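/- Let $d\ge 2$, and let $(Y_j,Z_j)$, $j=1,\dots,n$, be i.i.d. copies of $(Y,Z)$ with $Y$ real-valued and $Z$ in $\mathbb{R}^d$, independent of i.i.d. $X_1,\dots,X_m$ ($m\ge 1$) with Lebesgue density $f\le C_f$ on $\mathbb{R}^d$. Assume that the support $S$ of $Z$ is compact and convex with diameter $\rho''$, that $Z$ has a density $f_Z$ with $0<\rho\le f_Z\le\bar\rho$ on $S$, and that $S^*\subseteq S$ is a non-empty Borel set for which there is $\rho'>0$ such that the Euclidean balls $B_d(z,\rho')$, $z\in S^*$, are all contained in $S$. Assume $\mathrm{var}(Y\mid Z)\le C_V$ almost surely with $C_V>0$. For $l\in\mathbb{N}_0$, $0<\beta\le 1$, $C_H>0$, let $\mathcal{G}(l,\beta,C_H,C_G)$ be the class of functions $h$ on the interior of $S$ with partial derivatives of order $\le l$, with $|h|\le C_G$ and $|\partial_\kappa h(z)-\partial_\kappa h(z')|\le C_H\|z-z'\|^\beta$ for all $z,z'$ and all $|\kappa|=l$; let $G(z)=E[Y\mid Z=z]$. Put $$\Phi=E\Big[Y\,1_{S^*}(Z)\frac{f(Z)}{f_Z(Z)}\Big],\qquad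 \hat\Phi=\hat\Phi(L,K)=\frac1m\sum_{k=1}^m\ \sum_{J\subseteq\{1,\dots,n\},\,\#J=K}1\big(X_k\in C(J)\big)\,\hat G_J(X_k),$$ where $C(J)=\{z\in S^*:\|z-Z_j\|<\|z-Z_k\|\ \forall j\in J,\,k\notin J\}$ and $\hat G_J(z)$ is the value at $z$ of the least squares polynomial of total degree $\le L$ fitted to $(Z_j,Y_j)$, $j\in J$, i.e. $\hat G_J(z)=e_0^\top\big(\sum_{j\in J}\xi_j\xi_j^\top\big)^{-1}\sum_{j\in J}Y_j\xi_j$ with $\xi_j=\big((Z_j-z)^\kappa\big)_{|\kappa|\le L}$ and $e_0$ the unit vector of the index $\kappa=0$. Choose $L=l$, and let $K\ge 1$ if $l=0$, and $K\ge 2+(2D+1)K^*$ if $l\ge 1$, where $K^*=\binom{d+L}{L}$ and $D=\sum_{r=1}^{L}r\binom{d+r-1}{r}$. Then there is a constant $C>0$ that depends only on $L,K,\rho,\rho',\rho'',\bar\rho,d,\lambda(S^*)$ and $C_f$ (with $\lambda$ the Lebesgue measure) such that for all $n\ge K$ and $m\ge 1$ $$\sup_{G\in\mathcal{G}(l,\beta,C_H,C_G)}E\big[|\hat\Phi-\Phi|^2\big]\le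 C\Big((C_V+C_G^2)\,m^{-1}+C_V\,n^{-1}+C_H^2\,n^{-2(l+\beta)/d}\Big).$$ Consequently, if $l+\beta\ge d/2$, the supremum is at most $C'(n^{-1}+m^{-1})$ with $C'$ independent of $n$ and $m$; and if $l+\beta>d/2$, the contribution of the squared bias is negligible: $\sup_{G}E\big[|E[\hat\Phi\mid Z_1,\dots,Z_n]-\Phi|^2\big]=o(n^{-1})$, uniformly in $m$. -/

import Mathlib

open MeasureTheory ProbabilityTheory

universe u

/-- `ℝᵈ` with the Euclidean norm. -/
abbrev RSpace (d : ℕ) : Type := EuclideanSpace ℝ (Fin d)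

noncomputable section

/-- The multi-indices `κ ∈ ℕ₀ᵈ` with `|κ| ≤ L`. (Each entry is then at most `L`, so the entries
are taken in `{0, …, L}`, which makes the type visibly finite.) -/
abbrev MIdx (d L : ℕ) : Type := {κ : Fin d → Fin (L + 1) // ∑ i, (κ i : ℕ) ≤ L}

/-- The zero multi-index. -/
def MIdx.zero (d L : ℕ) : MIdx d L := ⟨fun _ => 0, by simp⟩

/-- The centered monomial `ξ_κ(z, w) = ∏ᵢ (wᵢ - zᵢ) ^ κᵢ`. -/
def xi {d L : ℕ} (z w : RSpace d) (κ : MIdx d L) : ℝ :=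
  ∏ i, (w i - z i) ^ (κ.1 i : ℕ)

/-- `K* = #{κ : |κ| ≤ L} = (d + L choose L)`. -/
def numMonomials (d L : ℕ) : ℕ := (d + L).choose L

/-- `D = ∑_{r=1}^L r * (d + r - 1 choose r)`. -/
def DConst (d L : ℕ) : ℕ := ∑ r ∈ Finset.Icc 1 L, r * (d + r - 1).choose r

/-- The Gram matrix `∑_{j ∈ J} ξ(z, Z_j) ξ(z, Z_j)ᵀ` of the least squares problem. -/
def gram {d n : ℕ} (L : ℕ) (Z : Fin n → RSpace d) (J : Finset (Fin n)) (z : RSpace d) :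
    Matrix (MIdx d L) (MIdx d L) ℝ :=
  ∑ j ∈ J, Matrix.vecMulVec (xi z (Z j)) (xi z (Z j))

/-- The moment vector `∑_{j ∈ J} Y_j ξ(z, Z_j)`. -/
def momentVec {d n : ℕ} (L : ℕ) (Z : Fin n → RSpace d) (Y : Fin n → ℝ) (J : Finset (Fin n))
    (z : RSpace d) : MIdx d L → ℝ :=
  ∑ j ∈ J, Y j • xi z (Z j)

/-- The value at `z` of the least squares polynomial of degree `L` fitted to `(Z_j, Y_j)`,
`j ∈ J`: the constant coefficient of the fit in the monomials centered at `z`. -/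
def localFit {d n : ℕ} (L : ℕ) (Z : Fin n → RSpace d) (Y : Fin n → ℝ) (J : Finset (Fin n))
    (z : RSpace d) : ℝ :=
  ((gram L Z J z)⁻¹.mulVec (momentVec L Z Y J z)) (MIdx.zero d L)

/-- The higher order Voronoi cell `C(J)` within `Sstar`. -/
def voronoiCell {d n : ℕ} (Sstar : Set (RSpace d)) (Z : Fin n → RSpace d)
    (J : Finset (Fin n)) : Set (RSpace d) :=
  {z ∈ Sstar | ∀ j ∈ J, ∀ k ∉ J, ‖z - Z j‖ < ‖z - Z k‖}

/-- The matching estimator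
`(1/m) ∑_k ∑_{J ⊆ {1,…,n}, #J = K} 1(X_k ∈ C(J)) Ĝ(X_k)`. -/
def matchingEstimator {d n m : ℕ} (L K : ℕ) (Sstar : Set (RSpace d)) (Z : Fin n → RSpace d)
    (Y : Fin n → ℝ) (X : Fin m → RSpace d) : ℝ :=
  (m : ℝ)⁻¹ * ∑ k, ∑ J ∈ (Finset.univ : Finset (Fin n)).powersetCard K,
    (voronoiCell Sstar Z J).indicator (localFit L Z Y J) (X k)

/-- The bounded Hölder class on an open set `O`: functions with continuous partial derivatives up
to order `l`, all of whose partial derivatives of order `l` are Hölder continuous on `O` with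
exponent `β` and constant `CH`, and that are bounded by `CG` on `O`. A partial derivative of
order `l` is given by the word `i₁ … i_l` of the directions of differentiation. (Continuity of the
partial derivatives of order at most `l` follows from the Hölder condition.) -/
structure IsBoundedHolder {d : ℕ} (O : Set (RSpace d)) (l : ℕ) (β CH CG : ℝ)
    (h : RSpace d → ℝ) : Prop where
  contDiffOn : ContDiffOn ℝ l h O
  holder : ∀ i : Fin l → Fin d, ∀ z ∈ O, ∀ z' ∈ O,
    |iteratedFDeriv ℝ l h z (fun r => EuclideanSpace.single (i r) (1 : ℝ)) -
      iteratedFDeriv ℝ l h z' (fun r => EuclideanSpace.single (i r) (1 : ℝ))|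
      ≤ CH * ‖z - z'‖ ^ β
  bounded : ∀ z ∈ O, |h z| ≤ CG

/-- The statistical model: a sample `(Y_1, Z_1), …, (Y_n, Z_n)` and an independent sample
`X_1, …, X_m`, with all the assumptions on the underlying distributions.

* `S` is the support of the covariate, `Sstar ⊆ S` the region of interest;
* `fZ` is the density of the covariate, `f` the density of each `X_k`;
* `Q` is the joint distribution of `(Z, Y)`;
* `G` is the regression function `G(z) = E[Y | Z = z]`. -/
structure MatchingModel (d n m l : ℕ) (ρ ρ' ρ'' ρbar lamS Cf β CH CG CV : ℝ) :
    Type (u + 1) where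
  S : Set (RSpace d)
  Sstar : Set (RSpace d)
  fZ : RSpace d → ℝ
  f : RSpace d → ℝ
  G : RSpace d → ℝ
  Q : Measure (RSpace d × ℝ)
  /-- Support and density of the covariate. -/
  isCompact_S : IsCompact S
  convex_S : Convex ℝ S
  diam_S : Metric.diam S = ρ''
  measurable_fZ : Measurable fZ
  fZ_lower : ∀ z ∈ S, ρ ≤ fZ z
  fZ_upper : ∀ z ∈ S, fZ z ≤ ρbar
  fZ_off : ∀ z ∉ S, fZ z = 0
  isProb_Q : IsProbabilityMeasure Q
  law_Z : Q.map Prod.fst = volume.withDensity (fun z => ENNReal.ofReal (fZ z))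
  /-- The region of interest, at distance at least `ρ'` from the boundary of the support. -/
  measurableSet_Sstar : MeasurableSet Sstar
  nonempty_Sstar : Sstar.Nonempty
  ball_subset : ∀ z ∈ Sstar, Metric.ball z ρ' ⊆ S
  volume_Sstar : volume.real Sstar = lamS
  /-- The regression function and the conditional variance. -/
  memLp_Y : MemLp (fun p : RSpace d × ℝ => p.2) 2 Q
  regression :
    Q[(fun p : RSpace d × ℝ => p.2) | MeasurableSpace.comap Prod.fst inferInstance]
      =ᵐ[Q] fun p => G p.1
  condVar_le :
    ∀ᵐ p ∂Q, (Var[(fun p : RSpace d × ℝ => p.2) ; Q |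
      MeasurableSpace.comap Prod.fst inferInstance]) p ≤ CV
  holder_G : IsBoundedHolder (interior S) l β CH CG G
  /-- The density of the additional sample. -/
  measurable_f : Measurable f
  f_nonneg : ∀ z, 0 ≤ f z
  f_le : ∀ z, f z ≤ Cf
  lintegral_f : ∫⁻ z, ENNReal.ofReal (f z) = 1
  /-- The probability space and the two samples. -/
  Ω : Type u
  mΩ : MeasurableSpace Ω
  P : Measure Ω
  isProb_P : IsProbabilityMeasure P
  Z : Fin n → Ω → RSpace d
  Y : Fin n → Ω → ℝ
  X : Fin m → Ω → RSpace d
  measurable_Z : ∀ j, Measurable (Z j)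
  measurable_Y : ∀ j, Measurable (Y j)
  measurable_X : ∀ k, Measurable (X k)
  law_ZY : ∀ j, P.map (fun ω => (Z j ω, Y j ω)) = Q
  law_X : ∀ k, P.map (X k) = volume.withDensity (fun z => ENNReal.ofReal (f z))
  indep_ZY : iIndepFun (fun j ω => (Z j ω, Y j ω)) P
  indep_X : iIndepFun X P
  indep_samples : IndepFun (fun ω j => (Z j ω, Y j ω)) (fun ω k => X k ω) P

namespace MatchingModel

variable {d n m l : ℕ} {ρ ρ' ρ'' ρbar lamS Cf β CH CG CV : ℝ}

instance (M : MatchingModel.{u} d n m l ρ ρ' ρ'' ρbar lamS Cf β CH CG CV) :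
    MeasurableSpace M.Ω := M.mΩ

/-- The target `Φ = E[Y 1_{S*}(Z) f(Z) / f_Z(Z)]`. -/
def Phi (M : MatchingModel.{u} d n m l ρ ρ' ρ'' ρbar lamS Cf β CH CG CV) : ℝ :=
  ∫ p, p.2 * M.Sstar.indicator (fun _ => (1 : ℝ)) p.1 * (M.f p.1 / M.fZ p.1) ∂M.Q

/-- The estimator `Φ̂(l, K)` as a random variable. -/
def PhiHat (M : MatchingModel.{u} d n m l ρ ρ' ρ'' ρbar lamS Cf β CH CG CV) (K : ℕ)
    (ω : M.Ω) : ℝ :=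
  matchingEstimator l K M.Sstar (fun j => M.Z j ω) (fun j => M.Y j ω) (fun k => M.X k ω)

/-- The σ-field generated by `Z_1, …, Z_n`. -/
abbrev sigmaZ (M : MatchingModel.{u} d n m l ρ ρ' ρ'' ρbar lamS Cf β CH CG CV) :
    MeasurableSpace M.Ω :=
  MeasurableSpace.comap (fun ω j => M.Z j ω) inferInstance

end MatchingModel

end

open scoped ENNReal

/-! The estimator is the mean over the `X k` of a linear smoother, the sum over `j` of `w x Z j * Y
j`, and the target is the integral of `1_{S*} G` against the law `ν` of `X`
(`MatchingModel.Phi_eq`). With the averaged weights `avgWeight`, the integrals of the `w x Z j` in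
`x` against `ν`, the error splits into three parts: the sampling error over the `X k`, centred given
the data; the noise, the sum of `(Y j - G (Z j)) * avgWeight j`, centred given the covariates; and a
bias `b` depending on the covariates only, which is therefore the conditional bias. Up to a factor 3
the risk is `1/m` times the mean integrated square of the fit, plus `CV` times the expected sum of
squared averaged weights, plus the mean square of `b` (`smootherMean_sub_memLp_and_integral`).

The squared weights of a local fit sum to the corner entry of the inverse Gram matrix, here
`fitVariance`. Taylor expansion bounds the squared bias of the fit by this variance factor times the
`2(l+β)`-th power of the neighbour radius. So both the weights and the bias are controlled by the
expectation of variance factor times radius to the power `a`. The variance factor is invariant under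
scaling, and a radius `r` for the `K` nearest neighbours costs a probability of order `exp(-c n
r^d)`. A change of scale by `n^(-1/d)` in dimension `dK` yields `n^(-K-a/d)` for each set `J` of
neighbours, and there are at most `n^K` such sets.

This needs the variance factor to be integrable over the unit ball of configurations, which is the
heart of the proof (`lintegral_closedBall_fitVariance_lt_top`). Least squares weights have minimal
norm among exact ones, so interpolation on any block of points bounds the factor by a constant times
the inverse squared determinant of that block. Taking the geometric mean over `2L+1` disjoint blocks
gives the power `-2/(2L+1)` of a polynomial that has degree at most `L` in each variable, and such a
power is integrable because `2L/(2L+1) < 1`.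

The noise gains its factor `1/n` from Cauchy-Schwarz: the weight of the `j`-th observation, as a
function of `x`, lives on the set of points having `Z j` among their `K` nearest neighbours, whose
volume is typically of order `1/n` (`exists_lintegral_catchmentMoment_le`). -/

/-! ### Negative powers of polynomials are integrable -/

theorem lintegral_Icc_enorm_rpow_neg_lt_top {r : ℝ} (hr : r < 1) :
    ∫⁻ t in Set.Icc (-1 : ℝ) 1, ‖t‖ₑ ^ (-r) < ∞ := by
  have h1 : ∫⁻ t in Set.Ioc (0 : ℝ) 1, ‖t‖ₑ ^ (-r) < ∞ := by
    have h := (intervalIntegral.intervalIntegrable_rpow' (a := 0) (b := 1) (r := -r)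
      (by linarith)).1.hasFiniteIntegral
    rw [HasFiniteIntegral] at h
    refine lt_of_le_of_lt (le_of_eq ?_) h
    refine setLIntegral_congr_fun measurableSet_Ioc fun t ht => ?_
    have ht0 : 0 < t := ht.1
    rw [Real.enorm_eq_ofReal ht0.le, Real.enorm_eq_ofReal (Real.rpow_nonneg ht0.le _),
      ENNReal.ofReal_rpow_of_pos ht0]
  have h2 : ∫⁻ t in Set.Ico (-1 : ℝ) 0, ‖t‖ₑ ^ (-r) < ∞ := by
    refine lt_of_le_of_lt (le_of_eq ?_) h1
    rw [← (Measure.measurePreserving_neg (volume : Measure ℝ)).setLIntegral_comp_preimage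
      measurableSet_Ioc (by fun_prop)]
    simp
  have h3 : ∫⁻ t in ({0} : Set ℝ), ‖t‖ₑ ^ (-r) < ∞ := by
    rw [Measure.restrict_singleton]; simp
  have hU : Set.Icc (-1 : ℝ) 1 ⊆ (Set.Ico (-1 : ℝ) 0 ∪ {0}) ∪ Set.Ioc (0 : ℝ) 1 := by
    intro t ht
    rcases lt_trichotomy t 0 with h | h | h
    · exact Or.inl (Or.inl ⟨ht.1, h⟩)
    · exact Or.inl (Or.inr h)
    · exact Or.inr ⟨h, ht.2⟩
  refine lt_of_le_of_lt (lintegral_mono_set hU) ?_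
  refine lt_of_le_of_lt (lintegral_union_le _ _ _) (ENNReal.add_lt_top.2 ⟨?_, h1⟩)
  exact lt_of_le_of_lt (lintegral_union_le _ _ _) (ENNReal.add_lt_top.2 ⟨h2, h3⟩)

/-- The bound is uniform in the centre: within distance 1 of `c` the integrand is a translate of one
fixed integrable function, and elsewhere it is at most 1. -/
theorem exists_lintegral_Icc_enorm_sub_rpow_neg_le {r : ℝ} (hr0 : 0 ≤ r) (hr : r < 1) :
    ∃ C : ℝ≥0∞, C < ∞ ∧ ∀ c : ℝ, ∫⁻ t in Set.Icc (-1 : ℝ) 1, ‖t - c‖ₑ ^ (-r) ≤ C := by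
  refine ⟨(∫⁻ t in Set.Icc (-1 : ℝ) 1, ‖t‖ₑ ^ (-r)) + 2,
    ENNReal.add_lt_top.2 ⟨lintegral_Icc_enorm_rpow_neg_lt_top hr, by simp⟩, fun c => ?_⟩
  have hpt : ∀ t : ℝ, ‖t - c‖ₑ ^ (-r) ≤
      (Set.Icc (-1 : ℝ) 1).indicator (fun u : ℝ => ‖u‖ₑ ^ (-r)) (t - c) + 1 := by
    intro t
    by_cases h : t - c ∈ Set.Icc (-1 : ℝ) 1
    · rw [Set.indicator_of_mem h]; exact le_self_add
    · rw [Set.indicator_of_notMem h, zero_add, ENNReal.rpow_neg]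
      rw [Set.mem_Icc, ← abs_le, not_le] at h
      have h1 : 1 ≤ ‖t - c‖ₑ := by
        rw [Real.enorm_eq_ofReal_abs]
        exact ENNReal.one_le_ofReal.2 h.le
      refine ENNReal.inv_le_one.2 ?_
      simpa using ENNReal.rpow_le_rpow h1 hr0
  refine (lintegral_mono hpt).trans ?_
  rw [lintegral_add_right _ measurable_const]
  refine add_le_add ?_ ?_
  · refine (setLIntegral_le_lintegral _ _).trans ?_
    rw [lintegral_sub_right_eq_self
      (fun u => (Set.Icc (-1 : ℝ) 1).indicator (fun u : ℝ => ‖u‖ₑ ^ (-r)) u) c,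
      lintegral_indicator measurableSet_Icc]
  · simp; norm_num

theorem prod_map_le_sum_toFinset_pow {α : Type*} [DecidableEq α] (m : Multiset α) (hm : m ≠ 0)
    (x : α → ℝ≥0∞) : (m.map x).prod ≤ ∑ r ∈ m.toFinset, x r ^ m.card := by
  obtain ⟨r0, hr0, hmax⟩ := Finset.exists_max_image m.toFinset x (by
    simpa [Finset.nonempty_iff_ne_empty] using hm)
  calc (m.map x).prod ≤ x r0 ^ (m.map x).card := by
        refine Multiset.prod_le_pow_card _ _ fun y hy => ?_
        obtain ⟨r, hr, rfl⟩ := Multiset.mem_map.1 hy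
        exact hmax r (Multiset.mem_toFinset.2 hr)
    _ = x r0 ^ m.card := by rw [Multiset.card_map]
    _ ≤ _ := Finset.single_le_sum (f := fun r => x r ^ m.card) (fun _ _ => zero_le) hr0

/-- Factor over the complex numbers. Replacing each root by its real part only decreases the factors
at real `t`, and a product of `k` factors is at most the sum of their `k`-th powers, so only
singularities of order `s * k < 1` remain. The constant depends on the degree alone, which is what
the induction on the number of variables needs. -/
theorem Polynomial.exists_lintegral_Icc_enorm_eval_rpow_neg_le {s : ℝ} (hs : 0 < s) (k : ℕ)
    (hk : s * k < 1) :
    ∃ C : ℝ≥0∞, C < ∞ ∧ ∀ q : Polynomial ℝ, q.natDegree = k →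
      ∫⁻ t in Set.Icc (-1 : ℝ) 1, ‖q.eval t‖ₑ ^ (-s) ≤ C * ‖q.leadingCoeff‖ₑ ^ (-s) := by
  obtain ⟨C, hC, hCb⟩ := exists_lintegral_Icc_enorm_sub_rpow_neg_le (r := s * k)
    (by positivity) hk
  -- `k * C` accounts for at most `k` distinct real parts. The 2 is the length of the interval,
  -- needed for `k = 0`; it also keeps the constant nonzero, so that for `q = 0` the right side is
  -- `∞`.
  refine ⟨2 + k * C, ENNReal.add_lt_top.2 ⟨by simp, ENNReal.mul_lt_top (by simp) hC⟩,
    fun q hq => ?_⟩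
  rcases eq_or_ne q 0 with rfl | hq0
  · have : (2 + k * C : ℝ≥0∞) ≠ 0 := by simp
    simp [ENNReal.zero_rpow_of_neg (neg_lt_zero.2 hs), ENNReal.mul_top this]
  set P : Polynomial ℂ := q.map (algebraMap ℝ ℂ) with hP
  have hsplit := IsAlgClosed.splits P
  have hcard : P.roots.card = k := by
    rw [← hsplit.natDegree_eq_card_roots, hP, Polynomial.natDegree_map, hq]
  have hlow : ∀ t : ℝ, ‖q.eval t‖ₑ ^ (-s) ≤
      ‖q.leadingCoeff‖ₑ ^ (-s) * (P.roots.map fun r => ‖t - r.re‖ₑ ^ (-s)).prod := by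
    intro t
    have h1 : ‖q.eval t‖ₑ = ‖q.leadingCoeff‖ₑ * (P.roots.map fun r => ‖(t : ℂ) - r‖ₑ).prod := by
      have h2 : ((q.eval t : ℝ) : ℂ) = P.eval (t : ℂ) := by
        rw [hP, Polynomial.eval_map_algebraMap]
        exact (Polynomial.aeval_algebraMap_apply ℂ t q).symm
      have h3 := hsplit.eval_eq_prod_roots (t : ℂ)
      have h4 : ‖q.eval t‖ₑ = ‖((q.eval t : ℝ) : ℂ)‖ₑ := by
        rw [← ofReal_norm, ← ofReal_norm, Complex.norm_real]
      have h5 : ‖q.leadingCoeff‖ₑ = ‖P.leadingCoeff‖ₑ := by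
        rw [hP, Polynomial.leadingCoeff_map, ← ofReal_norm, ← ofReal_norm]
        simp
      rw [h4, h2, h3, enorm_mul, h5]
      congr 1
      generalize P.roots = m
      induction m using Multiset.induction_on with
      | empty => simp
      | cons a m ih => simp [enorm_mul, ih]
    have h6 : ‖q.leadingCoeff‖ₑ * (P.roots.map fun r => ‖t - r.re‖ₑ).prod ≤ ‖q.eval t‖ₑ := by
      rw [h1]
      gcongr
      refine Multiset.prod_map_le_prod_map _ _ fun r _ => ?_
      rw [Real.enorm_eq_ofReal_abs, ← ofReal_norm]
      refine ENNReal.ofReal_le_ofReal ?_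
      simpa using Complex.abs_re_le_norm ((t : ℂ) - r)
    have h7 : ∀ m : Multiset ℂ, (m.map fun r => ‖t - r.re‖ₑ).prod ≠ ∞ ∧
        (m.map fun r => ‖t - r.re‖ₑ).prod ^ (-s) =
          (m.map fun r => ‖t - r.re‖ₑ ^ (-s)).prod := by
      intro m
      induction m using Multiset.induction_on with
      | empty => simp
      | cons a m ih =>
        simp only [Multiset.map_cons, Multiset.prod_cons]
        exact ⟨ENNReal.mul_ne_top enorm_ne_top ih.1, by
          rw [ENNReal.mul_rpow_of_ne_top enorm_ne_top ih.1, ih.2]⟩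
    rw [← (h7 _).2, ← ENNReal.mul_rpow_of_ne_top enorm_ne_top (h7 _).1]
    rw [ENNReal.rpow_neg, ENNReal.rpow_neg]
    exact ENNReal.inv_le_inv.2 (ENNReal.rpow_le_rpow h6 hs.le)
  refine (lintegral_mono hlow).trans ?_
  have hlc : ‖q.leadingCoeff‖ₑ ^ (-s) ≠ ∞ := by
    refine ENNReal.rpow_ne_top_of_ne_zero ?_ enorm_ne_top
    simpa using hq0
  rw [lintegral_const_mul' _ _ hlc, mul_comm]
  gcongr
  rcases Nat.eq_zero_or_pos k with hk0 | hk0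
  · have : P.roots = 0 := Multiset.card_eq_zero.1 (hcard.trans hk0)
    simp [this, hk0]
    norm_num
  · have hne : P.roots ≠ 0 := by
      intro h; rw [h] at hcard; simp at hcard; omega
    classical
    calc ∫⁻ t in Set.Icc (-1 : ℝ) 1, (P.roots.map fun r => ‖t - r.re‖ₑ ^ (-s)).prod
        ≤ ∫⁻ t in Set.Icc (-1 : ℝ) 1, ∑ r ∈ P.roots.toFinset, ‖t - r.re‖ₑ ^ (-(s * k)) := by
          refine lintegral_mono fun t => (prod_map_le_sum_toFinset_pow _ hne _).trans ?_
          refine Finset.sum_le_sum fun r _ => le_of_eq ?_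
          rw [hcard, ← ENNReal.rpow_natCast, ← ENNReal.rpow_mul, neg_mul]
      _ = ∑ r ∈ P.roots.toFinset, ∫⁻ t in Set.Icc (-1 : ℝ) 1, ‖t - r.re‖ₑ ^ (-(s * k)) :=
          lintegral_finsetSum _ fun r _ => by fun_prop
      _ ≤ ∑ r ∈ P.roots.toFinset, C := Finset.sum_le_sum fun r _ => hCb _
      _ ≤ k * C := by
          rw [Finset.sum_const, nsmul_eq_mul]
          gcongr
          exact (Multiset.toFinset_card_le _).trans hcard.le
      _ ≤ 2 + k * C := le_add_self

/-- Integrate out the first variable: the one-variable bound leaves the power `-s` of the leading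
coefficient, a nonzero polynomial in the other variables that satisfies the same degree bounds. -/
theorem MvPolynomial.lintegral_pi_enorm_eval_rpow_neg_lt_top {s : ℝ} (hs : 0 < s) (k : ℕ)
    (hk : s * k < 1) (N : ℕ) (p : MvPolynomial (Fin N) ℝ) (hp : p ≠ 0)
    (hdeg : ∀ i, p.degreeOf i ≤ k) :
    ∫⁻ u, ‖MvPolynomial.eval u p‖ₑ ^ (-s)
      ∂(Measure.pi fun _ : Fin N => (volume : Measure ℝ).restrict (Set.Icc (-1) 1)) < ∞ := by
  induction N with
  | zero =>
    have h : ∀ u : Fin 0 → ℝ, ‖MvPolynomial.eval u p‖ₑ ^ (-s) ≠ ∞ := fun u => by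
      refine ENNReal.rpow_ne_top_of_ne_zero ?_ enorm_ne_top
      rw [enorm_ne_zero]
      intro h
      apply hp
      rw [MvPolynomial.eq_C_of_isEmpty p] at h ⊢
      simpa using h
    rw [lintegral_unique]
    exact ENNReal.mul_lt_top (lt_top_iff_ne_top.2 (h _)) (measure_lt_top _ _)
  | succ N ih =>
    set ν := (volume : Measure ℝ).restrict (Set.Icc (-1) 1) with hν
    set q := MvPolynomial.finSuccEquiv ℝ N p with hq
    have hq0 : q ≠ 0 := by simpa [hq] using hp
    have hdq : q.natDegree ≤ k := by rw [hq, MvPolynomial.natDegree_finSuccEquiv]; exact hdeg 0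
    have hdk : s * q.natDegree < 1 := lt_of_le_of_lt (by gcongr) hk
    obtain ⟨C, hC, hCb⟩ := Polynomial.exists_lintegral_Icc_enorm_eval_rpow_neg_le hs _ hdk
    have hmp := (measurePreserving_piFinSuccAbove (fun _ : Fin (N + 1) => ν) 0).symm
    have hmeas : Measurable fun u : Fin (N + 1) → ℝ => ‖MvPolynomial.eval u p‖ₑ ^ (-s) := by
      have : Continuous fun u : Fin (N + 1) → ℝ => MvPolynomial.eval u p :=
        MvPolynomial.continuous_eval p
      exact this.measurable.enorm.pow_const _
    rw [← hmp.lintegral_comp hmeas]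
    refine lt_of_le_of_lt (lintegral_prod_symm' _ (hmeas.comp
      (MeasurableEquiv.piFinSuccAbove (fun _ : Fin (N + 1) => ℝ) 0).symm.measurable)).le ?_
    have hin : ∀ u : Fin N → ℝ, ∫⁻ t, ‖MvPolynomial.eval
        ((MeasurableEquiv.piFinSuccAbove (fun _ => ℝ) 0).symm (t, u)) p‖ₑ ^ (-s) ∂ν ≤
        (C + 1) * ‖MvPolynomial.eval u q.leadingCoeff‖ₑ ^ (-s) := by
      intro u
      -- Where the leading coefficient vanishes the degree drops and the one-variable bound is not
      -- available, but then the right side is `∞`. This is why the factor is `C + 1` and not `C`,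
      -- which might be 0.
      by_cases h0 : MvPolynomial.eval u q.leadingCoeff = 0
      · rw [h0]
        have : C + 1 ≠ 0 := by simp
        simp [ENNReal.zero_rpow_of_neg (neg_lt_zero.2 hs), ENNReal.mul_top this]
      · have hd : (q.map (MvPolynomial.eval u)).natDegree = q.natDegree :=
          Polynomial.natDegree_map_of_leadingCoeff_ne_zero _ h0
        have hl : (q.map (MvPolynomial.eval u)).leadingCoeff =
            MvPolynomial.eval u q.leadingCoeff :=
          Polynomial.leadingCoeff_map_of_leadingCoeff_ne_zero _ h0
        have h := hCb _ hd
        rw [hl] at h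
        refine le_trans (le_of_eq ?_) (h.trans (by gcongr; exact le_self_add))
        refine lintegral_congr fun t => ?_
        rw [hq, ← MvPolynomial.eval_eq_eval_mv_eval']
        congr 4
        exact (Fin.insertNth_zero' t u)
    refine lt_of_le_of_lt (lintegral_mono hin) ?_
    have hC1 : C + 1 ≠ ∞ := by simp [hC.ne]
    rw [lintegral_const_mul' _ _ hC1]
    refine ENNReal.mul_lt_top (lt_top_iff_ne_top.2 hC1) (ih _ ?_ fun i => ?_)
    · simpa using hq0
    · exact (MvPolynomial.degreeOf_coeff_finSuccEquiv p i _).trans (hdeg _)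

/-- A linear isomorphism onto the coordinate space carries Lebesgue measure to a multiple of
Lebesgue measure and the unit ball into the cube. -/
theorem MvPolynomial.lintegral_closedBall_enorm_eval_rpow_neg_lt_top {ι : Type*} [Fintype ι]
    {d : ℕ} {s : ℝ} (hs : 0 < s) (k : ℕ) (hk : s * k < 1) (p : MvPolynomial (ι × Fin d) ℝ)
    (hp : p ≠ 0) (hdeg : ∀ i, p.degreeOf i ≤ k) :
    ∫⁻ z in Metric.closedBall (0 : ι → RSpace d) 1,
      ‖MvPolynomial.eval (fun q => z q.1 q.2) p‖ₑ ^ (-s) < ∞ := by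
  set e : ι × Fin d ≃ Fin (Fintype.card (ι × Fin d)) := Fintype.equivFin _ with he
  set N := Fintype.card (ι × Fin d)
  let L₀ : (ι → RSpace d) ≃ₗ[ℝ] (Fin N → ℝ) :=
    { toFun := fun z i => z (e.symm i).1 (e.symm i).2
      invFun := fun u j => WithLp.toLp 2 fun i => u (e (j, i))
      map_add' := fun x y => by ext; simp
      map_smul' := fun c x => by ext; simp
      left_inv := fun z => by ext; simp
      right_inv := fun u => by ext; simp }
  let L : (ι → RSpace d) ≃L[ℝ] (Fin N → ℝ) := L₀.toContinuousLinearEquiv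
  have hL : ∀ z i, L z i = z (e.symm i).1 (e.symm i).2 := fun z i => rfl
  have : (Measure.map L (volume : Measure (ι → RSpace d))).IsAddHaarMeasure :=
    L.isAddHaarMeasure_map _
  have hmap : Measure.map L (volume : Measure (ι → RSpace d)) = _ :=
    Measure.isAddLeftInvariant_eq_smul _ volume
  set p' := MvPolynomial.rename e p with hp'
  have hpe : ∀ z : ι → RSpace d, MvPolynomial.eval (fun q => z q.1 q.2) p =
      MvPolynomial.eval (L z) p' := by
    intro z
    rw [hp', MvPolynomial.eval_rename]
    congr 2
    ext q
    simp [hL]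
  have hcont : Continuous fun u : Fin N → ℝ => MvPolynomial.eval u p' :=
    MvPolynomial.continuous_eval p'
  have hmeas : Measurable fun u : Fin N → ℝ => ‖MvPolynomial.eval u p'‖ₑ ^ (-s) :=
    hcont.measurable.enorm.pow_const _
  have hbox : MeasurableSet (Set.univ.pi fun _ : Fin N => Set.Icc (-1 : ℝ) 1) :=
    MeasurableSet.univ_pi fun _ => measurableSet_Icc
  have hsub : Metric.closedBall (0 : ι → RSpace d) 1 ⊆
      L ⁻¹' (Set.univ.pi fun _ : Fin N => Set.Icc (-1 : ℝ) 1) := by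
    intro z hz i _
    rw [mem_closedBall_zero_iff] at hz
    rw [hL, Set.mem_Icc, ← abs_le, ← Real.norm_eq_abs]
    exact (PiLp.norm_apply_le _ _).trans ((norm_le_pi_norm z _).trans hz)
  have hfin := MvPolynomial.lintegral_pi_enorm_eval_rpow_neg_lt_top hs k hk N p'
    (by simpa [hp'] using (MvPolynomial.rename_injective e e.injective).ne hp) (fun i => by
      rw [← e.apply_symm_apply i, hp', MvPolynomial.degreeOf_rename_of_injective e.injective]
      exact hdeg _)
  refine lt_of_le_of_lt (lintegral_mono_set hsub) ?_
  simp_rw [hpe]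
  rw [← setLIntegral_map hbox hmeas L.continuous.measurable, hmap, Measure.restrict_smul,
    lintegral_smul_measure]
  refine ENNReal.mul_lt_top (by simp) ?_
  rwa [volume_pi, Measure.restrict_pi_pi]

/-! ### Counting monomials -/

/-- Stars and bars: the slack `L - |κ|` is added as one more coordinate. -/
theorem card_MIdx_le (d L : ℕ) : Fintype.card (MIdx d L) ≤ numMonomials d L := by
  classical
  have h := Finset.card_finsuppAntidiag_nat_eq_choose (s := (Finset.univ : Finset (Fin (d + 1)))) L
  have h2 : numMonomials d L = (Finset.finsuppAntidiag (Finset.univ : Finset (Fin (d + 1))) L).card := by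
    rw [h, numMonomials, Finset.card_univ, Fintype.card_fin]
    congr 1
    omega
  rw [h2, ← Finset.card_univ]
  refine Finset.card_le_card_of_injOn (fun κ => Finsupp.equivFunOnFinite.symm
    (Fin.cons (L - ∑ i, (κ.1 i : ℕ)) fun i => (κ.1 i : ℕ))) ?_ ?_
  · intro κ _
    have := κ.2
    simp only [Finset.mem_coe, Finset.mem_finsuppAntidiag]
    refine ⟨?_, Finset.subset_univ _⟩
    simp only [Finsupp.equivFunOnFinite_symm_apply_apply, Fin.sum_univ_succ, Fin.cons_zero, Fin.cons_succ]
    omega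
  · intro κ _ κ' _ h
    have h' := Finsupp.equivFunOnFinite.symm.injective h
    have h'' := (Fin.cons_injective2 h').2
    ext i
    exact congrFun h'' i

theorem le_DConst (d L : ℕ) (hd : 1 ≤ d) : L ≤ DConst d L := by
  rcases Nat.eq_zero_or_pos L with rfl | hL
  · simp
  · have h : L * (d + L - 1).choose L ≤ DConst d L :=
      Finset.single_le_sum (f := fun r => r * (d + r - 1).choose r) (fun _ _ => Nat.zero_le _)
        (Finset.mem_Icc.2 ⟨hL, le_rfl⟩)
    have h2 : 1 ≤ (d + L - 1).choose L := Nat.choose_pos (by omega)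
    nlinarith

/-! ### Weights and variance factor of the least squares fit -/

noncomputable section

variable {d : ℕ} (L : ℕ) {ι : Type*} [Fintype ι]

/-- The Gram matrix of the monomials of degree at most `L` at the points `z j`. -/
def gramMat (z : ι → RSpace d) : Matrix (MIdx d L) (MIdx d L) ℝ :=
  ∑ j, Matrix.vecMulVec (xi 0 (z j)) (xi 0 (z j))

/-- The weight of the point `z j` in the least squares fit at the origin. -/
def fitWeight (z : ι → RSpace d) (j : ι) : ℝ :=
  ∑ κ, (gramMat L z)⁻¹ (MIdx.zero d L) κ * xi 0 (z j) κ

/-- The sum of the squared weights of the least squares fit at the origin, infinite if the fit is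
not unique. -/
def fitVariance (z : ι → RSpace d) : ℝ≥0∞ :=
  open Classical in
  if (gramMat L z).det = 0 then ∞
  else ENNReal.ofReal ((gramMat L z)⁻¹ (MIdx.zero d L) (MIdx.zero d L))

theorem xi_eq_xi_zero_sub (x w : RSpace d) : (xi x w : MIdx d L → ℝ) = xi 0 (w - x) := by
  ext κ; simp [xi]

theorem gramMat_apply (z : ι → RSpace d) (κ κ' : MIdx d L) :
    gramMat L z κ κ' = ∑ j, xi 0 (z j) κ * xi 0 (z j) κ' := by
  simp [gramMat, Matrix.sum_apply, Matrix.vecMulVec_apply]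

theorem gram_eq_gramMat {n : ℕ} (Z : Fin n → RSpace d) (J : Finset (Fin n)) (x : RSpace d) :
    gram L Z J x = gramMat L fun j : J => Z j - x := by
  rw [gram, gramMat, ← Finset.sum_coe_sort]
  simp_rw [xi_eq_xi_zero_sub L x]

theorem localFit_eq_sum {n : ℕ} (Z : Fin n → RSpace d) (Y : Fin n → ℝ) (J : Finset (Fin n))
    (x : RSpace d) :
    localFit L Z Y J x = ∑ j : J, fitWeight L (fun j : J => Z j - x) j * Y j := by
  rw [localFit, gram_eq_gramMat, momentVec, ← Finset.sum_coe_sort, Matrix.mulVec, dotProduct]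
  simp_rw [xi_eq_xi_zero_sub L x, fitWeight, Finset.sum_apply, Finset.mul_sum, Finset.sum_mul]
  rw [Finset.sum_comm]
  refine Finset.sum_congr rfl fun j _ => Finset.sum_congr rfl fun κ _ => ?_
  simp; ring

variable {L}

theorem sum_fitWeight_mul_xi {z : ι → RSpace d} (hz : (gramMat L z).det ≠ 0) (κ : MIdx d L) :
    ∑ j, fitWeight L z j * xi 0 (z j) κ = if κ = MIdx.zero d L then 1 else 0 := by
  have h : ((gramMat L z)⁻¹ * gramMat L z) (MIdx.zero d L) κ = if MIdx.zero d L = κ then 1 else 0 := by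
    rw [Matrix.nonsing_inv_mul _ (isUnit_iff_ne_zero.2 hz), Matrix.one_apply]
  simp_rw [eq_comm (a := κ)]
  rw [← h, Matrix.mul_apply]
  simp_rw [gramMat_apply, fitWeight, Finset.sum_mul, Finset.mul_sum]
  rw [Finset.sum_comm]
  simp_rw [mul_assoc]

/-- The least squares weights are a linear combination of the monomial vectors, so their inner
product with `v` depends only on the moments of `v`. It is thus the same for all exact weights,
which is the orthogonality behind minimality. -/
theorem sum_fitWeight_mul {z : ι → RSpace d} (v : ι → ℝ)
    (hv : ∀ κ, ∑ j, v j * xi 0 (z j) κ = if κ = MIdx.zero d L then 1 else 0) :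
    ∑ j, fitWeight L z j * v j = (gramMat L z)⁻¹ (MIdx.zero d L) (MIdx.zero d L) := by
  simp_rw [fitWeight, Finset.sum_mul]
  rw [Finset.sum_comm]
  have : ∀ κ, ∑ j, (gramMat L z)⁻¹ (MIdx.zero d L) κ * xi 0 (z j) κ * v j =
      (gramMat L z)⁻¹ (MIdx.zero d L) κ * if κ = MIdx.zero d L then 1 else 0 := by
    intro κ
    rw [← hv, Finset.mul_sum]
    exact Finset.sum_congr rfl fun j _ => by ring
  simp_rw [this]
  simp

theorem sum_fitWeight_sq {z : ι → RSpace d} (hz : (gramMat L z).det ≠ 0) :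
    ∑ j, fitWeight L z j ^ 2 = (gramMat L z)⁻¹ (MIdx.zero d L) (MIdx.zero d L) := by
  simp_rw [sq]
  exact sum_fitWeight_mul _ (sum_fitWeight_mul_xi hz)

theorem ofReal_sum_fitWeight_sq_le (z : ι → RSpace d) :
    ENNReal.ofReal (∑ j, fitWeight L z j ^ 2) ≤ fitVariance L z := by
  rw [fitVariance]
  split_ifs with h
  · exact le_top
  · rw [sum_fitWeight_sq h]

/-- By Pythagoras, the least squares weights have the smallest norm among all weights that reproduce
polynomials at the origin. -/
theorem gramMat_inv_le_of_exact {z : ι → RSpace d} (hz : (gramMat L z).det ≠ 0) (v : ι → ℝ)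
    (hv : ∀ κ, ∑ j, v j * xi 0 (z j) κ = if κ = MIdx.zero d L then 1 else 0) :
    (gramMat L z)⁻¹ (MIdx.zero d L) (MIdx.zero d L) ≤ ∑ j, v j ^ 2 := by
  have h1 := sum_fitWeight_mul (z := z) v hv
  have h2 := sum_fitWeight_sq hz
  have h3 : 0 ≤ ∑ j, (v j - fitWeight L z j) ^ 2 := Finset.sum_nonneg fun _ _ => sq_nonneg _
  have h4 : ∑ j, (v j - fitWeight L z j) ^ 2 =
      ∑ j, v j ^ 2 - 2 * ∑ j, fitWeight L z j * v j + ∑ j, fitWeight L z j ^ 2 := by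
    rw [Finset.mul_sum, ← Finset.sum_sub_distrib, ← Finset.sum_add_distrib]
    exact Finset.sum_congr rfl fun j _ => by ring
  rw [h1, h2] at h4
  linarith

/-- The matrix of the monomials at the points of a block. -/
def designMat (z : ι → RSpace d) (b : MIdx d L → ι) : Matrix (MIdx d L) (MIdx d L) ℝ :=
  Matrix.of fun a κ => xi 0 (z (b a)) κ

/-- A kernel vector of the Gram matrix is a polynomial vanishing at all the points; at the points of
the block this forces its coefficients to be zero. -/
theorem gramMat_det_ne_zero {z : ι → RSpace d} (b : MIdx d L → ι)
    (h : (designMat z b).det ≠ 0) : (gramMat L z).det ≠ 0 := by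
  intro h0
  obtain ⟨c, hc, hc0⟩ := Matrix.exists_mulVec_eq_zero_iff.2 h0
  apply hc
  have h1 : ∑ j, (∑ κ, xi 0 (z j) κ * c κ) ^ 2 = 0 := by
    have h2 : ∑ κ, c κ * (gramMat L z).mulVec c κ = 0 := by simp [hc0]
    rw [← h2]
    simp_rw [Matrix.mulVec, dotProduct, gramMat_apply, sq, Finset.sum_mul, Finset.mul_sum]
    rw [Finset.sum_comm]
    refine Finset.sum_congr rfl fun κ _ => ?_
    rw [Finset.sum_comm]
    refine Finset.sum_congr rfl fun κ' _ => Finset.sum_congr rfl fun j _ => by ring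
  rw [Finset.sum_eq_zero_iff_of_nonneg fun _ _ => sq_nonneg _] at h1
  refine Matrix.eq_zero_of_mulVec_eq_zero h ?_
  ext a
  have := h1 (b a) (Finset.mem_univ _)
  simpa [designMat, Matrix.mulVec, dotProduct] using this

theorem abs_xi_le_one {x : RSpace d} (hx : ‖x‖ ≤ 1) (κ : MIdx d L) : |xi 0 x κ| ≤ 1 := by
  rw [xi, Finset.abs_prod]
  refine Finset.prod_le_one (fun _ _ => abs_nonneg _) fun i _ => ?_
  rw [abs_pow]
  refine pow_le_one₀ (abs_nonneg _) ?_
  simpa using (PiLp.norm_apply_le x i).trans hx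

/-- Interpolation at the points of one block is an exact competitor. By Cramer's rule its weights
are cofactors over the determinant, and a cofactor is at most `N!` because the monomials are bounded
by 1 on the unit ball. -/
theorem fitVariance_le {z : ι → RSpace d} (hz : ‖z‖ ≤ 1) (b : MIdx d L → ι)
    (hb : Function.Injective b) :
    fitVariance L z ≤ ENNReal.ofReal (Fintype.card (MIdx d L) *
      ((Fintype.card (MIdx d L)).factorial : ℝ) ^ 2) * (‖(designMat z b).det‖ₑ ^ 2)⁻¹ := by
  classical
  set N := Fintype.card (MIdx d L) with hN
  have : Nonempty (MIdx d L) := ⟨MIdx.zero d L⟩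
  have hN0 : 0 < N := Fintype.card_pos
  set V := designMat z b with hV
  by_cases h : V.det = 0
  · rw [h]
    have : ENNReal.ofReal (N * (N.factorial : ℝ) ^ 2) ≠ 0 := by
      rw [ne_eq, ENNReal.ofReal_eq_zero, not_le]
      positivity
    rw [enorm_zero, zero_pow two_ne_zero, ENNReal.inv_zero, ENNReal.mul_top this]
    exact le_top
  · have hg := gramMat_det_ne_zero b h
    rw [fitVariance, if_neg hg]
    -- The row of `V⁻¹` for the zero index, placed on the block and extended by zero.
    set v : ι → ℝ := fun j => ∑ a, if b a = j then V⁻¹ (MIdx.zero d L) a else 0 with hv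
    have hvb : ∀ a, v (b a) = V⁻¹ (MIdx.zero d L) a := fun a => by
      simp [hv, hb.eq_iff]
    have hsum : ∀ g : ι → ℝ, ∑ j, v j * g j = ∑ a, V⁻¹ (MIdx.zero d L) a * g (b a) := by
      intro g
      simp_rw [hv, Finset.sum_mul]
      rw [Finset.sum_comm]
      simp
    have hex : ∀ κ, ∑ j, v j * xi 0 (z j) κ = if κ = MIdx.zero d L then 1 else 0 := by
      intro κ
      rw [hsum]
      have h1 : (V⁻¹ * V) (MIdx.zero d L) κ = if MIdx.zero d L = κ then 1 else 0 := by
        rw [Matrix.nonsing_inv_mul _ (isUnit_iff_ne_zero.2 h), Matrix.one_apply]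
      simp_rw [eq_comm (a := κ)]
      rw [← h1, Matrix.mul_apply]
      rfl
    have hent : ∀ a, |V⁻¹ (MIdx.zero d L) a| ≤ |V.det|⁻¹ * N.factorial := by
      intro a
      rw [Matrix.inv_def, Matrix.smul_apply, Ring.inverse_eq_inv', smul_eq_mul, abs_mul, abs_inv]
      gcongr
      rw [Matrix.adjugate_apply]
      have := Matrix.det_le (A := V.updateRow a (Pi.single (MIdx.zero d L) 1)) (abv := .abs) (x := (1 : ℝ)) ?_
      · simpa using this
      · intro i j
        rw [Matrix.updateRow_apply]
        split_ifs
        · by_cases hj : j = MIdx.zero d L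
          · subst hj; simp
          · simp [hj]
        · exact abs_xi_le_one ((norm_le_pi_norm z _).trans hz) _
    have hle : (gramMat L z)⁻¹ (MIdx.zero d L) (MIdx.zero d L) ≤
        N * (N.factorial : ℝ) ^ 2 * (|V.det| ^ 2)⁻¹ := by
      refine (gramMat_inv_le_of_exact hg v hex).trans ?_
      simp_rw [sq (v _)]
      rw [hsum]
      calc ∑ a, V⁻¹ (MIdx.zero d L) a * v (b a)
          ≤ ∑ a : MIdx d L, (|V.det|⁻¹ * N.factorial) ^ 2 := by
            refine Finset.sum_le_sum fun a _ => ?_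
            rw [hvb, ← sq, ← sq_abs]
            exact pow_le_pow_left₀ (abs_nonneg _) (hent a) 2
        _ = _ := by
            rw [Finset.sum_const, Finset.card_univ, nsmul_eq_mul, inv_eq_one_div, inv_eq_one_div]
            ring
    refine (ENNReal.ofReal_le_ofReal hle).trans (le_of_eq ?_)
    rw [ENNReal.ofReal_mul (by positivity), ENNReal.ofReal_inv_of_pos (by positivity),
      ENNReal.ofReal_pow (abs_nonneg _), Real.enorm_eq_ofReal_abs]

end

/-! ### Scale invariance and measurability of the variance factor -/

section Homogeneity

variable {d L : ℕ} {ι : Type*} [Fintype ι]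

theorem xi_zero_smul (t : ℝ) (w : RSpace d) (κ : MIdx d L) :
    xi 0 (t • w) κ = t ^ (∑ i, (κ.1 i : ℕ)) * xi 0 w κ := by
  simp only [xi, PiLp.smul_apply, smul_eq_mul, PiLp.zero_apply, sub_zero, mul_pow,
    Finset.prod_mul_distrib, Finset.prod_pow_eq_pow_sum]

theorem gramMat_smul (t : ℝ) (z : ι → RSpace d) :
    gramMat L (t • z) = Matrix.diagonal (fun κ : MIdx d L => t ^ (∑ i, (κ.1 i : ℕ))) * gramMat L z *
      Matrix.diagonal (fun κ : MIdx d L => t ^ (∑ i, (κ.1 i : ℕ))) := by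
  ext κ κ'
  rw [Matrix.mul_diagonal, Matrix.diagonal_mul, gramMat_apply, gramMat_apply, Finset.mul_sum,
    Finset.sum_mul]
  refine Finset.sum_congr rfl fun j _ => ?_
  rw [Pi.smul_apply, xi_zero_smul, xi_zero_smul]
  ring

/-- Scaling multiplies the Gram matrix on both sides by the diagonal matrix of the `t ^ |κ|`, whose
entry at the zero index is 1; the corner of the inverse is therefore unchanged. -/
theorem fitVariance_smul {t : ℝ} (ht : t ≠ 0) (z : ι → RSpace d) :
    fitVariance L (t • z) = fitVariance L z := by
  have hD : (Matrix.diagonal (fun κ : MIdx d L => t ^ (∑ i, (κ.1 i : ℕ)))).det ≠ 0 := by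
    rw [Matrix.det_diagonal]
    exact Finset.prod_ne_zero_iff.2 fun _ _ => pow_ne_zero _ ht
  have hDi : (Matrix.diagonal (fun κ : MIdx d L => t ^ (∑ i, (κ.1 i : ℕ))))⁻¹ =
      Matrix.diagonal (fun κ : MIdx d L => (t ^ (∑ i, (κ.1 i : ℕ)))⁻¹) := by
    refine Matrix.inv_eq_right_inv ?_
    rw [Matrix.diagonal_mul_diagonal, ← Matrix.diagonal_one]
    congr 1
    ext κ
    exact mul_inv_cancel₀ (pow_ne_zero _ ht)
  have hinv : (gramMat L (t • z))⁻¹ (MIdx.zero d L) (MIdx.zero d L) =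
      (gramMat L z)⁻¹ (MIdx.zero d L) (MIdx.zero d L) := by
    rw [gramMat_smul, Matrix.mul_inv_rev, Matrix.mul_inv_rev, hDi, ← mul_assoc,
      Matrix.mul_diagonal, Matrix.diagonal_mul]
    simp [MIdx.zero]
  have hdet : (gramMat L (t • z)).det = 0 ↔ (gramMat L z).det = 0 := by
    rw [gramMat_smul, Matrix.det_mul, Matrix.det_mul, mul_eq_zero, mul_eq_zero]
    exact ⟨fun h => (h.resolve_right hD).resolve_left hD, fun h => Or.inl (Or.inr h)⟩
  simp only [fitVariance, hdet, hinv]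

theorem continuous_xi_zero (κ : MIdx d L) : Continuous fun w : RSpace d => xi 0 w κ := by
  unfold xi
  fun_prop

theorem continuous_gramMat : Continuous fun z : ι → RSpace d => gramMat L z := by
  refine continuous_matrix fun κ κ' => ?_
  simp_rw [gramMat_apply]
  exact continuous_finsetSum _ fun j _ =>
    ((continuous_xi_zero κ).comp (continuous_apply j)).mul
      ((continuous_xi_zero κ').comp (continuous_apply j))

theorem measurable_gramMat_inv (κ κ' : MIdx d L) :
    Measurable fun z : ι → RSpace d => (gramMat L z)⁻¹ κ κ' := by
  simp_rw [Matrix.inv_def, Matrix.smul_apply, Ring.inverse_eq_inv', smul_eq_mul]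
  exact (continuous_gramMat.matrix_det.measurable.inv).mul
    (continuous_gramMat.matrix_adjugate.matrix_elem κ κ').measurable

theorem measurable_fitWeight (j : ι) : Measurable fun z : ι → RSpace d => fitWeight L z j := by
  unfold fitWeight
  exact Finset.measurable_sum _ fun κ _ => (measurable_gramMat_inv _ _).mul
    ((continuous_xi_zero κ).comp (continuous_apply j)).measurable

theorem measurable_fitVariance : Measurable fun z : ι → RSpace d => fitVariance L z := by
  classical
  unfold fitVariance
  refine Measurable.ite ?_ measurable_const (measurable_gramMat_inv _ _).ennreal_ofReal
  exact continuous_gramMat.matrix_det.measurable (measurableSet_singleton 0)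

end Homogeneity

/-! ### The determinant of a block as a polynomial -/

section DesignPolynomial

variable {d L : ℕ} {ι : Type*}

open Classical in
/-- The exponent of the monomial `κ` in the coordinates of the point `j`. -/
noncomputable def blockExponent (j : ι) (κ : MIdx d L) : ι × Fin d →₀ ℕ :=
  ∑ i, Finsupp.single (j, i) (κ.1 i : ℕ)

open Classical in
theorem blockExponent_apply (j : ι) (κ : MIdx d L) (q : ι × Fin d) :
    blockExponent j κ q = if j = q.1 then (κ.1 q.2 : ℕ) else 0 := by
  obtain ⟨a, i⟩ := q
  simp only [blockExponent, Finsupp.finsetSum_apply, Finsupp.single_apply, Prod.mk.injEq]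
  split_ifs with h <;> simp [h]

/-- The determinant of the design matrix of a block, as a polynomial in the coordinates. -/
noncomputable def designPoly (b : MIdx d L → ι) : MvPolynomial (ι × Fin d) ℝ :=
  (Matrix.of fun a κ => MvPolynomial.monomial (blockExponent (b a) κ) (1 : ℝ)).det

theorem eval_designPoly (b : MIdx d L → ι) (z : ι → RSpace d) :
    MvPolynomial.eval (fun q => z q.1 q.2) (designPoly b) = (designMat z b).det := by
  rw [designPoly, RingHom.map_det]
  congr 1
  ext a κ
  simp only [RingHom.mapMatrix_apply, Matrix.map_apply, Matrix.of_apply, designMat]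
  rw [MvPolynomial.eval_monomial, one_mul, blockExponent, ← Finsupp.prod_finsetSum_index
    (fun _ => pow_zero _) (fun _ _ _ => pow_add _ _ _), xi]
  refine Finset.prod_congr rfl fun i _ => ?_
  rw [Finsupp.prod_single_index (by exact pow_zero _)]
  simp

theorem designPoly_eq_sum (b : MIdx d L → ι) :
    designPoly b = ∑ σ : Equiv.Perm (MIdx d L), ((Equiv.Perm.sign σ : ℤ) : ℝ) •
      MvPolynomial.monomial (∑ κ, blockExponent (b (σ κ)) κ) (1 : ℝ) := by
  rw [designPoly, Matrix.det_apply']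
  refine Finset.sum_congr rfl fun σ _ => ?_
  rw [MvPolynomial.smul_eq_C_mul]
  simp only [Matrix.of_apply, MvPolynomial.monomial_sum_one, map_intCast]

open Classical in
theorem sum_blockExponent_apply {b : MIdx d L → ι} (hb : Function.Injective b)
    (σ : Equiv.Perm (MIdx d L)) (a : MIdx d L) (i : Fin d) :
    (∑ κ, blockExponent (b (σ κ)) κ) (b a, i) = ((σ.symm a).1 i : ℕ) := by
  rw [Finsupp.finsetSum_apply]
  simp_rw [blockExponent_apply, hb.eq_iff]
  rw [Finset.sum_eq_single (σ.symm a)]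
  · simp
  · intro κ _ hκ
    rw [if_neg]
    intro h
    exact hκ (by rw [← h]; simp)
  · simp

/-- Distinct permutations give distinct monomials, since the exponents of the point `b a` recover
`σ⁻¹ a`. So nothing cancels the coefficient 1 of the identity. -/
theorem designPoly_ne_zero {b : MIdx d L → ι} (hb : Function.Injective b) :
    designPoly b ≠ 0 := by
  classical
  intro h
  have h1 : MvPolynomial.coeff (∑ κ, blockExponent (b κ) κ) (designPoly b) = 1 := by
    rw [designPoly_eq_sum, MvPolynomial.coeff_sum, Finset.sum_eq_single 1]
    · simp
    · intro σ _ hσ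
      rw [MvPolynomial.coeff_smul, MvPolynomial.coeff_monomial, if_neg, smul_zero]
      intro he
      apply hσ
      have h2 : ∀ a, σ.symm a = a := by
        intro a
        ext i
        rw [← sum_blockExponent_apply hb σ a i, he]
        exact sum_blockExponent_apply hb 1 a i
      ext1 a
      rw [Equiv.Perm.one_apply]
      conv_lhs => rw [← h2 a]
      simp
    · simp
  rw [h] at h1
  simp at h1

/-- In each term of the determinant a point occurs in only one row, so its coordinates carry a
single multi-index, with entries at most `L`. -/
theorem degreeOf_designPoly_le {b : MIdx d L → ι} (hb : Function.Injective b) (q : ι × Fin d) :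
    (designPoly b).degreeOf q ≤ L := by
  classical
  rw [designPoly_eq_sum]
  refine (MvPolynomial.degreeOf_sum_le _ _ _).trans (Finset.sup_le fun σ _ => ?_)
  rw [MvPolynomial.smul_eq_C_mul]
  refine (MvPolynomial.degreeOf_C_mul_le _ _ _).trans ?_
  rw [MvPolynomial.degreeOf_monomial_eq _ _ one_ne_zero]
  obtain ⟨j, i⟩ := q
  by_cases hj : ∃ a, b a = j
  · obtain ⟨a, rfl⟩ := hj
    rw [sum_blockExponent_apply hb]
    exact Nat.lt_succ_iff.1 ((σ.symm a).1 i).2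
  · rw [Finsupp.finsetSum_apply, Finset.sum_eq_zero]
    · exact Nat.zero_le _
    · intro κ _
      rw [blockExponent_apply, if_neg fun h => hj ⟨_, h⟩]

theorem degreeOf_designPoly_eq_zero {b : MIdx d L → ι} {q : ι × Fin d} (hq : ∀ a, b a ≠ q.1) :
    (designPoly b).degreeOf q = 0 := by
  classical
  rw [← Nat.le_zero, designPoly_eq_sum]
  refine (MvPolynomial.degreeOf_sum_le _ _ _).trans (Finset.sup_le fun σ _ => ?_)
  rw [MvPolynomial.smul_eq_C_mul]
  refine (MvPolynomial.degreeOf_C_mul_le _ _ _).trans ?_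
  rw [MvPolynomial.degreeOf_monomial_eq _ _ one_ne_zero, Finsupp.finsetSum_apply,
    Finset.sum_eq_zero]
  intro κ _
  rw [blockExponent_apply, if_neg (hq _)]

end DesignPolynomial

/-! ### Integrability of the variance factor -/

/-- The geometric mean of the `M` bounds. It trades the exponent `-2` for one determinant against
`-2/M` for the product. -/
theorem le_mul_enorm_prod_rpow {M : ℕ} (hM : 0 < M) {x C : ℝ≥0∞} (D : Fin M → ℝ)
    (h : ∀ β, x ≤ C * (‖D β‖ₑ ^ 2)⁻¹) :
    x ≤ C * ‖∏ β, D β‖ₑ ^ (-(2 / M : ℝ)) := by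
  have hM0 : (M : ℝ) ≠ 0 := by positivity
  have h1 : x ^ M ≤ C ^ M * (‖∏ β, D β‖ₑ ^ 2)⁻¹ := by
    calc x ^ M = ∏ _β : Fin M, x := by simp
      _ ≤ ∏ β, C * (‖D β‖ₑ ^ 2)⁻¹ := Finset.prod_le_prod' fun β _ => h β
      _ = _ := by
        rw [Finset.prod_mul_distrib, Finset.prod_const, Finset.card_univ, Fintype.card_fin,
          ← ENNReal.prod_inv_distrib, Finset.prod_pow]
        · congr 3
          rw [← ofReal_norm, norm_prod, ENNReal.ofReal_prod_of_nonneg fun _ _ => norm_nonneg _]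
          exact Finset.prod_congr rfl fun β _ => (ofReal_norm _).symm
        · intro _ _ _ _ _
          exact Or.inr (by simp)
  have h2 := ENNReal.rpow_le_rpow h1 (z := (M : ℝ)⁻¹) (by positivity)
  rw [ENNReal.mul_rpow_of_nonneg _ _ (by positivity), ← ENNReal.rpow_natCast, ← ENNReal.rpow_natCast,
    ← ENNReal.rpow_mul, ← ENNReal.rpow_mul, mul_inv_cancel₀ hM0, ENNReal.rpow_one,
    ENNReal.rpow_one] at h2
  refine h2.trans (le_of_eq ?_)
  congr 1
  rw [← ENNReal.rpow_natCast, ← ENNReal.rpow_neg, ← ENNReal.rpow_mul]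
  congr 1
  push_cast
  ring

/-- The variance factor of the local fit is integrable over the unit ball if there are enough
points. -/
theorem lintegral_closedBall_fitVariance_lt_top {d L : ℕ} {ι : Type*} [Fintype ι] (hd : 1 ≤ d)
    (hι : (2 * DConst d L + 1) * numMonomials d L ≤ Fintype.card ι) :
    ∫⁻ z in Metric.closedBall (0 : ι → RSpace d) 1, fitVariance L z < ∞ := by
  -- The smallest number of blocks for which `L * (2 / M) < 1`. As `L ≤ DConst d L`, there are
  -- enough points for `M` disjoint blocks.
  set M := 2 * L + 1 with hM
  have hcard : Fintype.card (Fin M × MIdx d L) ≤ Fintype.card ι := by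
    rw [Fintype.card_prod, Fintype.card_fin]
    refine le_trans ?_ hι
    exact Nat.mul_le_mul (by have := le_DConst d L hd; omega) (card_MIdx_le d L)
  obtain ⟨b⟩ := Function.Embedding.nonempty_of_card_le hcard
  have hbβ : ∀ β, Function.Injective fun a => b (β, a) := fun β a a' h => by
    simpa using b.injective h
  set p : MvPolynomial (ι × Fin d) ℝ := ∏ β : Fin M, designPoly fun a => b (β, a) with hp
  have hp0 : p ≠ 0 := Finset.prod_ne_zero_iff.2 fun β _ => designPoly_ne_zero (hbβ β)
  -- The blocks are disjoint, so each coordinate occurs in at most one factor and the degrees do not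
  -- add up.
  have hdeg : ∀ q, p.degreeOf q ≤ L := by
    intro q
    refine (MvPolynomial.degreeOf_prod_le q _ _).trans ?_
    by_cases hq : ∃ y, b y = q.1
    · obtain ⟨⟨β₀, a₀⟩, hq⟩ := hq
      rw [Finset.sum_eq_single β₀]
      · exact degreeOf_designPoly_le (hbβ β₀) q
      · intro β _ hβ
        refine degreeOf_designPoly_eq_zero fun a h => hβ ?_
        have := b.injective (h.trans hq.symm)
        exact (Prod.mk.inj this).1
      · simp
    · rw [Finset.sum_eq_zero]
      · exact Nat.zero_le _
      · intro β _
        exact degreeOf_designPoly_eq_zero fun a h => hq ⟨_, h⟩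
  have hMpos : (0 : ℝ) < M := by positivity
  have hfin := MvPolynomial.lintegral_closedBall_enorm_eval_rpow_neg_lt_top (s := 2 / M)
    (by positivity) L (by
      rw [div_mul_eq_mul_div, div_lt_one hMpos, hM]
      push_cast
      linarith) p hp0 hdeg
  set C := ENNReal.ofReal (Fintype.card (MIdx d L) *
      ((Fintype.card (MIdx d L)).factorial : ℝ) ^ 2) with hC
  have hle : ∀ z ∈ Metric.closedBall (0 : ι → RSpace d) 1, fitVariance L z ≤
      C * ‖MvPolynomial.eval (fun q => z q.1 q.2) p‖ₑ ^ (-(2 / M : ℝ)) := by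
    intro z hz
    rw [hp, map_prod]
    refine le_mul_enorm_prod_rpow (by positivity) _ fun β => ?_
    rw [eval_designPoly]
    exact fitVariance_le (mem_closedBall_zero_iff.1 hz) _ (hbβ β)
  refine lt_of_le_of_lt (setLIntegral_mono' Metric.isClosed_closedBall.measurableSet hle) ?_
  rw [lintegral_const_mul' _ _ ENNReal.ofReal_ne_top]
  exact ENNReal.mul_lt_top ENNReal.ofReal_lt_top hfin

/-! ### Radial integration of scale invariant functions -/

section Radial

variable {V : Type*} [NormedAddCommGroup V] [NormedSpace ℝ V] [FiniteDimensional ℝ V]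
  [MeasurableSpace V] [BorelSpace V] (μ : Measure V) [μ.IsAddHaarMeasure]

theorem lintegral_eq_ofReal_pow_mul_lintegral_comp_smul {τ : ℝ} (hτ : 0 < τ) {g : V → ℝ≥0∞}
    (hg : Measurable g) :
    ∫⁻ z, g z ∂μ = ENNReal.ofReal (τ ^ Module.finrank ℝ V) * ∫⁻ u, g (τ • u) ∂μ := by
  have h := lintegral_map hg (measurable_const_smul (α := V) τ) (μ := μ)
  rw [Measure.map_addHaar_smul μ hτ.ne', lintegral_smul_measure] at h
  rw [← h, smul_eq_mul, ← mul_assoc, ← ENNReal.ofReal_mul (by positivity),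
    abs_of_pos (by positivity), mul_inv_cancel₀ (by positivity), ENNReal.ofReal_one, one_mul]

theorem setLIntegral_closedBall_of_homogeneous {F : V → ℝ≥0∞} (hF : Measurable F)
    (hhom : ∀ t : ℝ, 0 < t → ∀ z, F (t • z) = F z) {t : ℝ} (ht : 0 < t) :
    ∫⁻ z in Metric.closedBall 0 t, F z ∂μ =
      ENNReal.ofReal (t ^ Module.finrank ℝ V) * ∫⁻ z in Metric.closedBall 0 1, F z ∂μ := by
  rw [← lintegral_indicator Metric.isClosed_closedBall.measurableSet,
    ← lintegral_indicator Metric.isClosed_closedBall.measurableSet,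
    lintegral_eq_ofReal_pow_mul_lintegral_comp_smul μ ht
      (hF.indicator Metric.isClosed_closedBall.measurableSet)]
  congr 1
  congr 1
  ext z
  have : t • z ∈ Metric.closedBall (0 : V) t ↔ z ∈ Metric.closedBall (0 : V) 1 := by
    rw [mem_closedBall_zero_iff, mem_closedBall_zero_iff, norm_smul, Real.norm_of_nonneg ht.le]
    constructor
    · intro h; nlinarith
    · intro h; nlinarith
  by_cases hz : z ∈ Metric.closedBall (0 : V) 1
  · rw [Set.indicator_of_mem hz, Set.indicator_of_mem (this.2 hz), hhom t ht]
  · rw [Set.indicator_of_notMem hz, Set.indicator_of_notMem (mt this.1 hz)]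

/-- Cut space by the integer part `k` of the norm: the weight is at most `(k+2)^A exp(-ck)` there,
and by homogeneity the mass of `F` on the ball of radius `k+1` grows only like `(k+1)^D`. -/
theorem lintegral_homogeneous_mul_exp_lt_top {F : V → ℝ≥0∞} (hF : Measurable F)
    (hhom : ∀ t : ℝ, 0 < t → ∀ z, F (t • z) = F z)
    (hH : ∫⁻ z in Metric.closedBall 0 1, F z ∂μ < ∞) {c : ℝ} (hc : 0 < c) {p : ℕ} (hp : p ≠ 0)
    (A : ℕ) :
    ∫⁻ z, F z * ENNReal.ofReal ((1 + ‖z‖) ^ A * Real.exp (-(c * ‖z‖ ^ p))) ∂μ < ∞ := by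
  set D := Module.finrank ℝ V with hD
  set H := ∫⁻ z in Metric.closedBall 0 1, F z ∂μ with hHdef
  set w : ℕ → ℝ := fun k => ((k : ℝ) + 2) ^ A * Real.exp (-(c * k)) with hw
  have hpt : ∀ z : V, F z * ENNReal.ofReal ((1 + ‖z‖) ^ A * Real.exp (-(c * ‖z‖ ^ p))) ≤
      ∑' k : ℕ, ENNReal.ofReal (w k) * (Metric.closedBall (0 : V) (k + 1)).indicator F z := by
    intro z
    refine le_trans ?_ (ENNReal.le_tsum ⌊‖z‖⌋₊)
    have h1 : (⌊‖z‖⌋₊ : ℝ) ≤ ‖z‖ := Nat.floor_le (norm_nonneg _)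
    have h2 : ‖z‖ < ⌊‖z‖⌋₊ + 1 := Nat.lt_floor_add_one _
    rw [Set.indicator_of_mem (by rw [mem_closedBall_zero_iff]; exact h2.le), mul_comm]
    have h3 : 1 + ‖z‖ ≤ (⌊‖z‖⌋₊ : ℝ) + 2 := by linarith
    -- This uses that the floor is an integer: `k ≤ k ^ p` would fail for real `k` strictly between
    -- 0 and 1 when `p > 1`.
    have h4 : (⌊‖z‖⌋₊ : ℝ) ≤ ‖z‖ ^ p :=
      calc (⌊‖z‖⌋₊ : ℝ) ≤ (⌊‖z‖⌋₊ : ℝ) ^ p := by exact_mod_cast Nat.le_self_pow hp _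
        _ ≤ ‖z‖ ^ p := by gcongr
    refine mul_le_mul_left (ENNReal.ofReal_le_ofReal ?_) _
    exact mul_le_mul (pow_le_pow_left₀ (by positivity) h3 _)
      (Real.exp_le_exp.2 (neg_le_neg (mul_le_mul_of_nonneg_left h4 hc.le))) (by positivity)
      (by positivity)
  refine lt_of_le_of_lt (lintegral_mono hpt) ?_
  rw [lintegral_tsum fun k => ((hF.indicator
    Metric.isClosed_closedBall.measurableSet).const_mul _).aemeasurable]
  have hterm : ∀ k : ℕ, ∫⁻ z, ENNReal.ofReal (w k) *
      (Metric.closedBall (0 : V) (k + 1)).indicator F z ∂μ ≤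
      ENNReal.ofReal (((k : ℝ) + 2) ^ (A + D) * Real.exp (-(c * k))) * H := by
    intro k
    rw [lintegral_const_mul' _ _ ENNReal.ofReal_ne_top,
      lintegral_indicator Metric.isClosed_closedBall.measurableSet,
      setLIntegral_closedBall_of_homogeneous μ hF hhom (by positivity), ← mul_assoc,
      ← ENNReal.ofReal_mul (by positivity)]
    refine mul_le_mul_left (ENNReal.ofReal_le_ofReal ?_) _
    have h5 : ((k : ℝ) + 1) ^ D ≤ ((k : ℝ) + 2) ^ D := by gcongr; norm_num
    have h6 : 0 ≤ w k := by positivity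
    calc w k * ((k : ℝ) + 1) ^ D ≤ w k * ((k : ℝ) + 2) ^ D := mul_le_mul_of_nonneg_left h5 h6
      _ = _ := by rw [hw, pow_add]; ring
  refine lt_of_le_of_lt (ENNReal.tsum_le_tsum hterm) ?_
  rw [ENNReal.tsum_mul_right]
  refine ENNReal.mul_lt_top ?_ hH
  have hsum : Summable fun k : ℕ => ((k : ℝ) + 2) ^ (A + D) * Real.exp (-(c * k)) := by
    have h := (summable_nat_add_iff 2).2 (Real.summable_pow_mul_exp_neg_nat_mul (A + D) hc)
    refine (h.mul_right (Real.exp (c * 2))).congr fun k => ?_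
    rw [mul_assoc, ← Real.exp_add]
    push_cast
    congr 2
    ring
  rw [← ENNReal.ofReal_tsum_of_nonneg (fun k => by positivity) hsum]
  exact ENNReal.ofReal_lt_top

/-- Scaling of the moments of a homogeneous function with respect to a rapidly decaying weight. -/
theorem exists_lintegral_homogeneous_rpow_mul_exp_le {F : V → ℝ≥0∞} (hF : Measurable F)
    (hhom : ∀ t : ℝ, 0 < t → ∀ z, F (t • z) = F z)
    (hH : ∫⁻ z in Metric.closedBall 0 1, F z ∂μ < ∞) {c : ℝ} (hc : 0 < c) {p : ℕ} (hp : p ≠ 0)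
    (A : ℕ) :
    ∃ C : ℝ≥0∞, C < ∞ ∧ ∀ τ a : ℝ, 0 < τ → 0 ≤ a → a ≤ A →
      ∫⁻ z, F z * ENNReal.ofReal (‖z‖ ^ a * Real.exp (-(c * (‖z‖ / τ) ^ p))) ∂μ ≤
        C * ENNReal.ofReal (τ ^ ((Module.finrank ℝ V : ℝ) + a)) := by
  -- The factor `(1 + ‖z‖) ^ A` dominates every `‖z‖ ^ a` with `a ≤ A`, so the constant does not
  -- depend on `a`; eventually this makes it independent of `β`. The power of `τ` comes from the
  -- substitution `z = τ u`.
  refine ⟨_, lintegral_homogeneous_mul_exp_lt_top μ hF hhom hH hc hp A,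
    fun τ a hτ ha haA => ?_⟩
  have hmeas : Measurable fun z : V =>
      F z * ENNReal.ofReal (‖z‖ ^ a * Real.exp (-(c * (‖z‖ / τ) ^ p))) := by fun_prop
  rw [lintegral_eq_ofReal_pow_mul_lintegral_comp_smul μ hτ hmeas, Real.rpow_add hτ,
    Real.rpow_natCast, ENNReal.ofReal_mul (by positivity), mul_comm, mul_comm (ENNReal.ofReal (τ ^ _)),
    ← mul_assoc]
  gcongr
  rw [← lintegral_mul_const' _ _ ENNReal.ofReal_ne_top]
  refine lintegral_mono fun z => ?_
  rw [hhom τ hτ, mul_assoc, ← ENNReal.ofReal_mul (by positivity), norm_smul,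
    Real.norm_of_nonneg hτ.le, mul_div_cancel_left₀ _ hτ.ne', Real.mul_rpow hτ.le (norm_nonneg _)]
  have h7 : ‖z‖ ^ a ≤ (1 + ‖z‖) ^ A := by
    rw [← Real.rpow_natCast]
    calc ‖z‖ ^ a ≤ (1 + ‖z‖) ^ a := by gcongr; linarith
      _ ≤ (1 + ‖z‖) ^ (A : ℝ) :=
        Real.rpow_le_rpow_of_exponent_le (by linarith [norm_nonneg z]) haA
  refine mul_le_mul_right (ENNReal.ofReal_le_ofReal ?_) _
  calc τ ^ a * ‖z‖ ^ a * Real.exp (-(c * ‖z‖ ^ p))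
      ≤ τ ^ a * (1 + ‖z‖) ^ A * Real.exp (-(c * ‖z‖ ^ p)) := by gcongr
    _ = _ := by ring

end Radial

/-! ### Taylor expansion and the bias of a local fit -/

theorem hasDerivAt_sum_range_pow_div_factorial (a : ℕ → ℝ) (l : ℕ) (t : ℝ) :
    HasDerivAt (fun t : ℝ => ∑ i ∈ Finset.range (l + 1), a i * (t ^ i / i.factorial))
      (∑ i ∈ Finset.range l, a (i + 1) * (t ^ i / i.factorial)) t := by
  simp_rw [Finset.sum_range_succ' _ l]
  simp only [pow_zero, Nat.factorial_zero, Nat.cast_one, div_one, mul_one]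
  refine HasDerivAt.add_const _ (HasDerivAt.fun_sum fun i _ => HasDerivAt.const_mul _ ?_)
  have h := (hasDerivAt_pow (i + 1) t).div_const ((i + 1).factorial : ℝ)
  convert h using 1
  rw [Nat.factorial_succ]
  have h1 : ((i + 1 : ℕ) : ℝ) ≠ 0 := by positivity
  have h2 : ((i.factorial : ℕ) : ℝ) ≠ 0 := by positivity
  push_cast
  push_cast at h1
  field_simp

/-- A Taylor estimate for a chain of derivatives on the unit interval. -/
theorem abs_sub_taylor_le_of_hasDerivAt {B : ℝ} (l : ℕ) (g : ℕ → ℝ → ℝ)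
    (hg : ∀ k < l, ∀ t ∈ Set.Icc (0 : ℝ) 1, HasDerivAt (g k) (g (k + 1) t) t)
    (hB : ∀ t ∈ Set.Icc (0 : ℝ) 1, |g l t - g l 0| ≤ B) :
    ∀ t ∈ Set.Icc (0 : ℝ) 1,
      |g 0 t - ∑ i ∈ Finset.range (l + 1), g i 0 * (t ^ i / i.factorial)| ≤ B := by
  induction l generalizing g with
  | zero => intro t ht; simpa using hB t ht
  | succ l ih =>
    intro t ht
    -- The derivative of the remainder is the remainder of one order less for the shifted chain. It
    -- is bounded by `B`, and the remainder vanishes at 0, so the mean value inequality keeps the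
    -- bound `B`.
    have h1 := ih (fun k => g (k + 1)) (fun k hk => hg (k + 1) (by omega)) hB
    have hB0 : 0 ≤ B := (abs_nonneg _).trans (hB 0 (by simp))
    have h2 := (convex_Icc (0 : ℝ) 1).norm_image_sub_le_of_norm_hasDerivWithin_le
      (f := fun t => g 0 t - ∑ i ∈ Finset.range (l + 1 + 1), g i 0 * (t ^ i / i.factorial))
      (f' := fun t => g (0 + 1) t - ∑ i ∈ Finset.range (l + 1), g (i + 1) 0 * (t ^ i / i.factorial))
      (C := B) (fun t ht => ((hg 0 (by omega) t ht).sub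
        (hasDerivAt_sum_range_pow_div_factorial (fun i => g i 0) (l + 1) t)).hasDerivWithinAt)
      (fun t ht => h1 t ht) (x := 0) (y := t) (by simp) ht
    have h3 : g 0 0 - ∑ i ∈ Finset.range (l + 1 + 1), g i 0 * ((0 : ℝ) ^ i / i.factorial) = 0 := by
      rw [Finset.sum_range_succ']
      simp
    simp only [h3, sub_zero, Real.norm_eq_abs] at h2
    refine h2.trans ?_
    rw [abs_of_nonneg ht.1]
    exact mul_le_of_le_one_right hB0 ht.2

section LocalBias

variable {d l : ℕ}

theorem multilinear_diag_eq_sum {k : ℕ}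
    (T : ContinuousMultilinearMap ℝ (fun _ : Fin k => RSpace d) ℝ) (v : RSpace d) :
    T (fun _ => v) = ∑ i : Fin k → Fin d,
      (∏ r, v (i r)) * T (fun r => EuclideanSpace.single (i r) (1 : ℝ)) := by
  have hv : v = ∑ i, v i • EuclideanSpace.single i (1 : ℝ) := by
    ext j
    simp [Pi.single_apply]
  conv_lhs => rw [hv]
  have h := T.toMultilinearMap.map_sum (fun (_ : Fin k) (i : Fin d) =>
    v i • EuclideanSpace.single i (1 : ℝ))
  refine h.trans (Finset.sum_congr rfl fun i _ => ?_)
  exact T.toMultilinearMap.map_smul_univ (fun r => v (i r)) _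

theorem sum_abs_coord_le (v : RSpace d) : ∑ i, |v i| ≤ d * ‖v‖ := by
  calc ∑ i, |v i| ≤ ∑ _i : Fin d, ‖v‖ := Finset.sum_le_sum fun i _ => PiLp.norm_apply_le v i
    _ = d * ‖v‖ := by simp

/-- Restrict to the segment from `x` to `x + v`. The increment of the `l`-th derivative in direction
`v` is a sum over words, each controlled by the Hölder condition; the factor `d ^ l` comes from
bounding the coordinate sum of `v` by `d * ‖v‖`. -/
theorem IsBoundedHolder.abs_sub_taylor_le {O : Set (RSpace d)} (hO : IsOpen O) (hconv : Convex ℝ O)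
    {β CH CG : ℝ} (hβ : 0 < β) (hCH : 0 ≤ CH) {h : RSpace d → ℝ}
    (hh : IsBoundedHolder O l β CH CG h) {x v : RSpace d} (hx : x ∈ O) (hv : x + v ∈ O) :
    |h (x + v) - ∑ k ∈ Finset.range (l + 1),
      iteratedFDeriv ℝ k h x (fun _ => v) * (1 / k.factorial)| ≤
      (d : ℝ) ^ l * CH * ‖v‖ ^ ((l : ℝ) + β) := by
  have hseg : ∀ t ∈ Set.Icc (0 : ℝ) 1, x + t • v ∈ O := by
    intro t ht
    have := hconv.add_smul_sub_mem hx hv ht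
    simpa using this
  have key := abs_sub_taylor_le_of_hasDerivAt (B := (d : ℝ) ^ l * CH * ‖v‖ ^ ((l : ℝ) + β)) l
    (fun k t => iteratedFDeriv ℝ k h (x + t • v) fun _ => v) ?_ ?_ 1 (by simp)
  · simpa using key
  · intro k hk t ht
    have hc : ContDiffAt ℝ l h (x + t • v) := hh.contDiffOn.contDiffAt (hO.mem_nhds (hseg t ht))
    have hd : DifferentiableAt ℝ (iteratedFDeriv ℝ k h) (x + t • v) :=
      hc.differentiableAt_iteratedFDeriv (by exact_mod_cast hk)
    have hline : HasDerivAt (fun t : ℝ => x + t • v) v t := by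
      simpa using ((hasDerivAt_id t).smul_const v).const_add x
    have h1 := hd.hasFDerivAt.comp_hasDerivAt t hline
    have h2 := (ContinuousMultilinearMap.apply ℝ (fun _ : Fin k => RSpace d) ℝ
      fun _ => v).hasFDerivAt.comp_hasDerivAt t h1
    exact h2
  · intro t ht
    simp only [zero_smul, add_zero]
    rw [multilinear_diag_eq_sum, multilinear_diag_eq_sum, ← Finset.sum_sub_distrib]
    simp_rw [← mul_sub]
    refine (Finset.abs_sum_le_sum_abs _ _).trans ?_
    have h1 : ∀ i : Fin l → Fin d, |(∏ r, v (i r)) *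
        (iteratedFDeriv ℝ l h (x + t • v) (fun r => EuclideanSpace.single (i r) 1) -
          iteratedFDeriv ℝ l h x (fun r => EuclideanSpace.single (i r) 1))| ≤
        (∏ r, |v (i r)|) * (CH * ‖v‖ ^ β) := by
      intro i
      rw [abs_mul, Finset.abs_prod]
      refine mul_le_mul_of_nonneg_left ((hh.holder i _ (hseg t ht) _ hx).trans ?_)
        (Finset.prod_nonneg fun _ _ => abs_nonneg _)
      refine mul_le_mul_of_nonneg_left (Real.rpow_le_rpow (norm_nonneg _) ?_ hβ.le) hCH
      rw [add_sub_cancel_left, norm_smul, Real.norm_of_nonneg ht.1]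
      exact mul_le_of_le_one_left (norm_nonneg _) ht.2
    refine (Finset.sum_le_sum fun i _ => h1 i).trans ?_
    rw [← Finset.sum_mul]
    have h2 : ∑ i : Fin l → Fin d, ∏ r, |v (i r)| = (∑ i, |v i|) ^ l := by
      rw [Finset.sum_pow', Fintype.piFinset_univ]
    rw [h2]
    have h3 : ‖v‖ ^ ((l : ℝ) + β) = ‖v‖ ^ l * ‖v‖ ^ β := by
      rw [Real.rpow_add_of_nonneg (norm_nonneg _) (by positivity) hβ.le, Real.rpow_natCast]
    rw [h3]
    calc (∑ i, |v i|) ^ l * (CH * ‖v‖ ^ β) ≤ (d * ‖v‖) ^ l * (CH * ‖v‖ ^ β) := by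
          gcongr
          exact sum_abs_coord_le v
      _ = _ := by ring

/-- On the diagonal a `k`-linear form is a combination of monomials of degree `k`, and exact weights
annihilate all of these except the constant. -/
theorem sum_fitWeight_mul_taylor {ι : Type*} [Fintype ι] {z : ι → RSpace d}
    (hz : (gramMat l z).det ≠ 0) (T : (k : ℕ) → ContinuousMultilinearMap ℝ
      (fun _ : Fin k => RSpace d) ℝ) :
    ∑ j, fitWeight l z j * ∑ k ∈ Finset.range (l + 1), T k (fun _ => z j) * (1 / k.factorial) =
      T 0 (fun _ => 0) := by
  classical
  have hword : ∀ k ≤ l, ∀ i : Fin k → Fin d,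
      ∑ j, fitWeight l z j * ∏ r, z j (i r) = if k = 0 then 1 else 0 := by
    intro k hk i
    have hle : ∀ a : Fin d, (Finset.univ.filter fun r => i r = a).card < l + 1 := fun a =>
      lt_of_le_of_lt (Finset.card_le_univ _) (by simpa using Nat.lt_succ_of_le hk)
    have hsum : ∑ a : Fin d, (Finset.univ.filter fun r => i r = a).card = k := by
      have := Finset.card_eq_sum_card_fiberwise (f := i) (s := Finset.univ) (t := Finset.univ)
        (fun _ _ => by simp)
      simpa using this.symm
    -- The multi-index of a word counts how often each direction occurs.
    let κ : MIdx d l := ⟨fun a => ⟨_, hle a⟩, by simpa [hsum] using hk⟩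
    have h1 : ∀ w : RSpace d, ∏ r, w (i r) = xi 0 w κ := by
      intro w
      rw [xi, ← Finset.prod_fiberwise (s := Finset.univ) (g := i)]
      refine Finset.prod_congr rfl fun a _ => ?_
      rw [Finset.prod_congr rfl (g := fun _ => w a)
        (fun r hr => by rw [(Finset.mem_filter.1 hr).2]), Finset.prod_const]
      simp [κ]
    simp_rw [h1]
    rw [sum_fitWeight_mul_xi hz]
    have h2 : κ = MIdx.zero d l ↔ k = 0 := by
      constructor
      · intro h
        rw [← hsum]
        refine Finset.sum_eq_zero fun a _ => ?_
        have := congrArg (fun κ : MIdx d l => ((κ.1 a : Fin (l + 1)) : ℕ)) h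
        simpa [κ, MIdx.zero] using this
      · rintro rfl
        ext a
        simp [κ, MIdx.zero]
    simp [h2]
  simp_rw [Finset.mul_sum]
  rw [Finset.sum_comm]
  have hk : ∀ k ∈ Finset.range (l + 1),
      ∑ j, fitWeight l z j * (T k (fun _ => z j) * (1 / k.factorial)) =
        if k = 0 then T 0 (fun _ => 0) else 0 := by
    intro k hk
    simp_rw [multilinear_diag_eq_sum (T k), Finset.sum_mul, Finset.mul_sum]
    rw [Finset.sum_comm]
    have h3 : ∀ i : Fin k → Fin d, ∑ j, fitWeight l z j * ((∏ r, z j (i r)) *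
        T k (fun r => EuclideanSpace.single (i r) 1) * (1 / k.factorial)) =
        (if k = 0 then 1 else 0) *
          (T k (fun r => EuclideanSpace.single (i r) 1) * (1 / k.factorial)) := by
      intro i
      rw [← hword k (Nat.lt_succ_iff.1 (Finset.mem_range.1 hk)) i, Finset.sum_mul]
      exact Finset.sum_congr rfl fun j _ => by ring
    simp_rw [h3]
    split_ifs with h
    · subst h
      simp only [Fintype.sum_unique, Nat.factorial_zero, Nat.cast_one, div_one, mul_one, one_mul]
      congr 1
      ext1 r
      exact r.elim0
    · simp
  rw [Finset.sum_congr rfl hk]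
  simp

/-- The bias of the local polynomial fit at `x` of a function of Hölder class. -/
theorem IsBoundedHolder.sq_bias_le {O : Set (RSpace d)} (hO : IsOpen O) (hconv : Convex ℝ O)
    {β CH CG : ℝ} (hβ : 0 < β) (hCH : 0 ≤ CH) {h : RSpace d → ℝ}
    (hh : IsBoundedHolder O l β CH CG h) {ι : Type*} [Fintype ι] {x : RSpace d} (hx : x ∈ O)
    {z : ι → RSpace d} (hzO : ∀ j, x + z j ∈ O) (hz : (gramMat l z).det ≠ 0) :
    (∑ j, fitWeight l z j * h (x + z j) - h x) ^ 2 ≤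
      ((d : ℝ) ^ l) ^ 2 * CH ^ 2 * Fintype.card ι * ‖z‖ ^ (2 * ((l : ℝ) + β)) *
        ∑ j, fitWeight l z j ^ 2 := by
  set B := (d : ℝ) ^ l * CH * ‖z‖ ^ ((l : ℝ) + β) with hB
  have hrem : ∀ j, |h (x + z j) - ∑ k ∈ Finset.range (l + 1),
      iteratedFDeriv ℝ k h x (fun _ => z j) * (1 / k.factorial)| ≤ B := fun j =>
    (hh.abs_sub_taylor_le hO hconv hβ hCH hx (hzO j)).trans (by
      rw [hB]
      gcongr
      exact norm_le_pi_norm z j)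
  -- The weighted sum of the Taylor polynomials equals `h x`, so only the remainders are left, and
  -- Cauchy-Schwarz separates them from the weights.
  have h0 := sum_fitWeight_mul_taylor hz fun k => iteratedFDeriv ℝ k h x
  rw [iteratedFDeriv_zero_apply] at h0
  rw [← h0, ← Finset.sum_sub_distrib]
  simp_rw [← mul_sub]
  refine (Finset.sum_mul_sq_le_sq_mul_sq _ _ _).trans ?_
  rw [mul_comm]
  refine mul_le_mul_of_nonneg_right ?_ (Finset.sum_nonneg fun _ _ => sq_nonneg _)
  calc _ ≤ ∑ _j : ι, B ^ 2 := by
        refine Finset.sum_le_sum fun j _ => ?_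
        rw [← sq_abs]
        exact pow_le_pow_left₀ (abs_nonneg _) (hrem j) 2
    _ = _ := by
        rw [Finset.sum_const, Finset.card_univ, nsmul_eq_mul, hB, mul_pow, mul_pow,
          ← Real.rpow_natCast (‖z‖ ^ _), ← Real.rpow_mul (norm_nonneg _)]
        push_cast
        rw [mul_comm ((l : ℝ) + β)]
        ring

end LocalBias

/-! ### Domination and splitting of product measures -/

section ProductMeasure

theorem lmarginal_le_pow_mul_lmarginal {ι : Type*} [DecidableEq ι] {α : Type*}
    [MeasurableSpace α] {μ ν : Measure α} [SigmaFinite μ] [SigmaFinite ν] {R : ℝ≥0∞}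
    (h : μ ≤ R • ν) {F : (ι → α) → ℝ≥0∞} (hF : Measurable F) (s : Finset ι) (x : ι → α) :
    lmarginal (fun _ => μ) s F x ≤ R ^ s.card * lmarginal (fun _ => ν) s F x := by
  induction s using Finset.induction_on generalizing x with
  | empty => simp
  | insert i s hi ih =>
    rw [lmarginal_insert F hF hi, lmarginal_insert F hF hi, Finset.card_insert_of_notMem hi]
    calc ∫⁻ y, lmarginal (fun _ => μ) s F (Function.update x i y) ∂μ
        ≤ ∫⁻ y, lmarginal (fun _ => μ) s F (Function.update x i y) ∂(R • ν) :=
          lintegral_mono' h le_rfl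
      _ = R * ∫⁻ y, lmarginal (fun _ => μ) s F (Function.update x i y) ∂ν := by
          rw [lintegral_smul_measure, smul_eq_mul]
      _ ≤ R * ∫⁻ y, R ^ s.card * lmarginal (fun _ => ν) s F (Function.update x i y) ∂ν := by
          gcongr with y
          exact ih _
      _ = _ := by
          have hm : Measurable fun y => lmarginal (fun _ => ν) s F (Function.update x i y) :=
            (hF.lmarginal _).comp (measurable_update x)
          rw [lintegral_const_mul _ hm, pow_succ,
            ← mul_assoc, mul_comm R]

theorem lintegral_pi_le_pow_mul {ι : Type*} [Fintype ι] {α : Type*}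
    [MeasurableSpace α] {μ ν : Measure α} [SigmaFinite μ] [SigmaFinite ν] {R : ℝ≥0∞}
    (h : μ ≤ R • ν) {F : (ι → α) → ℝ≥0∞} (hF : Measurable F) :
    ∫⁻ z, F z ∂(Measure.pi fun _ => μ) ≤
      R ^ Fintype.card ι * ∫⁻ z, F z ∂(Measure.pi fun _ => ν) := by
  classical
  rcases isEmpty_or_nonempty (ι → α) with h0 | ⟨⟨x⟩⟩
  · simp
  · rw [lintegral_eq_lmarginal_univ x, lintegral_eq_lmarginal_univ x]
    exact lmarginal_le_pow_mul_lmarginal h hF _ x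

theorem lintegral_pi_prod_eq_pow {ι : Type*} [Fintype ι] {α : Type*} [MeasurableSpace α]
    {μ : Measure α} [IsProbabilityMeasure μ] {h : α → ℝ≥0∞} (hh : Measurable h) :
    ∫⁻ w, ∏ k, h (w k) ∂(Measure.pi fun _ : ι => μ) = (∫⁻ t, h t ∂μ) ^ Fintype.card ι := by
  have hind : iIndepFun (fun (k : ι) (w : ι → α) => h (w k)) (Measure.pi fun _ : ι => μ) :=
    iIndepFun_pi fun _ => hh.aemeasurable
  rw [lintegral_prod_eq_prod_lintegral_of_indepFun Finset.univ _ hind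
    fun k => hh.comp (measurable_pi_apply k)]
  have : ∀ k : ι, ∫⁻ w, h (w k) ∂(Measure.pi fun _ : ι => μ) = ∫⁻ t, h t ∂μ := fun k =>
    (measurePreserving_eval (fun _ : ι => μ) k).lintegral_comp hh
  simp [this]

/-- Given the points of `J`, the remaining `n - #J` points are independent with a common law, so
their factors integrate to a power. -/
theorem lintegral_pi_mul_prod_compl {n : ℕ} (J : Finset (Fin n)) {α : Type*} [MeasurableSpace α]
    {μ : Measure α} [IsProbabilityMeasure μ] {φ : (J → α) → ℝ≥0∞} (hφ : Measurable φ)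
    {h : (J → α) → α → ℝ≥0∞} (hh : Measurable (Function.uncurry h)) :
    ∫⁻ z, φ (fun j => z j) * ∏ k : {k // k ∉ J}, h (fun j => z j) (z k)
        ∂(Measure.pi fun _ : Fin n => μ) =
      ∫⁻ y, φ y * (∫⁻ t, h y t ∂μ) ^ (n - J.card) ∂(Measure.pi fun _ : J => μ) := by
  classical
  have hmp : MeasurePreserving (MeasurableEquiv.piEquivPiSubtypeProd (fun _ : Fin n => α) (· ∈ J))
      (Measure.pi fun _ => μ) ((Measure.pi fun _ : J => μ).prod
        (Measure.pi fun _ : {k // k ∉ J} => μ)) := by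
    convert! measurePreserving_piEquivPiSubtypeProd (fun _ : Fin n => μ) (fun i => i ∈ J)
  have hmeas : Measurable fun p : (J → α) × ({k // k ∉ J} → α) =>
      φ p.1 * ∏ k, h p.1 (p.2 k) := by
    refine (hφ.comp measurable_fst).mul (Finset.measurable_prod _ fun k _ => ?_)
    exact hh.comp (measurable_fst.prodMk ((measurable_pi_apply k).comp measurable_snd))
  have h1 := hmp.lintegral_comp hmeas
  refine h1.trans ?_
  rw [lintegral_prod _ hmeas.aemeasurable]
  refine lintegral_congr fun y => ?_
  have hy : Measurable fun t => h y t := hh.comp (measurable_const.prodMk measurable_id)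
  have hp : Measurable fun w : {k // k ∉ J} → α => ∏ k, h y (w k) :=
    Finset.measurable_prod _ fun k _ => hy.comp (measurable_pi_apply k)
  simp only
  rw [lintegral_const_mul _ hp, lintegral_pi_prod_eq_pow hy]
  simp

end ProductMeasure

/-! ### The probability that few points fall into two balls -/

section NearestNeighbors

variable {E : Type*} [NormedAddCommGroup E] [MeasurableSpace E] [BorelSpace E]

open Classical in
/-- A weight that discounts points in either of two closed balls. -/
noncomputable def ballDiscount (x x' : E) (r r' : ℝ) (t : E) : ℝ≥0∞ :=
  ENNReal.ofReal (1 - ((if dist t x ≤ r then 1 else 0) + (if dist t x' ≤ r' then 1 else 0)) / 4)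

/-- The mean discount is `1 - (q + q')/4`, with `q`, `q'` the masses of the balls, and `1 - u ≤
exp(-u)`. Replacing `n - K` by `n` in the exponent costs at most `exp K`. -/
theorem lintegral_ballDiscount_pow_le (μ : Measure E) [IsProbabilityMeasure μ] (x x' : E)
    (r r' : ℝ) {n K : ℕ} (hKn : K ≤ n) :
    (∫⁻ t, ballDiscount x x' r r' t ∂μ) ^ (n - K) ≤ ENNReal.ofReal (Real.exp K * Real.exp
      (-(n * ((μ.real (Metric.closedBall x r) + μ.real (Metric.closedBall x' r')) / 4)))) := by
  classical
  set q := μ.real (Metric.closedBall x r) with hq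
  set q' := μ.real (Metric.closedBall x' r') with hq'
  have hq1 : q ≤ 1 := measureReal_le_one
  have hq1' : q' ≤ 1 := measureReal_le_one
  have hq0 : 0 ≤ q := measureReal_nonneg
  have hq0' : 0 ≤ q' := measureReal_nonneg
  have hi : ∀ (y : E) (s : ℝ), (fun t : E => if dist t y ≤ s then (1 : ℝ) else 0) =
      (Metric.closedBall y s).indicator 1 := fun y s => by
    ext t; simp [Set.indicator_apply, Metric.mem_closedBall]
  have hint : ∀ (y : E) (s : ℝ), Integrable ((Metric.closedBall y s).indicator (1 : E → ℝ)) μ :=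
    fun y s => (integrable_const (1 : ℝ)).indicator Metric.isClosed_closedBall.measurableSet
  have h1 : ∫⁻ t, ballDiscount x x' r r' t ∂μ = ENNReal.ofReal (1 - (q + q') / 4) := by
    have h2 : ∫ t, (1 - ((if dist t x ≤ r then (1 : ℝ) else 0) +
        (if dist t x' ≤ r' then 1 else 0)) / 4) ∂μ = 1 - (q + q') / 4 := by
      have h3 := hi x r
      have h4 := hi x' r'
      calc _ = ∫ t, (1 - ((Metric.closedBall x r).indicator (1 : E → ℝ) t +
            (Metric.closedBall x' r').indicator (1 : E → ℝ) t) / 4) ∂μ := by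
            simp only [← h3, ← h4]
        _ = _ := by
            have hab : Integrable (fun t => ((Metric.closedBall x r).indicator (1 : E → ℝ) t +
                (Metric.closedBall x' r').indicator (1 : E → ℝ) t) / 4) μ :=
              ((hint _ _).add (hint _ _)).div_const _
            rw [integral_sub (integrable_const _) hab, integral_div]
            rw [integral_add (hint _ _) (hint _ _),
              integral_indicator_one Metric.isClosed_closedBall.measurableSet,
              integral_indicator_one Metric.isClosed_closedBall.measurableSet]
            simp [hq, hq']
    rw [← h2, ofReal_integral_eq_lintegral_ofReal]
    · rfl
    · have h3 := hi x r
      have h4 := hi x' r'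
      have := (integrable_const (μ := μ) (1 : ℝ)).sub
        (((hint x r).add (hint x' r')).div_const 4)
      rw [← h3, ← h4] at this
      exact this
    · refine Filter.Eventually.of_forall fun t => ?_
      simp only [Pi.zero_apply]
      split_ifs <;> norm_num
  rw [h1, ← ENNReal.ofReal_pow (by linarith), ← Real.exp_add]
  refine ENNReal.ofReal_le_ofReal ?_
  have h5 : 1 - (q + q') / 4 ≤ Real.exp (-((q + q') / 4)) := by
    have := Real.add_one_le_exp (-((q + q') / 4)); linarith
  calc (1 - (q + q') / 4) ^ (n - K) ≤ Real.exp (-((q + q') / 4)) ^ (n - K) :=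
        pow_le_pow_left₀ (by linarith) h5 _
    _ = Real.exp (-(((n : ℝ) - K) * ((q + q') / 4))) := by
        rw [← Real.exp_nat_mul, Nat.cast_sub hKn]
        congr 1; ring
    _ ≤ _ := by
        refine Real.exp_le_exp.2 ?_
        have : (K : ℝ) * ((q + q') / 4) ≤ K := mul_le_of_le_one_right (by positivity) (by linarith)
        linarith

omit [MeasurableSpace E] [BorelSpace E] in
-- This replaces the indicator of an event about two possibly overlapping balls by a product over
-- independent points. Outside the first ball a point is discounted by `3/4 ≥ 1/2` at worst, and at
-- most `K` points are discounted at all.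
theorem one_le_two_pow_mul_prod_ballDiscount {ι : Type*} [Fintype ι] (x x' : E) (r r' : ℝ)
    (w : ι → E) (K : ℕ) (h : ∀ k, ¬ dist (w k) x ≤ r)
    (h' : ∀ s : Finset ι, (∀ k ∈ s, dist (w k) x' ≤ r') → s.card ≤ K) :
    1 ≤ 2 ^ K * ∏ k, ballDiscount x x' r r' (w k) := by
  classical
  set s := Finset.univ.filter fun k => dist (w k) x' ≤ r' with hs
  have hsK : s.card ≤ K := h' s fun k hk => (Finset.mem_filter.1 hk).2
  have h1 : ∏ k, (if k ∈ s then (2 : ℝ≥0∞)⁻¹ else 1) ≤ ∏ k, ballDiscount x x' r r' (w k) := by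
    refine Finset.prod_le_prod' fun k _ => ?_
    rw [ballDiscount, if_neg (h k)]
    by_cases hk : dist (w k) x' ≤ r'
    · rw [if_pos (by simp [hs, hk]), if_pos hk, ← ENNReal.ofReal_ofNat 2,
        ← ENNReal.ofReal_inv_of_pos (by norm_num)]
      exact ENNReal.ofReal_le_ofReal (by norm_num)
    · rw [if_neg (by simp [hs, hk]), if_neg hk]
      simp
  refine le_trans ?_ (mul_le_mul_right h1 _)
  rw [Finset.prod_ite_mem, Finset.univ_inter, Finset.prod_const]
  calc (1 : ℝ≥0∞) = 2 ^ s.card * 2⁻¹ ^ s.card := by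
        rw [← mul_pow, ENNReal.mul_inv_cancel (by norm_num) (by norm_num), one_pow]
    _ ≤ 2 ^ K * 2⁻¹ ^ s.card := by
        gcongr
        norm_num

end NearestNeighbors

/-! ### Higher order Voronoi cells and catchments -/

section Cells

variable {d n : ℕ} {Sstar : Set (RSpace d)}

theorem measurableSet_voronoiCell_prod (hS : MeasurableSet Sstar) (J : Finset (Fin n)) :
    MeasurableSet {p : RSpace d × (Fin n → RSpace d) | p.1 ∈ voronoiCell Sstar p.2 J} := by
  have : {p : RSpace d × (Fin n → RSpace d) | p.1 ∈ voronoiCell Sstar p.2 J} =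
      (Prod.fst ⁻¹' Sstar) ∩ ⋂ j ∈ J, ⋂ k ∈ (↑J : Set (Fin n))ᶜ,
        {p : RSpace d × (Fin n → RSpace d) | ‖p.1 - p.2 j‖ < ‖p.1 - p.2 k‖} := by
    ext p
    simp [voronoiCell]
  rw [this]
  refine (measurable_fst hS).inter (Finset.measurableSet_biInter _ fun j _ =>
    MeasurableSet.biInter (Set.to_countable _) fun k _ => ?_)
  exact measurableSet_lt (by fun_prop) (by fun_prop)

theorem norm_lt_of_mem_voronoiCell {z : Fin n → RSpace d} {J : Finset (Fin n)} (hJ : J.Nonempty)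
    {x : RSpace d} (hx : x ∈ voronoiCell Sstar z J) {k : Fin n} (hk : k ∉ J) :
    ‖fun j : J => z j - x‖ < dist (z k) x := by
  have h1 : ∀ j : J, ‖z j - x‖ < dist (z k) x := fun j => by
    rw [dist_eq_norm, norm_sub_rev, norm_sub_rev (z k)]
    exact hx.2 j j.2 k hk
  obtain ⟨j0, hj0⟩ := hJ
  exact (pi_norm_lt_iff (lt_of_le_of_lt (norm_nonneg _) (h1 ⟨j0, hj0⟩))).2 h1

/-- If the sets differed, each would have an element outside the other, and the two elements would
each be strictly closer to `x` than the other. -/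
theorem voronoiCell_unique {z : Fin n → RSpace d} {J J' : Finset (Fin n)} (hc : J.card = J'.card)
    {x : RSpace d} (hx : x ∈ voronoiCell Sstar z J) (hx' : x ∈ voronoiCell Sstar z J') :
    J = J' := by
  refine Finset.eq_of_subset_of_card_le (fun j hj => ?_) hc.ge
  by_contra hj'
  have h2 : ¬ J' ⊆ J := fun h => hj' (Finset.eq_of_subset_of_card_le h hc.le ▸ hj)
  obtain ⟨k, hk', hk⟩ := Finset.not_subset.1 h2
  exact lt_asymm (hx.2 j hj k hk) (hx'.2 k hk' j hj')

/-- The points of `Sstar` that have `z j` among their `K` nearest neighbors. -/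
def catchment (Sstar : Set (RSpace d)) (K : ℕ) (z : Fin n → RSpace d) (j : Fin n) :
    Set (RSpace d) :=
  {x | ∃ J : Finset (Fin n), J.card = K ∧ j ∈ J ∧ x ∈ voronoiCell Sstar z J}

theorem measurableSet_catchment_prod (hS : MeasurableSet Sstar) (K : ℕ) (j : Fin n) :
    MeasurableSet {p : RSpace d × (Fin n → RSpace d) | p.1 ∈ catchment Sstar K p.2 j} := by
  have : {p : RSpace d × (Fin n → RSpace d) | p.1 ∈ catchment Sstar K p.2 j} =
      ⋃ J ∈ {J : Finset (Fin n) | J.card = K ∧ j ∈ J},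
        {p : RSpace d × (Fin n → RSpace d) | p.1 ∈ voronoiCell Sstar p.2 J} := by
    ext p
    simp [catchment, and_assoc]
  rw [this]
  exact MeasurableSet.biUnion (Set.to_countable _) fun J _ => measurableSet_voronoiCell_prod hS J

theorem card_le_of_mem_catchment {z : Fin n → RSpace d} {K : ℕ} {j : Fin n} {x : RSpace d}
    (hx : x ∈ catchment Sstar K z j) (s : Finset (Fin n))
    (hs : ∀ k ∈ s, dist (z k) x ≤ dist (z j) x) : s.card ≤ K := by
  obtain ⟨J, rfl, hj, hxJ⟩ := hx
  refine Finset.card_le_card fun k hk => ?_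
  by_contra hkJ
  have := hxJ.2 j hj k hkJ
  have h2 := hs k hk
  rw [dist_eq_norm, dist_eq_norm, norm_sub_rev, norm_sub_rev (z j)] at h2
  linarith

end Cells

/-! ### Moments for a fixed set of neighbours -/

section Moments

variable {d : ℕ}

theorem fitVariance_reindex (L : ℕ) {ι ι' : Type*} [Fintype ι] [Fintype ι'] (e : ι ≃ ι')
    (z : ι' → RSpace d) : fitVariance L (fun i => z (e i)) = fitVariance L z := by
  have : gramMat L (fun i => z (e i)) = gramMat L z :=
    e.sum_comp fun j => Matrix.vecMulVec (xi 0 (z j)) (xi 0 (z j))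
  rw [fitVariance, this, fitVariance]

theorem pi_norm_reindex {ι ι' : Type*} [Fintype ι] [Fintype ι'] (e : ι ≃ ι')
    (z : ι' → RSpace d) : ‖fun i => z (e i)‖ = ‖z‖ := by
  refine le_antisymm ((pi_norm_le_iff_of_nonneg (norm_nonneg _)).2 fun i => norm_le_pi_norm z _)
    ((pi_norm_le_iff_of_nonneg (norm_nonneg _)).2 fun i => ?_)
  simpa using norm_le_pi_norm (fun i => z (e i)) (e.symm i)

/-- Identifies `n^(-1/d)` as the natural scale of the neighbour distances. -/
theorem natCast_mul_pow_eq_div_rpow_pow {n : ℕ} (hn : 1 ≤ n) (hd : 1 ≤ d) (c r : ℝ) :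
    (n : ℝ) * (c * r ^ d) = c * (r / (n : ℝ) ^ (-(1 / d : ℝ))) ^ d := by
  have hd0 : (d : ℝ) ≠ 0 := by positivity
  rw [div_pow, ← Real.rpow_natCast ((n : ℝ) ^ _), ← Real.rpow_mul (by positivity), neg_mul,
    one_div_mul_cancel hd0, Real.rpow_neg_one, div_inv_eq_mul]
  ring

theorem exists_lintegral_fitVariance_le (L K : ℕ) (hd : 1 ≤ d)
    (hK : (2 * DConst d L + 1) * numMonomials d L ≤ K) {c : ℝ} (hc : 0 < c) (A : ℕ) :
    ∃ C : ℝ≥0∞, C < ∞ ∧ ∀ (ι : Type) [Fintype ι], Fintype.card ι = K → ∀ (n : ℕ) (a : ℝ), 1 ≤ n →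
      0 ≤ a → a ≤ A →
      ∫⁻ y : ι → RSpace d, fitVariance L y *
        ENNReal.ofReal (‖y‖ ^ a * Real.exp (-(n * (c * ‖y‖ ^ d)))) ≤
        C * ENNReal.ofReal ((n : ℝ) ^ (-((K : ℝ) + a / d))) := by
  obtain ⟨C, hC, hCb⟩ := exists_lintegral_homogeneous_rpow_mul_exp_le
    (volume : Measure (Fin K → RSpace d)) (F := fitVariance L) measurable_fitVariance
    (fun t ht z => fitVariance_smul ht.ne' z)
    (lintegral_closedBall_fitVariance_lt_top hd (by simpa using hK)) hc (p := d) (by omega) A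
  refine ⟨C, hC, fun ι _ hι n a hn ha haA => ?_⟩
  have hd0 : (d : ℝ) ≠ 0 := by positivity
  -- Reindexing by `Fin K` makes the constant independent of the set of neighbours.
  let e : Fin K ≃ ι := (Fintype.equivFinOfCardEq hι).symm
  have hmp := volume_measurePreserving_piCongrLeft (fun _ : ι => RSpace d) e
  have hmeas : Measurable fun y : ι → RSpace d => fitVariance L y *
      ENNReal.ofReal (‖y‖ ^ a * Real.exp (-(n * (c * ‖y‖ ^ d)))) :=
    measurable_fitVariance.mul (by fun_prop)
  rw [← hmp.lintegral_comp hmeas]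
  have hn0 : (0 : ℝ) < n := by positivity
  have h := hCb ((n : ℝ) ^ (-(1 / d : ℝ))) a (by positivity) ha haA
  simp_rw [← natCast_mul_pow_eq_div_rpow_pow hn hd c] at h
  refine le_trans (le_of_eq (lintegral_congr fun y => ?_)) (h.trans (le_of_eq ?_))
  · set w := (MeasurableEquiv.piCongrLeft (fun _ : ι => RSpace d) e) y with hw
    have hwy : y = fun i => w (e i) := by
      ext1 i
      rw [hw, MeasurableEquiv.piCongrLeft_apply_apply]
    rw [hwy, fitVariance_reindex, pi_norm_reindex]
  · congr 2
    rw [← Real.rpow_mul hn0.le]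
    congr 1
    rw [Module.finrank_pi_fintype]
    simp only [finrank_euclideanSpace, Fintype.card_fin, Finset.sum_const, Finset.card_univ,
      smul_eq_mul]
    push_cast
    field_simp

theorem exists_lintegral_exp_dist_le (hd : 1 ≤ d) {c : ℝ} (hc : 0 < c) :
    ∃ C : ℝ≥0∞, C < ∞ ∧ ∀ (n : ℕ), 1 ≤ n → ∀ y : RSpace d,
      ∫⁻ x : RSpace d, ENNReal.ofReal (Real.exp (-(n * (c * dist y x ^ d)))) ≤
        C * ENNReal.ofReal ((n : ℝ)⁻¹) := by
  obtain ⟨C, hC, hCb⟩ := exists_lintegral_homogeneous_rpow_mul_exp_le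
    (volume : Measure (RSpace d)) (F := fun _ => 1) measurable_const
    (fun t ht z => rfl) (by simp [measure_closedBall_lt_top]) hc (p := d) (by omega) 0
  refine ⟨C, hC, fun n hn y => ?_⟩
  have hd0 : (d : ℝ) ≠ 0 := by positivity
  have hn0 : (0 : ℝ) < n := by positivity
  have h := hCb ((n : ℝ) ^ (-(1 / d : ℝ))) 0 (by positivity) le_rfl (by simp)
  simp_rw [← natCast_mul_pow_eq_div_rpow_pow hn hd c] at h
  simp_rw [dist_eq_norm]
  rw [lintegral_sub_left_eq_self (fun u : RSpace d =>
    ENNReal.ofReal (Real.exp (-(n * (c * ‖u‖ ^ d))))) y]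
  simp only [Real.rpow_zero, one_mul, add_zero, finrank_euclideanSpace, Fintype.card_fin] at h
  rwa [← Real.rpow_mul hn0.le, neg_mul, one_div_mul_cancel hd0, Real.rpow_neg_one] at h

variable {n K : ℕ} {Sstar : Set (RSpace d)} {μ : Measure (RSpace d)} [IsProbabilityMeasure μ]
  {R : ℝ≥0∞} {c : ℝ}

/-- On this event no point outside `J` lies in the ball around `x` reaching the farthest point of
`J`, and at most `K` points lie in the ball around `x'` reaching `z j`. Majorize the indicator by
discounts, integrate out the points outside `J`, bound the ball masses below by `hlow`, and pass
from `μ` to Lebesgue measure for the points of `J`. The joint decay in `x` and `x'` is needed for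
the catchment volume. -/
theorem lintegral_cell_inter_catchment_le (hμ : μ ≤ R • volume)
    (hlow : ∀ x ∈ Sstar, ∀ᵐ t ∂μ, c * dist t x ^ d ≤ μ.real (Metric.closedBall x (dist t x)))
    {J : Finset (Fin n)} (hJ : J.card = K) (j : J) {x x' : RSpace d} (hx : x ∈ Sstar)
    (hx' : x' ∈ Sstar) {φ : (J → RSpace d) → ℝ≥0∞} (hφ : Measurable φ) :
    ∫⁻ z, {z : Fin n → RSpace d | x ∈ voronoiCell Sstar z J ∧ x' ∈ catchment Sstar K z j}.indicator
        (fun z => φ fun i => z i) z ∂(Measure.pi fun _ => μ) ≤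
      (2 * ENNReal.ofReal (Real.exp 1) * R) ^ K * ∫⁻ y : J → RSpace d, φ y *
        (ENNReal.ofReal (Real.exp (-(n * (c / 4 * ‖fun i => y i - x‖ ^ d)))) *
          ENNReal.ofReal (Real.exp (-(n * (c / 4 * dist (y j) x' ^ d))))) := by
  have hKn : K ≤ n := by simpa [hJ] using Finset.card_le_univ J
  have hJne : J.Nonempty := ⟨j, j.2⟩
  have : Nonempty J := ⟨j⟩
  set h : (J → RSpace d) → RSpace d → ℝ≥0∞ := fun y t =>
    ballDiscount x x' ‖fun i => y i - x‖ (dist (y j) x') t with hh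
  have hhm : Measurable (Function.uncurry h) := by
    have h1 : MeasurableSet {p : (J → RSpace d) × RSpace d | dist p.2 x ≤ ‖fun i => p.1 i - x‖} :=
      measurableSet_le (by fun_prop) (by fun_prop)
    have h2 : MeasurableSet {p : (J → RSpace d) × RSpace d | dist p.2 x' ≤ dist (p.1 j) x'} :=
      measurableSet_le (by fun_prop) (by fun_prop)
    exact ENNReal.measurable_ofReal.comp (measurable_const.sub
      (((Measurable.ite h1 measurable_const measurable_const).add
        (Measurable.ite h2 measurable_const measurable_const)).div_const 4))
  have hpt : ∀ z : Fin n → RSpace d,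
      {z : Fin n → RSpace d | x ∈ voronoiCell Sstar z J ∧ x' ∈ catchment Sstar K z j}.indicator
        (fun z => φ fun i => z i) z ≤
      2 ^ K * (φ (fun i => z i) * ∏ k : {k // k ∉ J}, h (fun i => z i) (z k)) := by
    intro z
    by_cases hz : x ∈ voronoiCell Sstar z J ∧ x' ∈ catchment Sstar K z j
    · rw [Set.indicator_of_mem (by exact hz), mul_left_comm]
      refine le_mul_of_one_le_right zero_le ?_
      refine one_le_two_pow_mul_prod_ballDiscount _ _ _ _ (fun k : {k // k ∉ J} => z k) K
        (fun k => not_le.2 (norm_lt_of_mem_voronoiCell hJne hz.1 k.2)) fun s hs => ?_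
      rw [← Finset.card_map (Function.Embedding.subtype fun k => k ∉ J)]
      refine card_le_of_mem_catchment hz.2 _ fun k hk => ?_
      obtain ⟨k', hk', rfl⟩ := Finset.mem_map.1 hk
      exact hs k' hk'
    · rw [Set.indicator_of_notMem (by exact hz)]
      exact zero_le
  have hlowJ : ∀ᵐ y ∂(Measure.pi fun _ : J => μ), ∀ i : J,
      c * dist (y i) x ^ d ≤ μ.real (Metric.closedBall x (dist (y i) x)) ∧
      c * dist (y i) x' ^ d ≤ μ.real (Metric.closedBall x' (dist (y i) x')) := by
    rw [ae_all_iff]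
    intro i
    exact (Measure.quasiMeasurePreserving_eval (fun _ : J => μ) i).ae
      ((hlow x hx).and (hlow x' hx'))
  have hbound : ∀ᵐ y ∂(Measure.pi fun _ : J => μ), φ y * (∫⁻ t, h y t ∂μ) ^ (n - J.card) ≤
      ENNReal.ofReal (Real.exp 1) ^ K * (φ y *
        (ENNReal.ofReal (Real.exp (-(n * (c / 4 * ‖fun i => y i - x‖ ^ d)))) *
          ENNReal.ofReal (Real.exp (-(n * (c / 4 * dist (y j) x' ^ d)))))) := by
    filter_upwards [hlowJ] with y hy
    rw [mul_left_comm]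
    refine mul_le_mul_right ?_ _
    rw [hJ]
    refine (lintegral_ballDiscount_pow_le μ x x' _ _ hKn).trans ?_
    rw [← ENNReal.ofReal_pow (by positivity), ← ENNReal.ofReal_mul (by positivity),
      ← ENNReal.ofReal_mul (by positivity), ← Real.exp_nat_mul, mul_one, ← Real.exp_add (-_)]
    refine ENNReal.ofReal_le_ofReal (mul_le_mul_of_nonneg_left (Real.exp_le_exp.2 ?_)
      (Real.exp_pos _).le)
    -- `hlow` only concerns radii that are distances to a point, so the supremum norm has to be
    -- attained by one of the points.
    obtain ⟨i, hi⟩ : ∃ i, ‖fun i => y i - x‖ = ‖y i - x‖ := by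
      obtain ⟨i, hi⟩ := Finite.exists_max fun i : J => ‖y i - x‖
      exact ⟨i, le_antisymm ((pi_norm_le_iff_of_nonneg (norm_nonneg _)).2 hi)
        (norm_le_pi_norm (fun i => y i - x) i)⟩
    have h1 := (hy i).1
    have h2 := (hy j).2
    rw [dist_eq_norm, ← hi] at h1
    have hn0 : (0 : ℝ) ≤ n := by positivity
    nlinarith
  calc _ ≤ ∫⁻ z : Fin n → RSpace d, 2 ^ K * (φ (fun i : J => z i) *
          ∏ k : {k // k ∉ J}, h (fun i : J => z i) (z k))
        ∂(Measure.pi fun _ => μ) := lintegral_mono hpt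
    _ = 2 ^ K * ∫⁻ y, φ y * (∫⁻ t, h y t ∂μ) ^ (n - J.card) ∂(Measure.pi fun _ : J => μ) := by
        rw [lintegral_const_mul' _ _ (by simp), lintegral_pi_mul_prod_compl J hφ hhm]
    _ ≤ 2 ^ K * ∫⁻ y, ENNReal.ofReal (Real.exp 1) ^ K * (φ y *
        (ENNReal.ofReal (Real.exp (-(n * (c / 4 * ‖fun i => y i - x‖ ^ d)))) *
          ENNReal.ofReal (Real.exp (-(n * (c / 4 * dist (y j) x' ^ d))))))
          ∂(Measure.pi fun _ : J => μ) := mul_le_mul_right (lintegral_mono_ae hbound) _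
    _ ≤ 2 ^ K * (R ^ Fintype.card J * ∫⁻ y, ENNReal.ofReal (Real.exp 1) ^ K * (φ y *
        (ENNReal.ofReal (Real.exp (-(n * (c / 4 * ‖fun i => y i - x‖ ^ d)))) *
          ENNReal.ofReal (Real.exp (-(n * (c / 4 * dist (y j) x' ^ d))))))) :=
        mul_le_mul_right (lintegral_pi_le_pow_mul hμ (by fun_prop)) _
    _ = _ := by
        rw [lintegral_const_mul' _ _ (by simp), Fintype.card_coe, hJ, mul_pow, mul_pow]
        ring

end Moments

/-! ### Moments summed over all sets of neighbours -/

section CellMoments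

variable {d : ℕ}

theorem card_powersetCard_mul_rpow_le {n K : ℕ} (hn : 1 ≤ n) (b : ℝ) :
    (((Finset.univ : Finset (Fin n)).powersetCard K).card : ℝ≥0∞) *
      ENNReal.ofReal ((n : ℝ) ^ (-((K : ℝ) + b))) ≤ ENNReal.ofReal ((n : ℝ) ^ (-b)) := by
  have hn0 : (0 : ℝ) < n := by positivity
  rw [Finset.card_powersetCard, Finset.card_univ, Fintype.card_fin,
    ← ENNReal.ofReal_natCast, ← ENNReal.ofReal_mul (by positivity)]
  refine ENNReal.ofReal_le_ofReal ?_
  calc (n.choose K : ℝ) * (n : ℝ) ^ (-((K : ℝ) + b))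
      ≤ (n : ℝ) ^ K * (n : ℝ) ^ (-((K : ℝ) + b)) := by
        gcongr
        exact_mod_cast Nat.choose_le_pow n K
    _ = (n : ℝ) ^ (-b) := by
        rw [← Real.rpow_natCast, ← Real.rpow_add hn0]
        congr 1
        ring

/-- The weighted variance factor of the nearest neighbor fit at `x`. -/
noncomputable def cellMoment {n : ℕ} (L K : ℕ) (Sstar : Set (RSpace d)) (a : ℝ) (x : RSpace d)
    (z : Fin n → RSpace d) : ℝ≥0∞ :=
  ∑ J ∈ (Finset.univ : Finset (Fin n)).powersetCard K,
    (voronoiCell Sstar z J).indicator (fun x => fitVariance L (fun j : J => z j - x) *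
      ENNReal.ofReal (‖fun j : J => z j - x‖ ^ a)) x

/-- The total catchment volume of the nearest neighbors of `x`, weighted by the squares of the
weights of the fit. -/
noncomputable def catchmentMoment {n : ℕ} (L K : ℕ) (Sstar : Set (RSpace d)) (x : RSpace d)
    (z : Fin n → RSpace d) : ℝ≥0∞ :=
  ∑ J ∈ (Finset.univ : Finset (Fin n)).powersetCard K,
    (voronoiCell Sstar z J).indicator (fun x => ∑ j : J,
      ENNReal.ofReal (fitWeight L (fun j : J => z j - x) j ^ 2) *
        volume (catchment Sstar K z j)) x

/-- Each set `J` contributes at most a multiple of `n^(-K-a/d)`, and there are at most `n^K` of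
them. -/
theorem exists_lintegral_cellMoment_le (L K : ℕ) (hd : 1 ≤ d) (hK1 : 1 ≤ K)
    (hK : (2 * DConst d L + 1) * numMonomials d L ≤ K) {c : ℝ} (hc : 0 < c) {R : ℝ≥0∞}
    (hR : R ≠ ∞) (A : ℕ) :
    ∃ C : ℝ≥0∞, C < ∞ ∧ ∀ (Sstar : Set (RSpace d)) (μ : Measure (RSpace d))
      [IsProbabilityMeasure μ], MeasurableSet Sstar → μ ≤ R • volume →
      (∀ x ∈ Sstar, ∀ᵐ t ∂μ, c * dist t x ^ d ≤ μ.real (Metric.closedBall x (dist t x))) →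
      ∀ (n : ℕ) (a : ℝ), 1 ≤ n → 0 ≤ a → a ≤ A → ∀ x ∈ Sstar,
        ∫⁻ z, cellMoment L K Sstar a x z ∂(Measure.pi fun _ : Fin n => μ) ≤
          C * ENNReal.ofReal ((n : ℝ) ^ (-(a / d))) := by
  obtain ⟨C, hC, hCb⟩ := exists_lintegral_fitVariance_le L K hd hK (c := c / 4) (by positivity) A
  set B := (2 * ENNReal.ofReal (Real.exp 1) * R) ^ K with hB
  have hBtop : B < ∞ := ENNReal.pow_lt_top (ENNReal.mul_lt_top
    (ENNReal.mul_lt_top (by simp) (by simp)) (lt_top_iff_ne_top.2 hR))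
  refine ⟨B * C, ENNReal.mul_lt_top hBtop hC,
    fun Sstar μ _ hS hμ hlow n a hn ha haA x hx => ?_⟩
  have hterm : ∀ J ∈ (Finset.univ : Finset (Fin n)).powersetCard K,
      ∫⁻ z : Fin n → RSpace d, (voronoiCell Sstar z J).indicator
        (fun x => fitVariance L (fun j : J => z j - x) *
          ENNReal.ofReal (‖fun j : J => z j - x‖ ^ a)) x ∂(Measure.pi fun _ => μ) ≤
      B * C * ENNReal.ofReal ((n : ℝ) ^ (-((K : ℝ) + a / d))) := by
    intro J hJ
    have hJc : J.card = K := (Finset.mem_powersetCard.1 hJ).2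
    obtain ⟨j, hj⟩ : J.Nonempty := Finset.card_pos.1 (by omega)
    set φ : (J → RSpace d) → ℝ≥0∞ := fun y => fitVariance L (fun i => y i - x) *
      ENNReal.ofReal (‖fun i => y i - x‖ ^ a) with hφ
    have hφm : Measurable φ :=
      (measurable_fitVariance.comp (by fun_prop : Measurable fun (y : J → RSpace d) i => y i - x)).mul
        (by fun_prop)
    -- With `x' = x` the catchment condition follows from the cell condition; the second exponential
    -- is then bounded by 1.
    have h1 := lintegral_cell_inter_catchment_le hμ hlow hJc ⟨j, hj⟩ hx hx hφm
    refine le_trans (lintegral_mono fun z => ?_) (h1.trans ?_)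
    · by_cases hz : x ∈ voronoiCell Sstar z J
      · have hz' : z ∈ {z : Fin n → RSpace d |
            x ∈ voronoiCell Sstar z J ∧ x ∈ catchment Sstar K z j} := ⟨hz, J, hJc, hj, hz⟩
        rw [Set.indicator_of_mem hz, Set.indicator_of_mem hz']
      · rw [Set.indicator_of_notMem hz]
        exact zero_le
    · rw [mul_assoc B]
      refine mul_le_mul_right ?_ _
      refine le_trans ?_ (hCb J (by simpa using hJc) n a hn ha haA)
      rw [← lintegral_sub_right_eq_self (fun y : J → RSpace d => fitVariance L y *
        ENNReal.ofReal (‖y‖ ^ a * Real.exp (-(n * (c / 4 * ‖y‖ ^ d))))) (fun _ => x)]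
      refine lintegral_mono fun y => ?_
      simp only [hφ]
      rw [mul_assoc, ← mul_assoc (ENNReal.ofReal (_ ^ a)),
        ← ENNReal.ofReal_mul (by positivity)]
      refine mul_le_mul_right (mul_le_of_le_one_right zero_le ?_) _
      rw [← ENNReal.ofReal_one]
      exact ENNReal.ofReal_le_ofReal (Real.exp_le_one_iff.2 (by
        have : 0 ≤ (n : ℝ) * (c / 4 * dist (y ⟨j, hj⟩) x ^ d) := by positivity
        linarith))
  have hmeas : ∀ J ∈ (Finset.univ : Finset (Fin n)).powersetCard K,
      Measurable fun z : Fin n → RSpace d => (voronoiCell Sstar z J).indicator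
        (fun x => fitVariance L (fun j : J => z j - x) *
          ENNReal.ofReal (‖fun j : J => z j - x‖ ^ a)) x := by
    intro J _
    have h1 : MeasurableSet {z : Fin n → RSpace d | x ∈ voronoiCell Sstar z J} :=
      measurable_const.prodMk measurable_id (measurableSet_voronoiCell_prod hS J)
    have h2 : Measurable fun z : Fin n → RSpace d => fitVariance L (fun j : J => z j - x) *
        ENNReal.ofReal (‖fun j : J => z j - x‖ ^ a) :=
      (measurable_fitVariance.comp
        (by fun_prop : Measurable fun (z : Fin n → RSpace d) (i : J) => z i - x)).mul (by fun_prop)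
    exact h2.indicator h1
  simp only [cellMoment]
  rw [lintegral_finsetSum _ hmeas]
  refine (Finset.sum_le_sum hterm).trans ?_
  rw [Finset.sum_const, nsmul_eq_mul, mul_left_comm]
  exact mul_le_mul_right (card_powersetCard_mul_rpow_le hn _) _

/-- Write the catchment volume as an integral over `x'` and exchange the integrals: the exponential
in the distance from `x'` to `z j` integrates to a multiple of `1/n`, and what is left is the moment
with `a = 0`. -/
theorem exists_lintegral_catchmentMoment_le (L K : ℕ) (hd : 1 ≤ d)
    (hK : (2 * DConst d L + 1) * numMonomials d L ≤ K) {c : ℝ} (hc : 0 < c) {R : ℝ≥0∞}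
    (hR : R ≠ ∞) :
    ∃ C : ℝ≥0∞, C < ∞ ∧ ∀ (Sstar : Set (RSpace d)) (μ : Measure (RSpace d))
      [IsProbabilityMeasure μ], MeasurableSet Sstar → μ ≤ R • volume →
      (∀ x ∈ Sstar, ∀ᵐ t ∂μ, c * dist t x ^ d ≤ μ.real (Metric.closedBall x (dist t x))) →
      ∀ n : ℕ, 1 ≤ n → ∀ x ∈ Sstar,
        ∫⁻ z, catchmentMoment L K Sstar x z ∂(Measure.pi fun _ : Fin n => μ) ≤
          C * ENNReal.ofReal ((n : ℝ)⁻¹) := by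
  obtain ⟨C, hC, hCb⟩ := exists_lintegral_fitVariance_le L K hd hK (c := c / 4) (by positivity) 0
  obtain ⟨C', hC', hCb'⟩ := exists_lintegral_exp_dist_le hd (c := c / 4) (by positivity)
  set B := (2 * ENNReal.ofReal (Real.exp 1) * R) ^ K with hB
  have hBtop : B < ∞ := ENNReal.pow_lt_top (ENNReal.mul_lt_top
    (ENNReal.mul_lt_top (by simp) (by simp)) (lt_top_iff_ne_top.2 hR))
  refine ⟨B * C' * C, ENNReal.mul_lt_top (ENNReal.mul_lt_top hBtop hC') hC,
    fun Sstar μ _ hS hμ hlow n hn x hx => ?_⟩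
  set N : ℝ≥0∞ := ENNReal.ofReal ((n : ℝ)⁻¹) with hN
  have hcm : ∀ j, Measurable fun z : Fin n → RSpace d => volume (catchment Sstar K z j) := fun j =>
    measurable_measure_prodMk_right (measurableSet_catchment_prod hS K j)
  have hwm : ∀ (J : Finset (Fin n)) (j : J), Measurable fun y : J → RSpace d =>
      ENNReal.ofReal (fitWeight L (fun i => y i - x) j ^ 2) := fun J j =>
    (((measurable_fitWeight j).comp (by fun_prop :
      Measurable fun (y : J → RSpace d) i => y i - x)).pow_const 2).ennreal_ofReal
  have hcellm : ∀ J, MeasurableSet {z : Fin n → RSpace d | x ∈ voronoiCell Sstar z J} := fun J =>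
    measurable_const.prodMk measurable_id (measurableSet_voronoiCell_prod hS J)
  have hres : ∀ J : Finset (Fin n), Measurable fun (z : Fin n → RSpace d) (i : J) => z i :=
    fun J => by fun_prop
  have hpair : ∀ (J : Finset (Fin n)) (hJ : J.card = K) (j : J),
      ∫⁻ z : Fin n → RSpace d, (voronoiCell Sstar z J).indicator (fun x =>
        ENNReal.ofReal (fitWeight L (fun j : J => z j - x) j ^ 2) *
          volume (catchment Sstar K z j)) x ∂(Measure.pi fun _ => μ) ≤
      B * (C' * N) * ∫⁻ y : J → RSpace d, ENNReal.ofReal (fitWeight L (fun i => y i - x) j ^ 2) *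
        ENNReal.ofReal (Real.exp (-(n * (c / 4 * ‖fun i => y i - x‖ ^ d)))) := by
    intro J hJ j
    set φ : (J → RSpace d) → ℝ≥0∞ := fun y =>
      ENNReal.ofReal (fitWeight L (fun i => y i - x) j ^ 2) with hφ
    set D : RSpace d → Set (Fin n → RSpace d) := fun x' =>
      {z | x ∈ voronoiCell Sstar z J ∧ x' ∈ catchment Sstar K z j} with hD
    have hsw : MeasurableSet {p : (Fin n → RSpace d) × RSpace d | p.2 ∈ catchment Sstar K p.1 j} :=
      (measurable_snd.prodMk measurable_fst) (measurableSet_catchment_prod hS K (j : Fin n))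
    have hDm : MeasurableSet {p : (Fin n → RSpace d) × RSpace d | p.1 ∈ D p.2} :=
      (measurable_fst (hcellm J)).inter hsw
    have h0 : ∀ z : Fin n → RSpace d, (voronoiCell Sstar z J).indicator (fun x =>
        ENNReal.ofReal (fitWeight L (fun j : J => z j - x) j ^ 2) *
          volume (catchment Sstar K z j)) x =
        ∫⁻ x', (D x').indicator (fun z => φ fun i => z i) z := by
      intro z
      have hzm : MeasurableSet (catchment Sstar K z j) :=
        (by fun_prop : Measurable fun x' : RSpace d => (x', z))
          (measurableSet_catchment_prod hS K (j : Fin n))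
      by_cases hz : x ∈ voronoiCell Sstar z J
      · rw [Set.indicator_of_mem hz]
        have : ∀ x', (D x').indicator (fun z => φ fun i => z i) z =
            (catchment Sstar K z j).indicator (fun _ => φ fun i => z i) x' := by
          intro x'
          by_cases hx' : x' ∈ catchment Sstar K z j
          · rw [Set.indicator_of_mem hx', Set.indicator_of_mem (by exact ⟨hz, hx'⟩)]
          · rw [Set.indicator_of_notMem hx', Set.indicator_of_notMem (by exact fun h => hx' h.2)]
        simp_rw [this]
        rw [lintegral_indicator_const hzm]
      · rw [Set.indicator_of_notMem hz]
        have : ∀ x', (D x').indicator (fun z => φ fun i => z i) z = 0 := fun x' =>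
          Set.indicator_of_notMem (by exact fun h => hz h.1) _
        simp [this]
    simp_rw [h0]
    -- Fix `x'` first, so that the bound for the joint event applies to the integral over the
    -- sample.
    rw [lintegral_lintegral_swap (by
      have : Measurable fun p : (Fin n → RSpace d) × RSpace d => φ fun i => p.1 i :=
        (hwm J j).comp ((hres J).comp measurable_fst)
      exact (this.indicator hDm).aemeasurable)]
    have h1 : ∀ x' : RSpace d, ∫⁻ z, (D x').indicator (fun z => φ fun i => z i) z
        ∂(Measure.pi fun _ => μ) ≤ B * ∫⁻ y : J → RSpace d, φ y *
        (ENNReal.ofReal (Real.exp (-(n * (c / 4 * ‖fun i => y i - x‖ ^ d)))) *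
          ENNReal.ofReal (Real.exp (-(n * (c / 4 * dist (y j) x' ^ d))))) := by
      intro x'
      by_cases hx' : x' ∈ Sstar
      · exact lintegral_cell_inter_catchment_le hμ hlow hJ j hx hx' (hwm J j)
      · have : ∀ z, (D x').indicator (fun z => φ fun i => z i) z = 0 := fun z =>
          Set.indicator_of_notMem (by
            rintro ⟨_, J', _, _, h⟩
            exact hx' h.1) _
        simp [this]
    refine (lintegral_mono h1).trans ?_
    have hum : Measurable (Function.uncurry fun (x' : RSpace d) (y : J → RSpace d) => φ y *
        (ENNReal.ofReal (Real.exp (-(n * (c / 4 * ‖fun i => y i - x‖ ^ d)))) *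
          ENNReal.ofReal (Real.exp (-(n * (c / 4 * dist (y j) x' ^ d)))))) := by
      have h2 : Measurable fun p : RSpace d × (J → RSpace d) => φ p.2 :=
        (hwm J j).comp measurable_snd
      have h3 : Measurable fun p : RSpace d × (J → RSpace d) =>
          ENNReal.ofReal (Real.exp (-(n * (c / 4 * ‖fun i => p.2 i - x‖ ^ d)))) *
            ENNReal.ofReal (Real.exp (-(n * (c / 4 * dist (p.2 j) p.1 ^ d)))) := by fun_prop
      exact h2.mul h3
    rw [lintegral_const_mul' _ _ hBtop.ne, lintegral_lintegral_swap hum.aemeasurable, mul_assoc,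
      ← lintegral_const_mul' _ _ (ENNReal.mul_ne_top hC'.ne (by simp [hN]))]
    refine mul_le_mul_right (lintegral_mono fun y => ?_) _
    rw [lintegral_const_mul' _ _ ENNReal.ofReal_ne_top,
      lintegral_const_mul' _ _ ENNReal.ofReal_ne_top, ← mul_assoc, mul_comm (C' * N)]
    exact mul_le_mul_right (hCb' n hn (y j)) _
  have hcell : ∀ J ∈ (Finset.univ : Finset (Fin n)).powersetCard K,
      ∫⁻ z : Fin n → RSpace d, (voronoiCell Sstar z J).indicator (fun x => ∑ j : J,
        ENNReal.ofReal (fitWeight L (fun j : J => z j - x) j ^ 2) *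
          volume (catchment Sstar K z j)) x ∂(Measure.pi fun _ => μ) ≤
      B * (C' * N) * (C * ENNReal.ofReal ((n : ℝ) ^ (-((K : ℝ) + 0)))) := by
    intro J hJ
    have hJc : J.card = K := (Finset.mem_powersetCard.1 hJ).2
    have hsum : ∀ z : Fin n → RSpace d, (voronoiCell Sstar z J).indicator (fun x => ∑ j : J,
        ENNReal.ofReal (fitWeight L (fun j : J => z j - x) j ^ 2) *
          volume (catchment Sstar K z j)) x =
        ∑ j : J, (voronoiCell Sstar z J).indicator (fun x =>
          ENNReal.ofReal (fitWeight L (fun j : J => z j - x) j ^ 2) *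
            volume (catchment Sstar K z j)) x := by
      intro z
      by_cases hz : x ∈ voronoiCell Sstar z J
      · simp only [Set.indicator_of_mem hz]
      · simp only [Set.indicator_of_notMem hz, Finset.sum_const_zero]
    simp_rw [hsum]
    rw [lintegral_finsetSum _ fun j _ => by
      have : Measurable fun z : Fin n → RSpace d =>
          ENNReal.ofReal (fitWeight L (fun j : J => z j - x) j ^ 2) *
            volume (catchment Sstar K z j) := ((hwm J j).comp (hres J)).mul (hcm j)
      exact this.indicator (hcellm J)]
    refine (Finset.sum_le_sum fun j _ => hpair J hJc j).trans ?_
    have hem : ∀ j ∈ (Finset.univ : Finset J), Measurable fun y : J → RSpace d =>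
        ENNReal.ofReal (fitWeight L (fun i => y i - x) j ^ 2) *
          ENNReal.ofReal (Real.exp (-(n * (c / 4 * ‖fun i => y i - x‖ ^ d)))) := fun j _ =>
      (hwm J j).mul (by fun_prop)
    rw [← Finset.mul_sum, ← lintegral_finsetSum _ hem]
    refine mul_le_mul_right ?_ _
    have h2 := hCb J (by simpa using hJc) n 0 hn le_rfl (by simp)
    rw [zero_div] at h2
    refine le_trans ?_ h2
    rw [← lintegral_sub_right_eq_self (fun y : J → RSpace d => fitVariance L y *
      ENNReal.ofReal (‖y‖ ^ (0 : ℝ) * Real.exp (-(n * (c / 4 * ‖y‖ ^ d))))) (fun _ => x)]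
    refine lintegral_mono fun y => ?_
    rw [← Finset.sum_mul, ← ENNReal.ofReal_sum_of_nonneg fun _ _ => sq_nonneg _, Real.rpow_zero,
      one_mul]
    -- Only after summing over `j` are the squared weights controlled by the variance factor.
    exact mul_le_mul_left (ofReal_sum_fitWeight_sq_le _) _
  simp only [catchmentMoment]
  rw [lintegral_finsetSum _ fun J _ => by
    have : Measurable fun z : Fin n → RSpace d => ∑ j : J,
        ENNReal.ofReal (fitWeight L (fun j : J => z j - x) j ^ 2) *
          volume (catchment Sstar K z j) :=
      Finset.measurable_sum _ fun j _ => ((hwm J j).comp (hres J)).mul (hcm j)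
    exact this.indicator (hcellm J)]
  refine (Finset.sum_le_sum hcell).trans ?_
  rw [Finset.sum_const, nsmul_eq_mul, mul_left_comm, mul_left_comm _ C]
  have h3 := card_powersetCard_mul_rpow_le (K := K) hn 0
  rw [neg_zero, Real.rpow_zero, ENNReal.ofReal_one] at h3
  calc B * (C' * N) * (C * _) ≤ B * (C' * N) * (C * 1) := by gcongr
    _ = _ := by ring

end CellMoments

/-! ### Resampling one observation -/

section Resampling

variable {ι α : Type*} [Fintype ι] [DecidableEq ι] [MeasurableSpace α] {Q : Measure α}
  [IsProbabilityMeasure Q]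

omit [Fintype ι] in
theorem measurable_update_prod (j : ι) :
    Measurable fun p : α × (ι → α) => Function.update p.2 j p.1 := by
  refine measurable_pi_lambda _ fun i => ?_
  by_cases h : i = j
  · subst h; simpa using measurable_fst
  · simp only [Function.update_of_ne h]
    fun_prop

theorem lintegral_pi_eq_lintegral_update (j : ι) {F : (ι → α) → ℝ≥0∞} (hF : Measurable F) :
    ∫⁻ z, F z ∂(Measure.pi fun _ => Q) =
      ∫⁻ z, ∫⁻ t, F (Function.update z j t) ∂Q ∂(Measure.pi fun _ => Q) := by
  have hm : Measurable fun z => ∫⁻ t, F (Function.update z j t) ∂Q :=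
    Measurable.lintegral_prod_left' (f := fun p : α × (ι → α) => F (Function.update p.2 j p.1))
      (hF.comp (measurable_update_prod j))
  refine lintegral_eq_of_lmarginal_eq {j} hF hm ?_
  rw [lmarginal_singleton, lmarginal_singleton]
  ext z
  simp

theorem measurePreserving_update (j : ι) :
    MeasurePreserving (fun p : α × (ι → α) => Function.update p.2 j p.1)
      (Q.prod (Measure.pi fun _ => Q)) (Measure.pi fun _ => Q) := by
  refine ⟨measurable_update_prod j, Measure.ext fun s hs => ?_⟩
  rw [Measure.map_apply (measurable_update_prod j) hs, ← lintegral_indicator_one hs,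
    lintegral_pi_eq_lintegral_update j (measurable_one.indicator hs),
    Measure.prod_apply_symm (measurable_update_prod j hs)]
  refine lintegral_congr fun z => ?_
  have : Measurable fun t : α => Function.update z j t := measurable_update z
  exact (lintegral_indicator_one (this hs)).symm

theorem integral_pi_eq_zero_of_integral_update_eq_zero (j : ι) {F : (ι → α) → ℝ}
    (hF : Integrable F (Measure.pi fun _ => Q))
    (h : ∀ z, ∫ t, F (Function.update z j t) ∂Q = 0) :
    ∫ z, F z ∂(Measure.pi fun _ => Q) = 0 := by
  have hmp := measurePreserving_update (Q := Q) j
  have hi : Integrable (fun p : α × (ι → α) => F (Function.update p.2 j p.1))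
      (Q.prod (Measure.pi fun _ => Q)) := hmp.integrable_comp_of_integrable hF
  rw [← hmp.map_eq, integral_map hmp.aemeasurable (by rw [hmp.map_eq]; exact hF.1),
    integral_prod_symm _ hi]
  simp [h]

end Resampling

/-! ### Regression residuals -/

section Regression

variable {E : Type*} [mE : MeasurableSpace E] {Q : Measure (E × ℝ)} [IsProbabilityMeasure Q]
  {g : E → ℝ}

theorem integral_residual_mul_eq_zero (hY : MemLp (fun p : E × ℝ => p.2) 2 Q)
    (hreg : Q[(fun p : E × ℝ => p.2) | MeasurableSpace.comap Prod.fst inferInstance] =ᵐ[Q]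
      fun p => g p.1) {h : E → ℝ} (hh : Measurable h) :
    ∫ p, (p.2 - g p.1) * h p.1 ∂Q = 0 := by
  -- Without integrability the integral is 0 by convention.
  by_cases hint : Integrable (fun p : E × ℝ => (p.2 - g p.1) * h p.1) Q
  swap
  · exact integral_undef hint
  have hm : mE.comap (Prod.fst : E × ℝ → E) ≤ Prod.instMeasurableSpace := measurable_fst.comap_le
  have hYi : Integrable (fun p : E × ℝ => p.2) Q := hY.integrable (by norm_num)
  have hgi : Integrable (fun p : E × ℝ => g p.1) Q := integrable_condExp.congr hreg
  have hhm : StronglyMeasurable[mE.comap Prod.fst] fun p : E × ℝ => h p.1 :=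
    (hh.comp (comap_measurable _)).stronglyMeasurable
  have hres : Q[(fun p : E × ℝ => p.2 - g p.1) | mE.comap Prod.fst] =ᵐ[Q] 0 := by
    have h1 : Q[(fun p : E × ℝ => p.2 - Q[(fun p : E × ℝ => p.2) | mE.comap Prod.fst] p) | mE.comap Prod.fst] =ᵐ[Q] 0 := by
      have h2 := condExp_sub (m := mE.comap Prod.fst) hYi (integrable_condExp (m := mE.comap Prod.fst) (μ := Q)
        (f := fun p : E × ℝ => p.2))
      refine h2.trans ?_
      rw [condExp_of_stronglyMeasurable hm stronglyMeasurable_condExp integrable_condExp]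
      simp
    refine (condExp_congr_ae ?_).trans h1
    filter_upwards [hreg] with p hp
    rw [hp]
  have h3 := condExp_mul_of_stronglyMeasurable_right hhm hint (hYi.sub hgi)
  rw [← integral_condExp hm]
  refine integral_eq_zero_of_ae (h3.trans ?_)
  filter_upwards [hres] with p hp
  simp [hp]

/-- The conditional variance bound is read as an inequality between measures on the covariate space,
first on sets. This gives it for every measurable `h` with values in `[0, ∞]`, with no integrability
assumption. -/
theorem lintegral_residual_sq_mul_le (hY : MemLp (fun p : E × ℝ => p.2) 2 Q)
    (hg : Measurable g)
    (hreg : Q[(fun p : E × ℝ => p.2) | MeasurableSpace.comap Prod.fst inferInstance] =ᵐ[Q]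
      fun p => g p.1) {CV : ℝ}
    (hvar : ∀ᵐ p ∂Q, (Var[(fun p : E × ℝ => p.2) ; Q |
      MeasurableSpace.comap Prod.fst inferInstance]) p ≤ CV) {h : E → ℝ≥0∞} (hh : Measurable h) :
    ∫⁻ p, ENNReal.ofReal ((p.2 - g p.1) ^ 2) * h p.1 ∂Q ≤
      ENNReal.ofReal CV * ∫⁻ p, h p.1 ∂Q := by
  have hm : mE.comap (Prod.fst : E × ℝ → E) ≤ Prod.instMeasurableSpace := measurable_fst.comap_le
  have hεm : Measurable fun p : E × ℝ => ENNReal.ofReal ((p.2 - g p.1) ^ 2) := by fun_prop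
  have hεi : Integrable (fun p : E × ℝ => (p.2 - g p.1) ^ 2) Q := by
    have hgL : MemLp (fun p : E × ℝ => g p.1) 2 Q := MemLp.ae_eq hreg (hY.condExp one_le_two)
    exact (hY.sub hgL).integrable_sq
  set κ := (Q.withDensity fun p => ENNReal.ofReal ((p.2 - g p.1) ^ 2)).map Prod.fst with hκ
  have hle : κ ≤ ENNReal.ofReal CV • Q.map Prod.fst := by
    refine Measure.le_iff.2 fun s hs => ?_
    have hs' : MeasurableSet (Prod.fst ⁻¹' s : Set (E × ℝ)) := measurable_fst hs
    rw [hκ, Measure.map_apply measurable_fst hs, withDensity_apply _ hs', Measure.smul_apply,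
      Measure.map_apply measurable_fst hs, smul_eq_mul,
      ← ofReal_integral_eq_lintegral_ofReal hεi.integrableOn
        (Filter.Eventually.of_forall fun p => sq_nonneg _)]
    have h1 : ∫ p in (Prod.fst ⁻¹' s : Set (E × ℝ)), (p.2 - g p.1) ^ 2 ∂Q =
        ∫ p in (Prod.fst ⁻¹' s : Set (E × ℝ)), (Var[(fun p : E × ℝ => p.2) ; Q |
          MeasurableSpace.comap Prod.fst inferInstance]) p ∂Q := by
      rw [condVar, setIntegral_condExp hm]
      · refine setIntegral_congr_ae hs' ?_
        filter_upwards [hreg] with p hp _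
        simp [hp]
      · refine hεi.congr ?_
        filter_upwards [hreg] with p hp
        simp [hp]
      · exact ⟨s, hs, rfl⟩
    rw [h1]
    have h2 : ∫ p in (Prod.fst ⁻¹' s : Set (E × ℝ)), (Var[(fun p : E × ℝ => p.2) ; Q |
          MeasurableSpace.comap Prod.fst inferInstance]) p ∂Q ≤
        ∫ _p in (Prod.fst ⁻¹' s : Set (E × ℝ)), CV ∂Q :=
      setIntegral_mono_ae integrable_condVar.integrableOn (integrable_const _).integrableOn hvar
    rw [setIntegral_const, smul_eq_mul, mul_comm] at h2
    refine (ENNReal.ofReal_le_ofReal h2).trans (le_of_eq ?_)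
    rw [ENNReal.ofReal_mul' measureReal_nonneg, ofReal_measureReal]
  have h3 : ∫⁻ p, ENNReal.ofReal ((p.2 - g p.1) ^ 2) * h p.1 ∂Q = ∫⁻ x, h x ∂κ := by
    rw [hκ, lintegral_map hh measurable_fst]
    exact (lintegral_withDensity_eq_lintegral_mul _ hεm (hh.comp measurable_fst)).symm
  rw [h3]
  refine (lintegral_mono' hle le_rfl).trans (le_of_eq ?_)
  rw [lintegral_smul_measure, lintegral_map hh measurable_fst, smul_eq_mul]

variable {n : ℕ}

/-- `hinv` says that `h` does not involve the `j`-th response. Resampling the `j`-th observation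
leaves a residual times a function of its own covariate. -/
theorem integral_pi_residual_mul_eq_zero (hY : MemLp (fun p : E × ℝ => p.2) 2 Q)
    (hreg : Q[(fun p : E × ℝ => p.2) | MeasurableSpace.comap Prod.fst inferInstance] =ᵐ[Q]
      fun p => g p.1) (j : Fin n) {h : (Fin n → E × ℝ) → ℝ} (hh : Measurable h)
    (hinv : ∀ D z y, h (Function.update D j (z, y)) = h (Function.update D j (z, 0)))
    (hint : Integrable (fun D => ((D j).2 - g (D j).1) * h D) (Measure.pi fun _ : Fin n => Q)) :
    ∫ D, ((D j).2 - g (D j).1) * h D ∂(Measure.pi fun _ : Fin n => Q) = 0 := by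
  refine integral_pi_eq_zero_of_integral_update_eq_zero j hint fun D => ?_
  have hm : Measurable fun z : E => h (Function.update D j (z, 0)) :=
    hh.comp ((measurable_update D).comp (measurable_id.prodMk measurable_const))
  rw [← integral_residual_mul_eq_zero hY hreg hm]
  refine integral_congr_ae (Filter.Eventually.of_forall fun p => ?_)
  simp only [Function.update_self]
  rw [← hinv D p.1 p.2]

theorem lintegral_pi_residual_sq_mul_le (hY : MemLp (fun p : E × ℝ => p.2) 2 Q)
    (hg : Measurable g)
    (hreg : Q[(fun p : E × ℝ => p.2) | MeasurableSpace.comap Prod.fst inferInstance] =ᵐ[Q]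
      fun p => g p.1) {CV : ℝ}
    (hvar : ∀ᵐ p ∂Q, (Var[(fun p : E × ℝ => p.2) ; Q |
      MeasurableSpace.comap Prod.fst inferInstance]) p ≤ CV) (j : Fin n)
    {h : (Fin n → E) → ℝ≥0∞} (hh : Measurable h) :
    ∫⁻ D, ENNReal.ofReal (((D j).2 - g (D j).1) ^ 2) * h (fun i => (D i).1)
      ∂(Measure.pi fun _ : Fin n => Q) ≤
    ENNReal.ofReal CV * ∫⁻ z, h z ∂(Measure.pi fun _ : Fin n => Q.map Prod.fst) := by
  have hfst : Measurable fun (D : Fin n → E × ℝ) i => (D i).1 := by fun_prop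
  have hmp : MeasurePreserving (fun (D : Fin n → E × ℝ) i => (D i).1)
      (Measure.pi fun _ : Fin n => Q) (Measure.pi fun _ : Fin n => Q.map Prod.fst) :=
    measurePreserving_pi _ _ fun _ => ⟨measurable_fst, rfl⟩
  have hupd : ∀ (D : Fin n → E × ℝ) (t : E × ℝ), (fun i => (Function.update D j t i).1) =
      Function.update (fun i => (D i).1) j t.1 := by
    intro D t
    ext1 i
    by_cases hi : i = j
    · subst hi; simp
    · simp [hi]
  have hcomp := hmp.lintegral_comp hh
  have hhf : Measurable fun D : Fin n → E × ℝ => h fun i => (D i).1 := hh.comp hfst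
  rw [← hcomp, lintegral_pi_eq_lintegral_update j (by fun_prop),
    lintegral_pi_eq_lintegral_update j hhf,
    ← lintegral_const_mul' _ _ ENNReal.ofReal_ne_top]
  refine lintegral_mono fun D => ?_
  simp only [Function.update_self, hupd]
  exact lintegral_residual_sq_mul_le hY hg hreg hvar (hh.comp (measurable_update _))

end Regression

/-! ### Cauchy-Schwarz and sample means -/

theorem sq_lintegral_le_measure_mul_lintegral_sq {α : Type*} [MeasurableSpace α] {μ : Measure α}
    {f : α → ℝ≥0∞} (hf : AEMeasurable f μ) :
    (∫⁻ x, f x ∂μ) ^ 2 ≤ μ Set.univ * ∫⁻ x, f x ^ 2 ∂μ := by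
  have h := ENNReal.lintegral_mul_le_Lp_mul_Lq μ Real.HolderConjugate.two_two
    (f := fun _ => (1 : ℝ≥0∞)) (g := f) aemeasurable_const hf
  simp only [Pi.mul_apply, one_mul, ENNReal.one_rpow, lintegral_one] at h
  have h2 := pow_le_pow_left' h 2
  refine h2.trans (le_of_eq ?_)
  rw [mul_pow, ← ENNReal.rpow_natCast, ← ENNReal.rpow_natCast, ← ENNReal.rpow_mul,
    ← ENNReal.rpow_mul]
  norm_num

theorem integral_sample_mean {α : Type*} [MeasurableSpace α] {ν : Measure α}
    [IsProbabilityMeasure ν] {m : ℕ} (hm : 1 ≤ m) {g : α → ℝ} (hg : Integrable g ν) :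
    ∫ x, (m : ℝ)⁻¹ * ∑ k, g (x k) ∂(Measure.pi fun _ : Fin m => ν) = ∫ t, g t ∂ν := by
  have hmp : ∀ k, MeasurePreserving (Function.eval k) (Measure.pi fun _ : Fin m => ν) ν :=
    fun k => measurePreserving_eval _ k
  have h1 : ∀ k : Fin m, ∫ x, g (x k) ∂(Measure.pi fun _ : Fin m => ν) = ∫ t, g t ∂ν := fun k => by
    conv_rhs => rw [← (hmp k).map_eq]
    rw [integral_map (hmp k).aemeasurable (by rw [(hmp k).map_eq]; exact hg.1)]
  have hm0 : (m : ℝ) ≠ 0 := by positivity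
  have hi : ∀ k ∈ (Finset.univ : Finset (Fin m)),
      Integrable (fun x : Fin m → α => g (x k)) (Measure.pi fun _ : Fin m => ν) :=
    fun k _ => (hmp k).integrable_comp_of_integrable hg
  rw [integral_const_mul, integral_finsetSum _ hi]
  simp only [h1, Finset.sum_const, Finset.card_univ, Fintype.card_fin, nsmul_eq_mul]
  field_simp

theorem integral_sq_sample_mean_sub_le {α : Type*} [MeasurableSpace α] {ν : Measure α}
    [IsProbabilityMeasure ν] {m : ℕ} (hm : 1 ≤ m) {g : α → ℝ} (hg : MemLp g 2 ν) :
    ∫ x, ((m : ℝ)⁻¹ * ∑ k, g (x k) - ∫ t, g t ∂ν) ^ 2 ∂(Measure.pi fun _ : Fin m => ν) ≤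
      (m : ℝ)⁻¹ * ∫ t, g t ^ 2 ∂ν := by
  have hm0 : (0 : ℝ) < m := by positivity
  have hgm : ∀ k, MemLp (fun x : Fin m → α => g (x k)) 2 (Measure.pi fun _ : Fin m => ν) :=
    fun k => hg.comp_measurePreserving (measurePreserving_eval _ k)
  have hS : MemLp (∑ k, fun x : Fin m → α => g (x k)) 2 (Measure.pi fun _ : Fin m => ν) :=
    memLp_finsetSum' _ fun k _ => hgm k
  have h1 := variance_eq_integral (X := fun x : Fin m → α => (m : ℝ)⁻¹ * ∑ k, g (x k))
    (μ := Measure.pi fun _ : Fin m => ν) (by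
      have := (hS.const_mul (m : ℝ)⁻¹).1.aemeasurable
      simpa using this)
  rw [integral_sample_mean hm (hg.integrable (by norm_num))] at h1
  rw [← h1, variance_const_mul]
  have h2 : Var[fun x : Fin m → α => ∑ k, g (x k); Measure.pi fun _ : Fin m => ν] =
      m * Var[g; ν] := by
    have := variance_sum_pi (μ := fun _ : Fin m => ν) (X := fun _ => g) fun _ => hg
    have h4 : (fun x : Fin m → α => ∑ k, g (x k)) = ∑ k, fun x : Fin m → α => g (x k) := by
      ext x; simp
    rw [h4, this]
    simp
  have h3 : Var[g; ν] ≤ ∫ t, g t ^ 2 ∂ν := variance_le_expectation_sq hg.1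
  rw [h2]
  calc (m : ℝ)⁻¹ ^ 2 * (m * Var[g; ν]) = (m : ℝ)⁻¹ * Var[g; ν] := by field_simp
    _ ≤ _ := by gcongr

/-! ### The nearest neighbour fit as a linear smoother -/

section NearestNeighborWeights

variable {d n : ℕ} {L K : ℕ} {Sstar : Set (RSpace d)}

open Classical in
/-- The weight of the `j`-th observation in the nearest neighbor fit at `x`. -/
noncomputable def nnWeight (L K : ℕ) (Sstar : Set (RSpace d)) (x : RSpace d)
    (z : Fin n → RSpace d) (j : Fin n) : ℝ :=
  ∑ J ∈ (Finset.univ : Finset (Fin n)).powersetCard K,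
    (voronoiCell Sstar z J).indicator (fun x => if h : j ∈ J then
      fitWeight L (fun i : J => z i - x) ⟨j, h⟩ else 0) x

/-- The nearest neighbor fit at `x`. -/
noncomputable def nnFit (L K : ℕ) (Sstar : Set (RSpace d)) (x : RSpace d)
    (z : Fin n → RSpace d) (y : Fin n → ℝ) : ℝ :=
  ∑ J ∈ (Finset.univ : Finset (Fin n)).powersetCard K,
    (voronoiCell Sstar z J).indicator (localFit L z y J) x

theorem sum_powersetCard_indicator_eq {M : Type*} [AddCommMonoid M] {z : Fin n → RSpace d}
    {J : Finset (Fin n)} (hJ : J.card = K) {x : RSpace d} (hx : x ∈ voronoiCell Sstar z J)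
    (F : Finset (Fin n) → RSpace d → M) :
    ∑ J ∈ (Finset.univ : Finset (Fin n)).powersetCard K,
      (voronoiCell Sstar z J).indicator (F J) x = F J x := by
  rw [Finset.sum_eq_single J]
  · rw [Set.indicator_of_mem hx]
  · intro J' hJ' hne
    rw [Set.indicator_of_notMem]
    intro hx'
    exact hne (voronoiCell_unique ((Finset.mem_powersetCard.1 hJ').2.trans hJ.symm) hx' hx)
  · intro h
    exact absurd (Finset.mem_powersetCard.2 ⟨Finset.subset_univ _, hJ⟩) h

theorem sum_powersetCard_indicator_eq_zero {M : Type*} [AddCommMonoid M] {z : Fin n → RSpace d}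
    {x : RSpace d} (hx : ∀ J : Finset (Fin n), J.card = K → x ∉ voronoiCell Sstar z J)
    (F : Finset (Fin n) → RSpace d → M) :
    ∑ J ∈ (Finset.univ : Finset (Fin n)).powersetCard K,
      (voronoiCell Sstar z J).indicator (F J) x = 0 :=
  Finset.sum_eq_zero fun J hJ => Set.indicator_of_notMem (hx J (Finset.mem_powersetCard.1 hJ).2) _

open Classical in
theorem nnWeight_of_mem {z : Fin n → RSpace d} {J : Finset (Fin n)} (hJ : J.card = K)
    {x : RSpace d} (hx : x ∈ voronoiCell Sstar z J) (j : Fin n) :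
    nnWeight L K Sstar x z j =
      if h : j ∈ J then fitWeight L (fun i : J => z i - x) ⟨j, h⟩ else 0 :=
  sum_powersetCard_indicator_eq hJ hx fun J x => if h : j ∈ J then
      fitWeight L (fun i : J => z i - x) ⟨j, h⟩ else 0

theorem nnWeight_of_forall_notMem {z : Fin n → RSpace d} {x : RSpace d}
    (hx : ∀ J : Finset (Fin n), J.card = K → x ∉ voronoiCell Sstar z J) (j : Fin n) :
    nnWeight L K Sstar x z j = 0 :=
  sum_powersetCard_indicator_eq_zero hx _

theorem sum_nnWeight_of_mem {M : Type*} [AddCommMonoid M] {z : Fin n → RSpace d}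
    {J : Finset (Fin n)} (hJ : J.card = K) {x : RSpace d} (hx : x ∈ voronoiCell Sstar z J)
    (F : Fin n → ℝ → M) (hF : ∀ j, F j 0 = 0) :
    ∑ j, F j (nnWeight L K Sstar x z j) = ∑ j : J, F j (fitWeight L (fun i : J => z i - x) j) := by
  classical
  simp_rw [nnWeight_of_mem hJ hx]
  rw [← Finset.sum_subset (Finset.subset_univ J), ← Finset.sum_coe_sort]
  · exact Finset.sum_congr rfl fun j _ => by rw [dif_pos j.2]
  · intro j _ hj
    rw [dif_neg hj, hF]

theorem nnFit_eq_sum (x : RSpace d) (z : Fin n → RSpace d) (y : Fin n → ℝ) :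
    nnFit L K Sstar x z y = ∑ j, nnWeight L K Sstar x z j * y j := by
  by_cases h : ∃ J : Finset (Fin n), J.card = K ∧ x ∈ voronoiCell Sstar z J
  · obtain ⟨J, hJ, hx⟩ := h
    rw [nnFit, sum_powersetCard_indicator_eq hJ hx,
      sum_nnWeight_of_mem hJ hx (fun j w => w * y j) (by simp), localFit_eq_sum]
  · push Not at h
    rw [nnFit, sum_powersetCard_indicator_eq_zero h]
    simp [nnWeight_of_forall_notMem h]

theorem matchingEstimator_eq {m : ℕ} (z : Fin n → RSpace d) (y : Fin n → ℝ)
    (X : Fin m → RSpace d) :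
    matchingEstimator L K Sstar z y X = (m : ℝ)⁻¹ * ∑ k, nnFit L K Sstar (X k) z y := rfl

theorem ofReal_sum_nnWeight_sq_le (x : RSpace d) (z : Fin n → RSpace d) :
    ENNReal.ofReal (∑ j, nnWeight L K Sstar x z j ^ 2) ≤ cellMoment L K Sstar 0 x z := by
  by_cases h : ∃ J : Finset (Fin n), J.card = K ∧ x ∈ voronoiCell Sstar z J
  · obtain ⟨J, hJ, hx⟩ := h
    rw [cellMoment, sum_powersetCard_indicator_eq hJ hx,
      sum_nnWeight_of_mem hJ hx (fun j w => w ^ 2) (by simp)]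
    rw [Real.rpow_zero, ENNReal.ofReal_one, mul_one]
    exact ofReal_sum_fitWeight_sq_le _
  · push Not at h
    simp [nnWeight_of_forall_notMem h]

/-- At most `K` weights are nonzero, so Cauchy-Schwarz costs `K` and not `n`. -/
theorem sq_sum_nnWeight_mul_le (x : RSpace d) (z : Fin n → RSpace d) (b : Fin n → ℝ) :
    (∑ j, nnWeight L K Sstar x z j * b j) ^ 2 ≤
      K * ∑ j, nnWeight L K Sstar x z j ^ 2 * b j ^ 2 := by
  by_cases h : ∃ J : Finset (Fin n), J.card = K ∧ x ∈ voronoiCell Sstar z J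
  · obtain ⟨J, hJ, hx⟩ := h
    rw [sum_nnWeight_of_mem hJ hx (fun j w => w * b j) (by simp),
      sum_nnWeight_of_mem hJ hx (fun j w => w ^ 2 * b j ^ 2) (by simp)]
    refine sq_sum_le_card_mul_sum_sq.trans (le_of_eq ?_)
    rw [Finset.card_univ, Fintype.card_coe, hJ]
    simp_rw [mul_pow]
  · push Not at h
    simp [nnWeight_of_forall_notMem h]

theorem sum_nnWeight_sq_mul_volume_le (x : RSpace d) (z : Fin n → RSpace d) :
    ∑ j, ENNReal.ofReal (nnWeight L K Sstar x z j ^ 2) * volume (catchment Sstar K z j) ≤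
      catchmentMoment L K Sstar x z := by
  by_cases h : ∃ J : Finset (Fin n), J.card = K ∧ x ∈ voronoiCell Sstar z J
  · obtain ⟨J, hJ, hx⟩ := h
    rw [catchmentMoment, sum_powersetCard_indicator_eq hJ hx,
      sum_nnWeight_of_mem hJ hx
        (fun j w => ENNReal.ofReal (w ^ 2) * volume (catchment Sstar K z j)) (by simp)]
  · push Not at h
    simp [nnWeight_of_forall_notMem h]

theorem nnWeight_eq_zero_of_notMem_catchment {x : RSpace d} {z : Fin n → RSpace d} {j : Fin n}
    (h : x ∉ catchment Sstar K z j) : nnWeight L K Sstar x z j = 0 := by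
  by_cases h' : ∃ J : Finset (Fin n), J.card = K ∧ x ∈ voronoiCell Sstar z J
  · obtain ⟨J, hJ, hx⟩ := h'
    rw [nnWeight_of_mem hJ hx, dif_neg]
    exact fun hj => h ⟨J, hJ, hj, hx⟩
  · push Not at h'
    exact nnWeight_of_forall_notMem h' j

theorem nnWeight_eq_zero_of_notMem {x : RSpace d} (hx : x ∉ Sstar) (z : Fin n → RSpace d)
    (j : Fin n) : nnWeight L K Sstar x z j = 0 :=
  nnWeight_of_forall_notMem (fun _ _ h => hx h.1) j

theorem cellMoment_eq_zero_of_notMem {x : RSpace d} (hx : x ∉ Sstar) (a : ℝ)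
    (z : Fin n → RSpace d) : cellMoment L K Sstar a x z = 0 :=
  sum_powersetCard_indicator_eq_zero (fun _ _ h => hx h.1) _

theorem catchmentMoment_eq_zero_of_notMem {x : RSpace d} (hx : x ∉ Sstar)
    (z : Fin n → RSpace d) : catchmentMoment L K Sstar x z = 0 :=
  sum_powersetCard_indicator_eq_zero (fun _ _ h => hx h.1) _

theorem measurable_sub_prod (J : Finset (Fin n)) :
    Measurable fun (p : RSpace d × (Fin n → RSpace d)) (i : J) => p.2 i - p.1 := by
  fun_prop

theorem measurable_nnWeight (hS : MeasurableSet Sstar) (j : Fin n) :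
    Measurable fun p : RSpace d × (Fin n → RSpace d) => nnWeight L K Sstar p.1 p.2 j := by
  unfold nnWeight
  refine Finset.measurable_sum _ fun J _ => ?_
  have h1 : Measurable fun p : RSpace d × (Fin n → RSpace d) => if h : j ∈ J then
      fitWeight L (fun i : J => p.2 i - p.1) ⟨j, h⟩ else 0 := by
    by_cases h : j ∈ J
    · simp only [dif_pos h]
      exact (measurable_fitWeight _).comp (measurable_sub_prod J)
    · simp only [dif_neg h]
      exact measurable_const
  exact h1.indicator (measurableSet_voronoiCell_prod hS J)

theorem measurable_cellMoment (hS : MeasurableSet Sstar) (a : ℝ) :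
    Measurable fun p : RSpace d × (Fin n → RSpace d) => cellMoment L K Sstar a p.1 p.2 := by
  unfold cellMoment
  refine Finset.measurable_sum _ fun J _ => ?_
  have h1 : Measurable fun p : RSpace d × (Fin n → RSpace d) =>
      fitVariance L (fun i : J => p.2 i - p.1) * ENNReal.ofReal (‖fun i : J => p.2 i - p.1‖ ^ a) :=
    (measurable_fitVariance.comp (measurable_sub_prod J)).mul (by fun_prop)
  exact h1.indicator (measurableSet_voronoiCell_prod hS J)

theorem measurable_fst_pi_prod {E : Type*} [MeasurableSpace E] :
    Measurable fun p : E × (Fin n → E × ℝ) => (p.1, fun i => (p.2 i).1) :=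
  measurable_fst.prodMk (measurable_pi_lambda _ fun i =>
    measurable_fst.comp ((measurable_pi_apply i).comp measurable_snd))

/-- Without ties, the nearest remaining point can be added one step at a time. -/
theorem exists_mem_voronoiCell (hK : K ≤ n) {x : RSpace d} (hx : x ∈ Sstar)
    {z : Fin n → RSpace d} (hz : ∀ i j, i ≠ j → ‖x - z i‖ ≠ ‖x - z j‖) :
    ∃ J : Finset (Fin n), J.card = K ∧ x ∈ voronoiCell Sstar z J := by
  induction K with
  | zero => exact ⟨∅, rfl, hx, by simp⟩
  | succ K ih =>
    obtain ⟨J, hJ, hxJ⟩ := ih (by omega)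
    have hne : (Finset.univ \ J).Nonempty := by
      rw [← Finset.card_pos, Finset.card_sdiff_of_subset (Finset.subset_univ _)]
      simp
      omega
    obtain ⟨k0, hk0, hmin⟩ := Finset.exists_min_image _ (fun k => ‖x - z k‖) hne
    have hk0J : k0 ∉ J := (Finset.mem_sdiff.1 hk0).2
    refine ⟨insert k0 J, by rw [Finset.card_insert_of_notMem hk0J, hJ], hx, fun j hj k hk => ?_⟩
    rw [Finset.mem_insert, not_or] at hk
    rcases Finset.mem_insert.1 hj with rfl | hj
    · exact lt_of_le_of_ne (hmin k (by simp [hk.2])) (hz _ _ (Ne.symm hk.1))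
    · exact hxJ.2 j hj k hk.2

theorem ofReal_sq_nnBias_le {O : Set (RSpace d)} (hO : IsOpen O) (hconv : Convex ℝ O)
    {β CH CG : ℝ} (hβ : 0 < β) (hCH : 0 ≤ CH) {h : RSpace d → ℝ}
    (hh : IsBoundedHolder O L β CH CG h) (hK : K ≤ n) {x : RSpace d} (hx : x ∈ Sstar)
    (hxO : x ∈ O) {z : Fin n → RSpace d} (hzO : ∀ j, z j ∈ O)
    (hz : ∀ i j, i ≠ j → ‖x - z i‖ ≠ ‖x - z j‖) (hfin : cellMoment L K Sstar 0 x z ≠ ∞) :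
    ENNReal.ofReal ((∑ j, nnWeight L K Sstar x z j * h (z j) - h x) ^ 2) ≤
      ENNReal.ofReal (((d : ℝ) ^ L) ^ 2 * CH ^ 2 * K) *
        cellMoment L K Sstar (2 * ((L : ℝ) + β)) x z := by
  obtain ⟨J, hJ, hxJ⟩ := exists_mem_voronoiCell hK hx hz
  rw [cellMoment, sum_powersetCard_indicator_eq hJ hxJ] at hfin ⊢
  rw [Real.rpow_zero, ENNReal.ofReal_one, mul_one] at hfin
  rw [sum_nnWeight_of_mem hJ hxJ (fun j w => w * h (z j)) (by simp)]
  -- The variance factor is infinite for a singular Gram matrix, so a finite moment encodes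
  -- uniqueness of the fit.
  have hdet : (gramMat L fun i : J => z i - x).det ≠ 0 := by
    intro h0
    rw [fitVariance, if_pos h0] at hfin
    exact hfin rfl
  have hb := hh.sq_bias_le hO hconv hβ hCH hxO (z := fun i : J => z i - x)
    (fun j => by simpa using hzO j) hdet
  simp only [add_sub_cancel, Fintype.card_coe, hJ] at hb
  refine (ENNReal.ofReal_le_ofReal hb).trans ?_
  rw [mul_comm (fitVariance _ _), ← mul_assoc, ← ENNReal.ofReal_mul (by positivity),
    ENNReal.ofReal_mul (by positivity)]
  exact mul_le_mul_right (ofReal_sum_fitWeight_sq_le _) _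

end NearestNeighborWeights

/-! ### Square integrable functions -/

section SquareIntegrable

variable {α : Type*} [MeasurableSpace α] {μ : Measure α} {f : α → ℝ}

theorem memLp_two_of_lintegral_ofReal_sq_lt_top (hf : AEStronglyMeasurable f μ)
    (h : ∫⁻ x, ENNReal.ofReal (f x ^ 2) ∂μ < ∞) : MemLp f 2 μ := by
  rw [memLp_two_iff_integrable_sq hf]
  refine ⟨hf.pow 2, ?_⟩
  rw [hasFiniteIntegral_iff_ofReal (Filter.Eventually.of_forall fun _ => sq_nonneg _)]
  exact h

theorem MeasureTheory.MemLp.lintegral_ofReal_sq (hf : MemLp f 2 μ) :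
    ∫⁻ x, ENNReal.ofReal (f x ^ 2) ∂μ = ENNReal.ofReal (∫ x, f x ^ 2 ∂μ) :=
  (ofReal_integral_eq_lintegral_ofReal hf.integrable_sq
    (Filter.Eventually.of_forall fun _ => sq_nonneg _)).symm

theorem ofReal_sq_eq_enorm_sq (a : ℝ) : ENNReal.ofReal (a ^ 2) = ‖a‖ₑ ^ 2 := by
  rw [← sq_abs, ENNReal.ofReal_pow (abs_nonneg _), Real.enorm_eq_ofReal_abs]

theorem ofReal_sq_integral_le_measure_mul (hf : AEMeasurable f μ) {c : Set α}
    (hc : MeasurableSet c) (hfc : ∀ x ∉ c, f x = 0) :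
    ENNReal.ofReal ((∫ x, f x ∂μ) ^ 2) ≤ μ c * ∫⁻ x, ENNReal.ofReal (f x ^ 2) ∂μ := by
  rw [ofReal_sq_eq_enorm_sq]
  have h1 : ∫⁻ x, ‖f x‖ₑ ∂μ = ∫⁻ x in c, ‖f x‖ₑ ∂μ := by
    rw [← lintegral_indicator hc]
    refine lintegral_congr fun x => ?_
    by_cases hx : x ∈ c
    · rw [Set.indicator_of_mem hx]
    · rw [Set.indicator_of_notMem hx, hfc x hx, enorm_zero]
  refine (pow_le_pow_left' (enorm_integral_le_lintegral_enorm f) 2).trans ?_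
  rw [h1]
  refine (sq_lintegral_le_measure_mul_lintegral_sq hf.restrict.enorm).trans ?_
  rw [Measure.restrict_apply_univ]
  refine mul_le_mul_right ((setLIntegral_le_lintegral _ _).trans_eq ?_) _
  simp_rw [ofReal_sq_eq_enorm_sq]

theorem ofReal_sq_integral_le [IsProbabilityMeasure μ] (hf : AEMeasurable f μ) :
    ENNReal.ofReal ((∫ x, f x ∂μ) ^ 2) ≤ ∫⁻ x, ENNReal.ofReal (f x ^ 2) ∂μ := by
  simpa using ofReal_sq_integral_le_measure_mul hf MeasurableSet.univ (by simp)

end SquareIntegrable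

/-! ### Linear smoothers and their averaged weights -/

section LinearSmoother

variable {E : Type*} [mE : MeasurableSpace E] {n m : ℕ} {Q : Measure (E × ℝ)}
  [IsProbabilityMeasure Q] {ν : Measure E} [IsProbabilityMeasure ν] {g : E → ℝ} {CV : ℝ}
  {w : E → (Fin n → E) → Fin n → ℝ}

theorem measurePreserving_pi_fst :
    MeasurePreserving (fun (D : Fin n → E × ℝ) i => (D i).1)
      (Measure.pi fun _ : Fin n => Q) (Measure.pi fun _ : Fin n => Q.map Prod.fst) :=
  have : IsProbabilityMeasure (Q.map Prod.fst) :=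
    Measure.isProbabilityMeasure_map measurable_fst.aemeasurable
  measurePreserving_pi _ _ fun _ => ⟨measurable_fst, rfl⟩

theorem lintegral_smoother_sq_le (hY : MemLp (fun p : E × ℝ => p.2) 2 Q)
    (hg : Measurable g)
    (hreg : Q[(fun p : E × ℝ => p.2) | MeasurableSpace.comap Prod.fst inferInstance] =ᵐ[Q]
      fun p => g p.1)
    (hvar : ∀ᵐ p ∂Q, (Var[(fun p : E × ℝ => p.2) ; Q |
      MeasurableSpace.comap Prod.fst inferInstance]) p ≤ CV)
    {CG : ℝ} (hCG : ∀ z, |g z| ≤ CG)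
    (hw : ∀ j, Measurable fun p : E × (Fin n → E) => w p.1 p.2 j) {K : ℕ}
    (hK : ∀ x z (b : Fin n → ℝ), (∑ j, w x z j * b j) ^ 2 ≤ K * ∑ j, w x z j ^ 2 * b j ^ 2)
    {C : ℝ≥0∞} (hC : ∫⁻ x, ∫⁻ z, ∑ j, ENNReal.ofReal (w x z j ^ 2)
      ∂(Measure.pi fun _ : Fin n => Q.map Prod.fst) ∂ν ≤ C) :
    ∫⁻ D, ∫⁻ x, ENNReal.ofReal ((∑ j, w x (fun i => (D i).1) j * (D j).2) ^ 2) ∂ν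
      ∂(Measure.pi fun _ : Fin n => Q) ≤
        ENNReal.ofReal (2 * K) * (ENNReal.ofReal (CG ^ 2) + ENNReal.ofReal CV) * C := by
  have : IsProbabilityMeasure (Q.map Prod.fst) :=
    Measure.isProbabilityMeasure_map measurable_fst.aemeasurable
  have hwx : ∀ x j, Measurable fun z => w x z j := fun x j => (hw j).comp measurable_prodMk_left
  have hw' : ∀ j, Measurable fun p : E × (Fin n → E × ℝ) => w p.1 (fun i => (p.2 i).1) j :=
    fun j => Measurable.comp (g := fun p : E × (Fin n → E) => w p.1 p.2 j)
      (f := fun p : E × (Fin n → E × ℝ) => (p.1, fun i => (p.2 i).1)) (hw j)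
      measurable_fst_pi_prod
  have hy' : ∀ j, Measurable fun p : E × (Fin n → E × ℝ) => (p.2 j).2 := fun j =>
    measurable_snd.comp ((measurable_pi_apply j).comp measurable_snd)
  have hm : Measurable fun p : E × (Fin n → E × ℝ) =>
      ENNReal.ofReal ((∑ j, w p.1 (fun i => (p.2 i).1) j * (p.2 j).2) ^ 2) :=
    ((Finset.measurable_sum _ fun j _ => (hw' j).mul (hy' j)).pow_const 2).ennreal_ofReal
  rw [← lintegral_lintegral_swap (f := fun x (D : Fin n → E × ℝ) =>
    ENNReal.ofReal ((∑ j, w x (fun i => (D i).1) j * (D j).2) ^ 2)) hm.aemeasurable]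
  refine le_trans ?_ (mul_le_mul_right hC _)
  rw [← lintegral_const_mul' _ _ (by finiteness)]
  refine lintegral_mono fun x => ?_
  have hb : ∀ D : Fin n → E × ℝ,
      ENNReal.ofReal ((∑ j, w x (fun i => (D i).1) j * (D j).2) ^ 2) ≤
      ENNReal.ofReal (2 * K) * ∑ j, (ENNReal.ofReal (CG ^ 2) *
        ENNReal.ofReal (w x (fun i => (D i).1) j ^ 2) +
        ENNReal.ofReal (((D j).2 - g (D j).1) ^ 2) *
          ENNReal.ofReal (w x (fun i => (D i).1) j ^ 2)) := by
    intro D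
    simp_rw [← add_mul]
    have h1 : (∑ j, w x (fun i => (D i).1) j * (D j).2) ^ 2 ≤ (2 * K) * ∑ j,
        (CG ^ 2 + ((D j).2 - g (D j).1) ^ 2) * w x (fun i => (D i).1) j ^ 2 := by
      refine (hK _ _ _).trans ?_
      rw [mul_comm 2 (K : ℝ), mul_assoc]
      refine mul_le_mul_of_nonneg_left ?_ (Nat.cast_nonneg K)
      rw [Finset.mul_sum]
      refine Finset.sum_le_sum fun j _ => ?_
      have h2 : g (D j).1 ^ 2 ≤ CG ^ 2 := sq_le_sq' (abs_le.1 (hCG _)).1 (abs_le.1 (hCG _)).2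
      -- The difference of the two sides is at least `(y - 2g)^2`, with `y` the response and `g` the
      -- regression value.
      have h3 : (D j).2 ^ 2 ≤ 2 * (CG ^ 2 + ((D j).2 - g (D j).1) ^ 2) := by
        nlinarith [sq_nonneg ((D j).2 - 2 * g (D j).1)]
      linarith [mul_le_mul_of_nonneg_left h3 (sq_nonneg (w x (fun i => (D i).1) j))]
    refine (ENNReal.ofReal_le_ofReal h1).trans (le_of_eq ?_)
    rw [ENNReal.ofReal_mul (p := 2 * (K : ℝ)) (by positivity), ENNReal.ofReal_sum_of_nonneg fun j _ =>
      mul_nonneg (add_nonneg (sq_nonneg _) (sq_nonneg _)) (sq_nonneg _)]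
    congr 1
    refine Finset.sum_congr rfl fun j _ => ?_
    rw [ENNReal.ofReal_mul (add_nonneg (sq_nonneg _) (sq_nonneg _)), ENNReal.ofReal_add (by positivity) (by positivity)]
  refine (lintegral_mono hb).trans ?_
  have hwD : ∀ j, Measurable fun D : Fin n → E × ℝ =>
      ENNReal.ofReal (w x (fun i => (D i).1) j ^ 2) := fun j =>
    (((hw' j).comp measurable_prodMk_left).pow_const 2).ennreal_ofReal
  have hεD : ∀ j, Measurable fun D : Fin n → E × ℝ =>
      ENNReal.ofReal (((D j).2 - g (D j).1) ^ 2) := fun j => by fun_prop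
  have hsD : ∀ j ∈ (Finset.univ : Finset (Fin n)), Measurable fun D : Fin n → E × ℝ =>
      ENNReal.ofReal (CG ^ 2) * ENNReal.ofReal (w x (fun i => (D i).1) j ^ 2) +
        ENNReal.ofReal (((D j).2 - g (D j).1) ^ 2) *
          ENNReal.ofReal (w x (fun i => (D i).1) j ^ 2) := fun j _ =>
    ((hwD j).const_mul _).add ((hεD j).mul (hwD j))
  rw [lintegral_const_mul' _ _ (by finiteness), lintegral_finsetSum _ hsD, mul_assoc,
    lintegral_finsetSum _ fun j _ => ((hwx x j).pow_const 2).ennreal_ofReal]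
  refine mul_le_mul_right ?_ _
  rw [Finset.mul_sum]
  refine Finset.sum_le_sum fun j _ => ?_
  rw [lintegral_add_left ((hwD j).const_mul _), add_mul, lintegral_const_mul _ (hwD j)]
  have hpush : ∫⁻ D, ENNReal.ofReal (w x (fun i => (D i).1) j ^ 2) ∂(Measure.pi fun _ : Fin n => Q)
      = ∫⁻ z, ENNReal.ofReal (w x z j ^ 2) ∂(Measure.pi fun _ : Fin n => Q.map Prod.fst) :=
    measurePreserving_pi_fst.lintegral_comp (((hwx x j).pow_const 2).ennreal_ofReal)
  rw [hpush]
  refine add_le_add le_rfl ?_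
  exact lintegral_pi_residual_sq_mul_le hY hg hreg hvar j
    (h := fun z => ENNReal.ofReal (w x z j ^ 2)) (((hwx x j).pow_const 2).ennreal_ofReal)

variable (ν w) in
/-- The average weight of the `j`-th observation. -/
noncomputable def avgWeight (z : Fin n → E) (j : Fin n) : ℝ := ∫ x, w x z j ∂ν

theorem measurable_avgWeight (hw : ∀ j, Measurable fun p : E × (Fin n → E) => w p.1 p.2 j)
    (j : Fin n) : Measurable fun z => avgWeight ν w z j :=
  ((hw j).stronglyMeasurable.integral_prod_left' (μ := ν)).measurable

theorem ae_memLp_of_lintegral_sum_sq_le {κ : Measure (Fin n → E)} [SFinite κ]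
    (hw : ∀ j, Measurable fun p : E × (Fin n → E) => w p.1 p.2 j) {C : ℝ≥0∞} (hC' : C ≠ ∞)
    (hC : ∫⁻ x, ∫⁻ z, ∑ j, ENNReal.ofReal (w x z j ^ 2) ∂κ ∂ν ≤ C) :
    ∀ᵐ z ∂κ, ∀ j, MemLp (fun x => w x z j) 2 ν := by
  have hm : Measurable fun p : E × (Fin n → E) => ∑ j, ENNReal.ofReal (w p.1 p.2 j ^ 2) :=
    Finset.measurable_sum _ fun j _ => ((hw j).pow_const 2).ennreal_ofReal
  rw [lintegral_lintegral_swap hm.aemeasurable] at hC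
  filter_upwards [ae_lt_top hm.lintegral_prod_left' (ne_top_of_le_ne_top hC' hC)] with z hz j
  refine memLp_two_of_lintegral_ofReal_sq_lt_top
    ((hw j).comp measurable_prodMk_right).aestronglyMeasurable (lt_of_le_of_lt ?_ hz)
  exact lintegral_mono fun x => Finset.single_le_sum
    (f := fun j => ENNReal.ofReal (w x z j ^ 2)) (fun _ _ => zero_le) (Finset.mem_univ j)

/-- As a function of `x`, the `j`-th weight is supported in `c z j`, so Cauchy-Schwarz gains the
mass of that set. This gain turns the noise into order `1/n`. -/
theorem lintegral_sum_avgWeight_sq_le {κ : Measure (Fin n → E)} [SFinite κ]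
    (hw : ∀ j, Measurable fun p : E × (Fin n → E) => w p.1 p.2 j) {c : (Fin n → E) → Fin n → Set E}
    (hc : ∀ j, MeasurableSet {p : E × (Fin n → E) | p.1 ∈ c p.2 j})
    (hwc : ∀ x z j, x ∉ c z j → w x z j = 0) :
    ∫⁻ z, ∑ j, ENNReal.ofReal (avgWeight ν w z j ^ 2) ∂κ ≤
      ∫⁻ x, ∫⁻ z, ∑ j, ENNReal.ofReal (w x z j ^ 2) * ν (c z j) ∂κ ∂ν := by
  have hm : Measurable fun p : E × (Fin n → E) =>
      ∑ j, ENNReal.ofReal (w p.1 p.2 j ^ 2) * ν (c p.2 j) :=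
    Finset.measurable_sum _ fun j _ => ((hw j).pow_const 2).ennreal_ofReal.mul
      ((measurable_measure_prodMk_right (hc j)).comp measurable_snd)
  rw [lintegral_lintegral_swap hm.aemeasurable]
  refine lintegral_mono fun z => ?_
  have hwz : ∀ j, Measurable fun x => w x z j := fun j => (hw j).comp measurable_prodMk_right
  rw [lintegral_finsetSum _ fun j _ => ((hwz j).pow_const 2).ennreal_ofReal.mul_const _]
  refine Finset.sum_le_sum fun j _ => ?_
  rw [lintegral_mul_const _ ((hwz j).pow_const 2).ennreal_ofReal, mul_comm]
  exact ofReal_sq_integral_le_measure_mul (hwz j).aemeasurable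
    (measurable_prodMk_right (hc j)) fun x hx => hwc x z j hx

/-- Jensen's inequality: the bias of the average is the average of the pointwise biases. Square
integrability of the weights permits the interchange of sum and integral. -/
theorem lintegral_sq_avgWeight_bias_le {κ : Measure (Fin n → E)} [SFinite κ]
    (hw : ∀ j, Measurable fun p : E × (Fin n → E) => w p.1 p.2 j)
    (hg : Measurable g) {φ : E → ℝ} (hφ : Measurable φ) (hφi : Integrable φ ν)
    (hint : ∀ᵐ z ∂κ, ∀ j, MemLp (fun x => w x z j) 2 ν) :
    ∫⁻ z, ENNReal.ofReal ((∑ j, avgWeight ν w z j * g (z j) - ∫ x, φ x ∂ν) ^ 2) ∂κ ≤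
      ∫⁻ x, ∫⁻ z, ENNReal.ofReal ((∑ j, w x z j * g (z j) - φ x) ^ 2) ∂κ ∂ν := by
  have hm0 : Measurable fun p : E × (Fin n → E) => ∑ j, w p.1 p.2 j * g (p.2 j) - φ p.1 :=
    (Finset.measurable_sum _ fun j _ => (hw j).mul
      (hg.comp ((measurable_pi_apply j).comp measurable_snd))).sub (hφ.comp measurable_fst)
  rw [lintegral_lintegral_swap (hm0.pow_const 2).ennreal_ofReal.aemeasurable]
  refine lintegral_mono_ae (hint.mono fun z hz => ?_)
  have h1 : ∑ j, avgWeight ν w z j * g (z j) - ∫ x, φ x ∂ν =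
      ∫ x, (∑ j, w x z j * g (z j) - φ x) ∂ν := by
    have hi : ∀ j ∈ (Finset.univ : Finset (Fin n)),
        Integrable (fun x => w x z j * g (z j)) ν := fun j _ =>
      ((hz j).integrable (by norm_num)).mul_const _
    rw [integral_sub (integrable_finsetSum _ hi) hφi, integral_finsetSum _ hi]
    simp_rw [integral_mul_const, avgWeight]
  rw [h1]
  exact ofReal_sq_integral_le (hm0.comp measurable_prodMk_right).aemeasurable

end LinearSmoother

/-! ### Risk of the mean of a linear smoother -/

theorem MeasureTheory.MeasurePreserving.integral_comp_of_measurable {α β : Type*}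
    [MeasurableSpace α] [MeasurableSpace β] {μ : Measure α} {ν : Measure β} {f : α → β}
    (hf : MeasurePreserving f μ ν) {F : β → ℝ} (hF : Measurable F) :
    ∫ x, F (f x) ∂μ = ∫ y, F y ∂ν := by
  rw [← hf.map_eq, integral_map hf.aemeasurable hF.aestronglyMeasurable]

theorem fst_update {E F : Type*} {n : ℕ} (D : Fin n → E × F) (j : Fin n) (t : E × F) :
    (fun i => (Function.update D j t i).1) = Function.update (fun i => (D i).1) j t.1 := by
  ext i
  by_cases h : i = j
  · subst h; simp
  · simp [Function.update_of_ne h]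

theorem integral_add_add {α : Type*} [MeasurableSpace α] {μ : Measure α} {f g h : α → ℝ}
    (hf : Integrable f μ) (hg : Integrable g μ) (hh : Integrable h μ) :
    ∫ x, (f x + g x + h x) ∂μ = ∫ x, f x ∂μ + ∫ x, g x ∂μ + ∫ x, h x ∂μ := by
  rw [integral_add (f := fun x => f x + g x) (hf.add hg) hh, integral_add hf hg]

section SmootherRisk

variable {E : Type*} [mE : MeasurableSpace E] {n m : ℕ} {Q : Measure (E × ℝ)}
  [IsProbabilityMeasure Q] {ν : Measure E} [IsProbabilityMeasure ν] {g : E → ℝ} {CV : ℝ}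
  {w : E → (Fin n → E) → Fin n → ℝ} {a : (Fin n → E) → Fin n → ℝ}

theorem measurable_fst_pi : Measurable fun (D : Fin n → E × ℝ) i => (D i).1 :=
  measurable_pi_lambda _ fun i => measurable_fst.comp (measurable_pi_apply i)

theorem memLp_residual_mul (hY : MemLp (fun p : E × ℝ => p.2) 2 Q) (hg : Measurable g)
    (hreg : Q[(fun p : E × ℝ => p.2) | MeasurableSpace.comap Prod.fst inferInstance] =ᵐ[Q]
      fun p => g p.1)
    (hvar : ∀ᵐ p ∂Q, (Var[(fun p : E × ℝ => p.2) ; Q |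
      MeasurableSpace.comap Prod.fst inferInstance]) p ≤ CV) (j : Fin n)
    {b : (Fin n → E) → ℝ} (hb : Measurable b)
    (hfin : ∫⁻ z, ENNReal.ofReal (b z ^ 2) ∂(Measure.pi fun _ : Fin n => Q.map Prod.fst) < ∞) :
    MemLp (fun D : Fin n → E × ℝ => ((D j).2 - g (D j).1) * b fun i => (D i).1) 2
      (Measure.pi fun _ => Q) := by
  have hbm : Measurable fun D : Fin n → E × ℝ => b fun i => (D i).1 := hb.comp measurable_fst_pi
  have hε : Measurable fun D : Fin n → E × ℝ => (D j).2 - g (D j).1 := by fun_prop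
  refine memLp_two_of_lintegral_ofReal_sq_lt_top (hε.mul hbm).aestronglyMeasurable ?_
  simp_rw [mul_pow, ENNReal.ofReal_mul (sq_nonneg _)]
  exact (lintegral_pi_residual_sq_mul_le hY hg hreg hvar j
    (h := fun z => ENNReal.ofReal (b z ^ 2)) (hb.pow_const 2).ennreal_ofReal).trans_lt
      (ENNReal.mul_lt_top ENNReal.ofReal_lt_top hfin)

theorem lintegral_sq_sum_residual_mul_le (hY : MemLp (fun p : E × ℝ => p.2) 2 Q)
    (hg : Measurable g)
    (hreg : Q[(fun p : E × ℝ => p.2) | MeasurableSpace.comap Prod.fst inferInstance] =ᵐ[Q]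
      fun p => g p.1)
    (hvar : ∀ᵐ p ∂Q, (Var[(fun p : E × ℝ => p.2) ; Q |
      MeasurableSpace.comap Prod.fst inferInstance]) p ≤ CV)
    (ha : ∀ j, Measurable fun z => a z j)
    (hfin : ∀ j, ∫⁻ z, ENNReal.ofReal (a z j ^ 2)
      ∂(Measure.pi fun _ : Fin n => Q.map Prod.fst) < ∞) :
    ∫⁻ D, ENNReal.ofReal ((∑ j, ((D j).2 - g (D j).1) * a (fun i => (D i).1) j) ^ 2)
      ∂(Measure.pi fun _ => Q) ≤ ENNReal.ofReal CV *
        ∫⁻ z, ∑ j, ENNReal.ofReal (a z j ^ 2) ∂(Measure.pi fun _ : Fin n => Q.map Prod.fst) := by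
  set T : Fin n → (Fin n → E × ℝ) → ℝ := fun j D =>
    ((D j).2 - g (D j).1) * a (fun i => (D i).1) j with hT
  have hTL : ∀ j, MemLp (T j) 2 (Measure.pi fun _ => Q) := fun j =>
    memLp_residual_mul hY hg hreg hvar j (ha j) (hfin j)
  have hsum : MemLp (fun D => ∑ j, T j D) 2 (Measure.pi fun _ => Q) :=
    memLp_finsetSum _ fun j _ => hTL j
  -- The factor `T i` does not involve the `j`-th response, so the `j`-th residual averages out.
  have hcross : ∀ i j, i ≠ j → ∫ D, T i D * T j D ∂(Measure.pi fun _ => Q) = 0 := by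
    intro i j hij
    have hi : Integrable (fun D => T j D * T i D) (Measure.pi fun _ => Q) :=
      (hTL j).integrable_mul (hTL i)
    have haD : ∀ i, Measurable fun D : Fin n → E × ℝ => a (fun k => (D k).1) i :=
      fun i => (ha i).comp measurable_fst_pi
    have hεD : ∀ j, Measurable fun D : Fin n → E × ℝ => (D j).2 - g (D j).1 :=
      fun j => by fun_prop
    have h0 := integral_pi_residual_mul_eq_zero hY hreg j
      (h := fun D => a (fun k => (D k).1) j * T i D)
      ((haD j).mul ((hεD i).mul (haD i)))
      (fun D z y => by simp only [hT, fst_update, Function.update_of_ne hij])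
      (hi.congr (Filter.Eventually.of_forall fun D => by simp only [hT]; ring))
    rw [← h0]
    exact integral_congr_ae (Filter.Eventually.of_forall fun D => by simp only [hT]; ring)
  have hsq : ∫ D, (∑ j, T j D) ^ 2 ∂(Measure.pi fun _ => Q) =
      ∑ j, ∫ D, T j D ^ 2 ∂(Measure.pi fun _ => Q) := by
    have h1 : ∀ D, (∑ j, T j D) ^ 2 = ∑ i, ∑ j, T i D * T j D := fun D => by
      rw [sq, Finset.sum_mul_sum]
    simp_rw [h1]
    have hTi : ∀ i j, Integrable (fun D => T i D * T j D) (Measure.pi fun _ => Q) :=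
      fun i j => (hTL i).integrable_mul (hTL j)
    rw [integral_finsetSum _ fun i _ => integrable_finsetSum _ fun j _ => hTi i j]
    refine Finset.sum_congr rfl fun i _ => ?_
    rw [integral_finsetSum _ fun j _ => hTi i j,
      Finset.sum_eq_single i (fun j _ hj => hcross i j hj.symm) (by simp)]
    simp_rw [sq]
  rw [hsum.lintegral_ofReal_sq, hsq, ENNReal.ofReal_sum_of_nonneg fun j _ =>
    integral_nonneg fun D => sq_nonneg _,
    lintegral_finsetSum _ fun j _ => ((ha j).pow_const 2).ennreal_ofReal, Finset.mul_sum]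
  refine Finset.sum_le_sum fun j _ => ?_
  rw [← (hTL j).lintegral_ofReal_sq]
  simp_rw [hT, mul_pow, ENNReal.ofReal_mul (sq_nonneg _)]
  exact lintegral_pi_residual_sq_mul_le hY hg hreg hvar j
    (h := fun z => ENNReal.ofReal (a z j ^ 2)) ((ha j).pow_const 2).ennreal_ofReal

theorem integral_mul_sum_residual_mul_eq_zero (hY : MemLp (fun p : E × ℝ => p.2) 2 Q)
    (hg : Measurable g)
    (hreg : Q[(fun p : E × ℝ => p.2) | MeasurableSpace.comap Prod.fst inferInstance] =ᵐ[Q]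
      fun p => g p.1)
    (hvar : ∀ᵐ p ∂Q, (Var[(fun p : E × ℝ => p.2) ; Q |
      MeasurableSpace.comap Prod.fst inferInstance]) p ≤ CV)
    (ha : ∀ j, Measurable fun z => a z j)
    (hfin : ∀ j, ∫⁻ z, ENNReal.ofReal (a z j ^ 2)
      ∂(Measure.pi fun _ : Fin n => Q.map Prod.fst) < ∞)
    {h : (Fin n → E) → ℝ} (hh : Measurable h) {B : ℝ} (hB : ∀ z, ‖h z‖ ≤ B) :
    ∫ D, h (fun i => (D i).1) * ∑ j, ((D j).2 - g (D j).1) * a (fun i => (D i).1) j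
      ∂(Measure.pi fun _ => Q) = 0 := by
  have hhD : Measurable fun D : Fin n → E × ℝ => h fun i => (D i).1 := hh.comp measurable_fst_pi
  have hi : ∀ j, Integrable (fun D : Fin n → E × ℝ =>
      h (fun i => (D i).1) * (((D j).2 - g (D j).1) * a (fun i => (D i).1) j))
      (Measure.pi fun _ => Q) := fun j =>
    ((memLp_residual_mul hY hg hreg hvar j (ha j) (hfin j)).integrable (by norm_num)).bdd_mul
      hhD.aestronglyMeasurable (Filter.Eventually.of_forall fun D => hB _)
  simp_rw [Finset.mul_sum]
  rw [integral_finsetSum _ fun j _ => hi j]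
  refine Finset.sum_eq_zero fun j _ => ?_
  have haD : ∀ i, Measurable fun D : Fin n → E × ℝ => a (fun k => (D k).1) i :=
    fun i => (ha i).comp measurable_fst_pi
  rw [← integral_pi_residual_mul_eq_zero hY hreg j
      (h := fun D => h (fun k => (D k).1) * a (fun k => (D k).1) j) (hhD.mul (haD j))
      (fun D z y => by simp only [fst_update])
      ((hi j).congr (Filter.Eventually.of_forall fun D => by ring))]
  exact integral_congr_ae (Filter.Eventually.of_forall fun D => by ring)

omit [IsProbabilityMeasure ν] in
theorem memLp_smoother {z : Fin n → E} (hz : ∀ j, MemLp (fun x => w x z j) 2 ν) (y : Fin n → ℝ) :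
    MemLp (fun x => ∑ j, w x z j * y j) 2 ν :=
  memLp_finsetSum _ fun j _ => by simpa [mul_comm] using (hz j).const_mul (y j)

theorem integral_smoother {z : Fin n → E} (hz : ∀ j, MemLp (fun x => w x z j) 2 ν)
    (y : Fin n → ℝ) :
    ∫ x, ∑ j, w x z j * y j ∂ν = ∑ j, avgWeight ν w z j * y j := by
  rw [integral_finsetSum _ fun j _ => ((hz j).integrable (by norm_num)).mul_const _]
  simp_rw [integral_mul_const, avgWeight]

variable (m w) in
/-- The mean of a linear smoother over the points of a sample. -/
noncomputable def smootherMean (p : (Fin n → E × ℝ) × (Fin m → E)) : ℝ :=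
  (m : ℝ)⁻¹ * ∑ k, ∑ j, w (p.2 k) (fun i => (p.1 i).1) j * (p.1 j).2

theorem measurable_smootherMean (hw : ∀ j, Measurable fun p : E × (Fin n → E) => w p.1 p.2 j) :
    Measurable (smootherMean m w) := by
  refine (Finset.measurable_sum _ fun k _ => Finset.measurable_sum _ fun j _ =>
    Measurable.mul ?_ ?_).const_mul _
  · exact Measurable.comp (g := fun p : E × (Fin n → E) => w p.1 p.2 j)
      (f := fun p : (Fin n → E × ℝ) × (Fin m → E) => (p.2 k, fun i => (p.1 i).1)) (hw j)
      (((measurable_pi_apply k).comp measurable_snd).prodMk (measurable_fst_pi.comp measurable_fst))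
  · exact measurable_snd.comp ((measurable_pi_apply j).comp measurable_fst)

/-- The mean squared error of the mean of a linear smoother over an independent sample, and its
conditional bias, in terms of the average weights. -/
theorem smootherMean_sub_memLp_and_integral (hm : 1 ≤ m)
    (hY : MemLp (fun p : E × ℝ => p.2) 2 Q) (hg : Measurable g)
    (hreg : Q[(fun p : E × ℝ => p.2) | MeasurableSpace.comap Prod.fst inferInstance] =ᵐ[Q]
      fun p => g p.1) (hCV : 0 ≤ CV)
    (hvar : ∀ᵐ p ∂Q, (Var[(fun p : E × ℝ => p.2) ; Q |
      MeasurableSpace.comap Prod.fst inferInstance]) p ≤ CV)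
    (hw : ∀ j, Measurable fun p : E × (Fin n → E) => w p.1 p.2 j)
    (hint : ∀ᵐ z ∂(Measure.pi fun _ : Fin n => Q.map Prod.fst),
      ∀ j, MemLp (fun x => w x z j) 2 ν) {V W B φ : ℝ} (hV0 : 0 ≤ V) (hW0 : 0 ≤ W) (hB0 : 0 ≤ B)
    (hV : ∫⁻ D, ∫⁻ x, ENNReal.ofReal ((∑ j, w x (fun i => (D i).1) j * (D j).2) ^ 2) ∂ν
      ∂(Measure.pi fun _ : Fin n => Q) ≤ ENNReal.ofReal V)
    (hW : ∫⁻ z, ∑ j, ENNReal.ofReal (avgWeight ν w z j ^ 2)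
      ∂(Measure.pi fun _ : Fin n => Q.map Prod.fst) ≤ ENNReal.ofReal W)
    (hB : ∫⁻ z, ENNReal.ofReal ((∑ j, avgWeight ν w z j * g (z j) - φ) ^ 2)
      ∂(Measure.pi fun _ : Fin n => Q.map Prod.fst) ≤ ENNReal.ofReal B) :
    MemLp (fun p => smootherMean m w p - φ) 2
      ((Measure.pi fun _ : Fin n => Q).prod (Measure.pi fun _ : Fin m => ν)) ∧
    ∫ p, (smootherMean m w p - φ) ^ 2
      ∂((Measure.pi fun _ : Fin n => Q).prod (Measure.pi fun _ : Fin m => ν)) ≤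
        3 * ((m : ℝ)⁻¹ * V + CV * W + B) ∧
    ∀ (h : (Fin n → E) → ℝ), Measurable h → ∀ b : ℝ, (∀ z, ‖h z‖ ≤ b) →
      ∫ p, h (fun i => (p.1 i).1) * (smootherMean m w p - φ)
        ∂((Measure.pi fun _ : Fin n => Q).prod (Measure.pi fun _ : Fin m => ν)) =
      ∫ z, h z * (∑ j, avgWeight ν w z j * g (z j) - φ)
        ∂(Measure.pi fun _ : Fin n => Q.map Prod.fst) := by
  have : IsProbabilityMeasure (Q.map Prod.fst) :=
    Measure.isProbabilityMeasure_map measurable_fst.aemeasurable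
  set PQ := Measure.pi fun _ : Fin n => Q with hPQ
  set PX := Measure.pi fun _ : Fin m => ν with hPX
  set Pz := Measure.pi fun _ : Fin n => Q.map Prod.fst with hPz
  have hmp : MeasurePreserving (fun (D : Fin n → E × ℝ) i => (D i).1) PQ Pz :=
    measurePreserving_pi_fst
  have ha : ∀ j, Measurable fun z => avgWeight ν w z j := measurable_avgWeight hw
  have hfin : ∀ j, ∫⁻ z, ENNReal.ofReal (avgWeight ν w z j ^ 2) ∂Pz < ∞ := fun j =>
    (lintegral_mono fun z => Finset.single_le_sum
      (f := fun j => ENNReal.ofReal (avgWeight ν w z j ^ 2)) (fun _ _ => zero_le)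
      (Finset.mem_univ j)).trans_lt (hW.trans_lt ENNReal.ofReal_lt_top)
  have haD : ∀ j, Measurable fun D : Fin n → E × ℝ => avgWeight ν w (fun i => (D i).1) j :=
    fun j => (ha j).comp measurable_fst_pi
  have hεD : ∀ j, Measurable fun D : Fin n → E × ℝ => (D j).2 - g (D j).1 :=
    fun j => by fun_prop
  have hyD : ∀ j, Measurable fun D : Fin n → E × ℝ => (D j).2 :=
    fun j => measurable_snd.comp (measurable_pi_apply j)
  -- the three parts of the error
  set A : (Fin n → E × ℝ) × (Fin m → E) → ℝ := fun p => smootherMean m w p -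
    ∑ j, avgWeight ν w (fun i => (p.1 i).1) j * (p.1 j).2 with hA
  set R : (Fin n → E × ℝ) → ℝ := fun D =>
    ∑ j, ((D j).2 - g (D j).1) * avgWeight ν w (fun i => (D i).1) j with hR
  set b : (Fin n → E) → ℝ := fun z => ∑ j, avgWeight ν w z j * g (z j) - φ with hb
  have hdec : ∀ p, smootherMean m w p - φ = A p + R p.1 + b (fun i => (p.1 i).1) := by
    intro p
    simp only [hA, hR, hb]
    have : ∑ j, avgWeight ν w (fun i => (p.1 i).1) j * (p.1 j).2 =
        ∑ j, ((p.1 j).2 - g (p.1 j).1) * avgWeight ν w (fun i => (p.1 i).1) j +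
        ∑ j, avgWeight ν w (fun i => (p.1 i).1) j * g (p.1 j).1 := by
      rw [← Finset.sum_add_distrib]
      exact Finset.sum_congr rfl fun j _ => by ring
    rw [this]; ring
  have hAm : Measurable A := (measurable_smootherMean hw).sub
    ((Finset.measurable_sum _ fun j _ => (haD j).mul (hyD j)).comp measurable_fst)
  have hRm : Measurable R := Finset.measurable_sum _ fun j _ => (hεD j).mul (haD j)
  have hbm : Measurable b := (Finset.measurable_sum _ fun j _ => (ha j).mul
    (hg.comp (measurable_pi_apply j))).sub measurable_const
  have hintD : ∀ᵐ D ∂PQ, ∀ j, MemLp (fun x => w x (fun i => (D i).1) j) 2 ν :=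
    hmp.quasiMeasurePreserving.ae hint
  -- the sampling error
  have hA2 : ∫⁻ p, ENNReal.ofReal (A p ^ 2) ∂(PQ.prod PX) ≤ ENNReal.ofReal ((m : ℝ)⁻¹ * V) := by
    rw [lintegral_prod _ (hAm.pow_const 2).ennreal_ofReal.aemeasurable,
      ENNReal.ofReal_mul (by positivity)]
    refine le_trans ?_ (mul_le_mul_right hV _)
    rw [← lintegral_const_mul' _ _ ENNReal.ofReal_ne_top]
    -- For fixed data the smoother at the sample points is an average of i.i.d. variables whose mean
    -- is the fit with averaged weights.
    refine lintegral_mono_ae (hintD.mono fun D hD => ?_)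
    have hL := memLp_smoother hD fun j => (D j).2
    have h1 := integral_sq_sample_mean_sub_le hm hL
    rw [integral_smoother hD] at h1
    have hLX : MemLp (fun X : Fin m → E => A (D, X)) 2 PX := by
      have h2 : MemLp (fun X : Fin m → E => (m : ℝ)⁻¹ * ∑ k, ∑ j,
          w (X k) (fun i => (D i).1) j * (D j).2) 2 PX :=
        (memLp_finsetSum _ fun k _ =>
          hL.comp_measurePreserving (measurePreserving_eval (fun _ : Fin m => ν) k)).const_mul _
      exact h2.sub (memLp_const (∑ j, avgWeight ν w (fun i => (D i).1) j * (D j).2))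
    rw [hLX.lintegral_ofReal_sq, hL.lintegral_ofReal_sq, ← ENNReal.ofReal_mul (by positivity)]
    exact ENNReal.ofReal_le_ofReal h1
  have hR2 : ∫⁻ D, ENNReal.ofReal (R D ^ 2) ∂PQ ≤ ENNReal.ofReal (CV * W) := by
    rw [ENNReal.ofReal_mul hCV]
    exact (lintegral_sq_sum_residual_mul_le hY hg hreg hvar ha hfin).trans
      (mul_le_mul_right hW _)
  have hAL : MemLp A 2 (PQ.prod PX) := memLp_two_of_lintegral_ofReal_sq_lt_top
    hAm.aestronglyMeasurable (hA2.trans_lt ENNReal.ofReal_lt_top)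
  have hRL : MemLp R 2 PQ := memLp_two_of_lintegral_ofReal_sq_lt_top
    hRm.aestronglyMeasurable (hR2.trans_lt ENNReal.ofReal_lt_top)
  have hbL : MemLp b 2 Pz := memLp_two_of_lintegral_ofReal_sq_lt_top
    hbm.aestronglyMeasurable (hB.trans_lt ENNReal.ofReal_lt_top)
  have hfstp : MeasurePreserving (Prod.fst : (Fin n → E × ℝ) × (Fin m → E) → _)
      (PQ.prod PX) PQ := measurePreserving_fst
  have hRL' : MemLp (fun p : (Fin n → E × ℝ) × (Fin m → E) => R p.1) 2 (PQ.prod PX) :=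
    hRL.comp_measurePreserving hfstp
  have hbLD : MemLp (fun D : Fin n → E × ℝ => b fun i => (D i).1) 2 PQ :=
    hbL.comp_measurePreserving hmp
  have hbL' : MemLp (fun p : (Fin n → E × ℝ) × (Fin m → E) => b fun i => (p.1 i).1) 2
      (PQ.prod PX) := hbLD.comp_measurePreserving hfstp
  have hsumL : MemLp (fun p => smootherMean m w p - φ) 2 (PQ.prod PX) := by
    simp_rw [hdec]
    exact (hAL.add hRL').add hbL'
  refine ⟨hsumL, ?_, ?_⟩
  · have hAr : ∫ p, A p ^ 2 ∂(PQ.prod PX) ≤ (m : ℝ)⁻¹ * V := by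
      rw [hAL.lintegral_ofReal_sq] at hA2
      exact (ENNReal.ofReal_le_ofReal_iff (by positivity)).1 hA2
    have hRr : ∫ p : (Fin n → E × ℝ) × (Fin m → E), R p.1 ^ 2 ∂(PQ.prod PX) ≤ CV * W := by
      rw [← hfstp.lintegral_comp (hRm.pow_const 2).ennreal_ofReal,
        hRL'.lintegral_ofReal_sq] at hR2
      exact (ENNReal.ofReal_le_ofReal_iff (by positivity)).1 hR2
    have hbr : ∫ p : (Fin n → E × ℝ) × (Fin m → E), b (fun i => (p.1 i).1) ^ 2 ∂(PQ.prod PX)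
        ≤ B := by
      rw [← (hmp.comp hfstp).lintegral_comp (hbm.pow_const 2).ennreal_ofReal] at hB
      have h2 := hbL'.lintegral_ofReal_sq
      simp only [Function.comp_def] at hB
      rw [h2] at hB
      exact (ENNReal.ofReal_le_ofReal_iff (by positivity)).1 hB
    have hle : ∀ p, (smootherMean m w p - φ) ^ 2 ≤
        3 * (A p ^ 2 + R p.1 ^ 2 + b (fun i => (p.1 i).1) ^ 2) := by
      intro p
      rw [hdec]
      nlinarith [sq_nonneg (A p - R p.1), sq_nonneg (A p - b fun i => (p.1 i).1),
        sq_nonneg (R p.1 - b fun i => (p.1 i).1)]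
    have hi : Integrable (fun p => 3 * (A p ^ 2 + R p.1 ^ 2 + b (fun i => (p.1 i).1) ^ 2))
        (PQ.prod PX) :=
      ((hAL.integrable_sq.add hRL'.integrable_sq).add hbL'.integrable_sq).const_mul 3
    refine (integral_mono hsumL.integrable_sq hi hle).trans ?_
    rw [integral_const_mul, integral_add_add hAL.integrable_sq hRL'.integrable_sq
      hbL'.integrable_sq]
    linarith
  -- Against a function of the covariates the sampling error integrates to zero given the data, and
  -- the noise given the covariates. Only `b` survives, which is the conditional bias in weak form.
  · intro h hh c hc
    have hhD : Measurable fun D : Fin n → E × ℝ => h fun i => (D i).1 := hh.comp measurable_fst_pi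
    have hhp : Measurable fun p : (Fin n → E × ℝ) × (Fin m → E) => h fun i => (p.1 i).1 :=
      hhD.comp measurable_fst
    have hbdd : ∀ {F : (Fin n → E × ℝ) × (Fin m → E) → ℝ}, MemLp F 2 (PQ.prod PX) →
        Integrable (fun p => h (fun i => (p.1 i).1) * F p) (PQ.prod PX) := fun hF =>
      (hF.integrable (by norm_num)).bdd_mul hhp.aestronglyMeasurable
        (Filter.Eventually.of_forall fun p => hc _)
    have hAz : ∫ p, h (fun i => (p.1 i).1) * A p ∂(PQ.prod PX) = 0 := by
      rw [integral_prod _ (hbdd hAL)]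
      refine integral_eq_zero_of_ae (hintD.mono fun D hD => ?_)
      have hL := memLp_smoother hD fun j => (D j).2
      have hLi := hL.integrable (by norm_num)
      have h1 := integral_sample_mean hm hLi
      rw [integral_smoother hD] at h1
      have hi : Integrable (fun X : Fin m → E => (m : ℝ)⁻¹ * ∑ k, ∑ j,
          w (X k) (fun i => (D i).1) j * (D j).2) PX :=
        (integrable_finsetSum _ fun k _ => (measurePreserving_eval
          (fun _ : Fin m => ν) k).integrable_comp_of_integrable hLi).const_mul _
      simp only [Pi.zero_apply, integral_const_mul, hA, smootherMean]
      rw [integral_sub hi (integrable_const _), h1]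
      simp
    have hRz : ∫ p : (Fin n → E × ℝ) × (Fin m → E), h (fun i => (p.1 i).1) * R p.1
        ∂(PQ.prod PX) = 0 := by
      have h1 := integral_mul_sum_residual_mul_eq_zero hY hg hreg hvar ha hfin hh hc
      exact (hfstp.integral_comp_of_measurable
        (F := fun D => h (fun i => (D i).1) * R D) (hhD.mul hRm)).trans h1
    have hbz : ∫ p : (Fin n → E × ℝ) × (Fin m → E),
        h (fun i => (p.1 i).1) * b (fun i => (p.1 i).1) ∂(PQ.prod PX) = ∫ z, h z * b z ∂Pz :=
      (hmp.comp hfstp).integral_comp_of_measurable (F := fun z => h z * b z) (hh.mul hbm)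
    simp_rw [hdec, mul_add]
    rw [integral_add_add (hbdd hAL) (hbdd hRL') (hbdd hbL'), hAz, hRz, hbz, zero_add, zero_add]

end SmootherRisk

/-! ### Risk of the averaged nearest neighbour fit -/

section NearestNeighborRisk

variable {d n : ℕ} {L K : ℕ} {Sstar : Set (RSpace d)}

theorem sum_ofReal_nnWeight_sq_le (x : RSpace d) (z : Fin n → RSpace d) :
    ∑ j, ENNReal.ofReal (nnWeight L K Sstar x z j ^ 2) ≤ cellMoment L K Sstar 0 x z := by
  rw [← ENNReal.ofReal_sum_of_nonneg fun j _ => sq_nonneg _]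
  exact ofReal_sum_nnWeight_sq_le x z

theorem measurable_cellMoment_right (hS : MeasurableSet Sstar) (a : ℝ) (x : RSpace d) :
    Measurable fun z : Fin n → RSpace d => cellMoment L K Sstar a x z :=
  Measurable.comp (g := fun p : RSpace d × (Fin n → RSpace d) => cellMoment L K Sstar a p.1 p.2)
    (f := fun z => (x, z)) (measurable_cellMoment hS a) measurable_prodMk_left

/-- Given the other points, a tie puts `z j` on a sphere around `x`, which is a null set. -/
theorem ae_pi_norm_sub_ne [Nonempty (Fin d)] {μ : Measure (RSpace d)} [IsProbabilityMeasure μ]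
    (hμ : μ ≪ volume) (x : RSpace d) :
    ∀ᵐ z ∂(Measure.pi fun _ : Fin n => μ), ∀ i j, i ≠ j → ‖x - z i‖ ≠ ‖x - z j‖ := by
  rw [ae_all_iff]; intro i
  rw [ae_all_iff]; intro j
  by_cases hij : i = j
  · exact Filter.Eventually.of_forall fun z h => absurd hij h
  have hset : MeasurableSet {z : Fin n → RSpace d | ‖x - z i‖ = ‖x - z j‖} :=
    measurableSet_eq_fun (by fun_prop) (by fun_prop)
  have h0 : (Measure.pi fun _ : Fin n => μ) {z | ‖x - z i‖ = ‖x - z j‖} = 0 := by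
    rw [← lintegral_indicator_one hset,
      lintegral_pi_eq_lintegral_update j (measurable_one.indicator hset)]
    rw [lintegral_eq_zero_iff' (Measurable.lintegral_prod_left'
      (f := fun p : RSpace d × (Fin n → RSpace d) => Set.indicator
        {z : Fin n → RSpace d | ‖x - z i‖ = ‖x - z j‖} 1 (Function.update p.2 j p.1))
      ((measurable_one.indicator hset).comp (measurable_update_prod j))).aemeasurable]
    refine Filter.Eventually.of_forall fun z => ?_
    have hsph : μ (Metric.sphere x ‖x - z i‖) = 0 := hμ (Measure.addHaar_sphere _ _ _)
    have hle : ∀ t, Set.indicator {z : Fin n → RSpace d | ‖x - z i‖ = ‖x - z j‖} (1 : (Fin n → RSpace d) → ℝ≥0∞)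
        (Function.update z j t) ≤ (Metric.sphere x ‖x - z i‖).indicator 1 t := by
      intro t
      by_cases ht : Function.update z j t ∈ {z : Fin n → RSpace d | ‖x - z i‖ = ‖x - z j‖}
      · have ht' : t ∈ Metric.sphere x ‖x - z i‖ := by
          simp only [Set.mem_ofPred_eq, Function.update_of_ne hij, Function.update_self] at ht
          rw [mem_sphere_iff_norm, norm_sub_rev, ht]
        rw [Set.indicator_of_mem ht, Set.indicator_of_mem ht', Pi.one_apply, Pi.one_apply]
      · rw [Set.indicator_of_notMem ht]
        exact zero_le
    refine le_antisymm ((lintegral_mono hle).trans ?_) zero_le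
    rw [lintegral_indicator_one Metric.isClosed_sphere.measurableSet, hsph, Pi.zero_apply]
  filter_upwards [measure_eq_zero_iff_ae_notMem.1 h0] with z hz _ using hz

set_option maxHeartbeats 400000 in
/-- The risk of the nearest neighbor fit, averaged over an independent sample, as an estimator of
an integral of the regression function, and its conditional bias given the covariates. -/
theorem exists_nnFit_risk_le (L K : ℕ) (hd : 1 ≤ d) (hK1 : 1 ≤ K)
    (hK : (2 * DConst d L + 1) * numMonomials d L ≤ K) {c : ℝ} (hc : 0 < c) {R Cf : ℝ≥0∞}
    (hR : R ≠ ∞) (hCf : Cf ≠ ∞) :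
    ∃ C : ℝ, 0 < C ∧ ∀ (Sstar O : Set (RSpace d)) (Q : Measure (RSpace d × ℝ))
      [IsProbabilityMeasure Q] (ν : Measure (RSpace d)) [IsProbabilityMeasure ν],
      MeasurableSet Sstar → IsOpen O → Convex ℝ O → Sstar ⊆ O → Q.map Prod.fst ≤ R • volume →
      (∀ᵐ t ∂(Q.map Prod.fst), t ∈ O) →
      (∀ x ∈ Sstar, ∀ᵐ t ∂(Q.map Prod.fst),
        c * dist t x ^ d ≤ (Q.map Prod.fst).real (Metric.closedBall x (dist t x))) →
      ν ≤ Cf • volume → ∀ (g : RSpace d → ℝ) (β CH CG CV : ℝ), Measurable g →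
      (∀ z, |g z| ≤ CG) → 0 < β → β ≤ 1 → 0 ≤ CH → 0 ≤ CV → IsBoundedHolder O L β CH CG g →
      MemLp (fun p : RSpace d × ℝ => p.2) 2 Q →
      (Q[(fun p : RSpace d × ℝ => p.2) | MeasurableSpace.comap Prod.fst inferInstance] =ᵐ[Q]
        fun p => g p.1) →
      (∀ᵐ p ∂Q, (Var[(fun p : RSpace d × ℝ => p.2) ; Q |
        MeasurableSpace.comap Prod.fst inferInstance]) p ≤ CV) →
      ∀ n m : ℕ, K ≤ n → 1 ≤ m →
      MemLp (fun p => smootherMean m (nnWeight (n := n) L K Sstar) p -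
          ∫ x, Sstar.indicator g x ∂ν) 2
        ((Measure.pi fun _ : Fin n => Q).prod (Measure.pi fun _ : Fin m => ν)) ∧
      ∫ p, (smootherMean m (nnWeight (n := n) L K Sstar) p -
          ∫ x, Sstar.indicator g x ∂ν) ^ 2
        ∂((Measure.pi fun _ : Fin n => Q).prod (Measure.pi fun _ : Fin m => ν)) ≤
        C * ((CV + CG ^ 2) * (m : ℝ)⁻¹ + CV * (n : ℝ)⁻¹ +
          CH ^ 2 * (n : ℝ) ^ (-(2 * ((L : ℝ) + β) / (d : ℝ)))) ∧
      ∃ b : (Fin n → RSpace d) → ℝ, Measurable b ∧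
        MemLp b 2 (Measure.pi fun _ : Fin n => Q.map Prod.fst) ∧
        ∫ z, b z ^ 2 ∂(Measure.pi fun _ : Fin n => Q.map Prod.fst) ≤
          C * (CH ^ 2 * (n : ℝ) ^ (-(2 * ((L : ℝ) + β) / (d : ℝ)))) ∧
        ∀ (h : (Fin n → RSpace d) → ℝ), Measurable h → ∀ B : ℝ, (∀ z, ‖h z‖ ≤ B) →
          ∫ p, h (fun i => (p.1 i).1) * (smootherMean m (nnWeight (n := n) L K Sstar) p -
              ∫ x, Sstar.indicator g x ∂ν)
            ∂((Measure.pi fun _ : Fin n => Q).prod (Measure.pi fun _ : Fin m => ν)) =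
          ∫ z, h z * b z ∂(Measure.pi fun _ : Fin n => Q.map Prod.fst) := by
  -- The bias needs the exponent `2 * (L + β) ≤ 2 * L + 2`, so one constant serves all `β ≤ 1`.
  obtain ⟨C₁, hC₁, hcell⟩ := exists_lintegral_cellMoment_le L K hd hK1 hK hc hR (2 * L + 2)
  obtain ⟨C₂, hC₂, hcatch⟩ := exists_lintegral_catchmentMoment_le L K hd hK hc hR
  set c₁ := C₁.toReal with hc₁
  set c₂ := C₂.toReal with hc₂
  set f := Cf.toReal with hf
  have hC₁e : C₁ = ENNReal.ofReal c₁ := (ENNReal.ofReal_toReal hC₁.ne).symm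
  have hC₂e : C₂ = ENNReal.ofReal c₂ := (ENNReal.ofReal_toReal hC₂.ne).symm
  have hCfe : Cf = ENNReal.ofReal f := (ENNReal.ofReal_toReal hCf).symm
  have hc₁0 : 0 ≤ c₁ := ENNReal.toReal_nonneg
  have hc₂0 : 0 ≤ c₂ := ENNReal.toReal_nonneg
  have hf0 : 0 ≤ f := ENNReal.toReal_nonneg
  -- The three summands belong to sampling error, noise and bias; the 3 comes from squaring a sum of
  -- three terms, and the 1 ensures positivity.
  refine ⟨3 * (2 * K * c₁ + f * c₂ + ((d : ℝ) ^ L) ^ 2 * K * c₁) + 1, by positivity, ?_⟩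
  intro Sstar O Q _ ν _ hS hO hOc hSO hμ hμO hlow hν g β CH CG CV hg hgb hβ hβ1 hCH hCV hh hY hreg
    hvar n m hn hm
  have : Nonempty (Fin d) := ⟨⟨0, hd⟩⟩
  have : IsProbabilityMeasure (Q.map Prod.fst) :=
    Measure.isProbabilityMeasure_map measurable_fst.aemeasurable
  set μ := Q.map Prod.fst with hμdef
  set Pz := Measure.pi fun _ : Fin n => μ with hPz
  have hn1 : 1 ≤ n := hK1.trans hn
  have hw : ∀ j, Measurable fun p : RSpace d × (Fin n → RSpace d) =>
      nnWeight L K Sstar p.1 p.2 j := fun j => measurable_nnWeight hS j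
  have hwsum : ∀ (x : RSpace d) (z : Fin n → RSpace d),
      ∑ j, ENNReal.ofReal (nnWeight L K Sstar x z j ^ 2) ≤ cellMoment L K Sstar 0 x z :=
    sum_ofReal_nnWeight_sq_le
  have hwK : ∀ (x : RSpace d) (z : Fin n → RSpace d) (b : Fin n → ℝ),
      (∑ j, nnWeight L K Sstar x z j * b j) ^ 2 ≤
        K * ∑ j, nnWeight L K Sstar x z j ^ 2 * b j ^ 2 := sq_sum_nnWeight_mul_le
  have hwcat : ∀ (x : RSpace d) (z : Fin n → RSpace d) (j : Fin n),
      x ∉ catchment Sstar K z j → nnWeight L K Sstar x z j = 0 :=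
    fun x z j hx => nnWeight_eq_zero_of_notMem_catchment hx
  have hwvol : ∀ (x : RSpace d) (z : Fin n → RSpace d),
      ∑ j, ENNReal.ofReal (nnWeight L K Sstar x z j ^ 2) * volume (catchment Sstar K z j) ≤
        catchmentMoment L K Sstar x z := sum_nnWeight_sq_mul_volume_le
  have hwS : ∀ (x : RSpace d) (z : Fin n → RSpace d) (j : Fin n), x ∉ Sstar →
      nnWeight L K Sstar x z j = 0 := fun x z j hx => nnWeight_eq_zero_of_notMem hx z j
  have hwbias : ∀ x ∈ Sstar, ∀ z : Fin n → RSpace d, (∀ j, z j ∈ O) →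
      (∀ i j, i ≠ j → ‖x - z i‖ ≠ ‖x - z j‖) → cellMoment L K Sstar 0 x z ≠ ∞ →
      ENNReal.ofReal ((∑ j, nnWeight L K Sstar x z j * g (z j) - g x) ^ 2) ≤
        ENNReal.ofReal (((d : ℝ) ^ L) ^ 2 * CH ^ 2 * K) *
          cellMoment L K Sstar (2 * ((L : ℝ) + β)) x z := fun x hx z h1 h2 h3 =>
    ofReal_sq_nnBias_le hO hOc hβ hCH hh hn hx (hSO hx) h1 h2 h3
  -- From here on only the properties of the weights listed above are used.
  generalize nnWeight (n := n) L K Sstar = w at *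
  have hwx : ∀ x j, Measurable fun z => w x z j := fun x j => (hw j).comp measurable_prodMk_left
  have hμac : μ ≪ volume :=
    (Measure.absolutelyContinuous_of_le hμ).trans Measure.smul_absolutelyContinuous
  have hcell0 : ∀ x, ∫⁻ z, cellMoment L K Sstar 0 x z ∂Pz ≤ C₁ := by
    intro x
    by_cases hx : x ∈ Sstar
    · simpa using hcell Sstar μ hS hμ hlow n 0 hn1 le_rfl (by positivity) x hx
    · simp [cellMoment_eq_zero_of_notMem hx]
  have hCvar : ∫⁻ x, ∫⁻ z, ∑ j, ENNReal.ofReal (w x z j ^ 2) ∂Pz ∂ν ≤ C₁ := by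
    refine (lintegral_mono fun x => (lintegral_mono fun z =>
      hwsum x z).trans (hcell0 x)).trans ?_
    simp
  have hint := ae_memLp_of_lintegral_sum_sq_le hw hC₁.ne hCvar
  have hV : ∫⁻ D, ∫⁻ x, ENNReal.ofReal ((∑ j, w x (fun i => (D i).1) j * (D j).2) ^ 2) ∂ν
      ∂(Measure.pi fun _ : Fin n => Q) ≤ ENNReal.ofReal (2 * K * (CG ^ 2 + CV) * c₁) := by
    refine (lintegral_smoother_sq_le hY hg hreg hvar hgb hw
      hwK hCvar).trans_eq ?_
    rw [ENNReal.ofReal_mul (p := 2 * K * (CG ^ 2 + CV)) (by positivity),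
      ENNReal.ofReal_mul (p := 2 * (K : ℝ)) (q := CG ^ 2 + CV) (by positivity),
      ENNReal.ofReal_add (sq_nonneg CG) hCV, ← hC₁e]
  have hW : ∫⁻ z, ∑ j, ENNReal.ofReal (avgWeight ν w z j ^ 2) ∂Pz ≤
      ENNReal.ofReal (f * c₂ * (n : ℝ)⁻¹) := by
    refine (lintegral_sum_avgWeight_sq_le hw (c := fun z j => catchment Sstar K z j)
      (fun j => measurableSet_catchment_prod hS K j) hwcat).trans ?_
    have hle : ∀ x, ∫⁻ z, ∑ j, ENNReal.ofReal (w x z j ^ 2) * ν (catchment Sstar K z j) ∂Pz ≤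
        Cf * (C₂ * ENNReal.ofReal (n : ℝ)⁻¹) := by
      intro x
      have h1 : ∀ z, ∑ j, ENNReal.ofReal (w x z j ^ 2) * ν (catchment Sstar K z j) ≤
          Cf * catchmentMoment L K Sstar x z := by
        intro z
        refine le_trans ?_ (mul_le_mul_right (hwvol x z) _)
        rw [Finset.mul_sum]
        refine Finset.sum_le_sum fun j _ => ?_
        rw [mul_left_comm]
        exact mul_le_mul_right (hν _) _
      refine (lintegral_mono h1).trans ?_
      rw [lintegral_const_mul' _ _ hCf]
      refine mul_le_mul_right ?_ _
      by_cases hx : x ∈ Sstar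
      · exact hcatch Sstar μ hS hμ hlow n hn1 x hx
      · simp [catchmentMoment_eq_zero_of_notMem hx]
    refine (lintegral_mono hle).trans ?_
    rw [lintegral_const, measure_univ, mul_one, hC₂e, hCfe, ← ENNReal.ofReal_mul hc₂0,
      ← ENNReal.ofReal_mul hf0, mul_assoc]
  set e : ℝ := (n : ℝ) ^ (-(2 * ((L : ℝ) + β) / (d : ℝ))) with he
  have he0 : 0 ≤ e := by positivity
  have hφm : Measurable (Sstar.indicator g) := hg.indicator hS
  have hCG0 : 0 ≤ CG := (abs_nonneg _).trans (hgb 0)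
  have hφi : Integrable (Sstar.indicator g) ν := by
    refine Integrable.of_bound hφm.aestronglyMeasurable CG (Filter.Eventually.of_forall fun x => ?_)
    by_cases hx : x ∈ Sstar
    · rw [Set.indicator_of_mem hx]; exact hgb x
    · rw [Set.indicator_of_notMem hx]; simpa using hCG0
  set κ : ℝ := ((d : ℝ) ^ L) ^ 2 * CH ^ 2 * K with hκ
  have hκ0 : 0 ≤ κ := by positivity
  have hB : ∫⁻ z, ENNReal.ofReal ((∑ j, avgWeight ν w z j * g (z j) -
      ∫ x, Sstar.indicator g x ∂ν) ^ 2) ∂Pz ≤ ENNReal.ofReal (κ * c₁ * e) := by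
    refine (lintegral_sq_avgWeight_bias_le hw hg hφm hφi hint).trans ?_
    have hle : ∀ x, ∫⁻ z, ENNReal.ofReal ((∑ j, w x z j * g (z j) - Sstar.indicator g x) ^ 2) ∂Pz ≤
        ENNReal.ofReal (κ * c₁ * e) := by
      intro x
      by_cases hx : x ∈ Sstar
      · have hfin : ∀ᵐ z ∂Pz, cellMoment L K Sstar 0 x z < ∞ :=
          ae_lt_top (measurable_cellMoment_right hS 0 x)
            (ne_top_of_le_ne_top hC₁.ne (hcell0 x))
        have hzO : ∀ᵐ z ∂Pz, ∀ j, z j ∈ O := by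
          rw [ae_all_iff]
          exact fun j => (measurePreserving_eval (fun _ : Fin n => μ) j).quasiMeasurePreserving.ae
            hμO
        have hpt : ∀ᵐ z ∂Pz,
            ENNReal.ofReal ((∑ j, w x z j * g (z j) - Sstar.indicator g x) ^ 2) ≤
            ENNReal.ofReal κ * cellMoment L K Sstar (2 * ((L : ℝ) + β)) x z := by
          filter_upwards [hfin, hzO, ae_pi_norm_sub_ne (n := n) hμac x] with z h1 h2 h3
          rw [Set.indicator_of_mem hx]
          exact hwbias x hx z h2 h3 h1.ne
        refine (lintegral_mono_ae hpt).trans ?_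
        rw [lintegral_const_mul' _ _ ENNReal.ofReal_ne_top, mul_assoc, ENNReal.ofReal_mul hκ0,
          ENNReal.ofReal_mul hc₁0, ← hC₁e]
        refine mul_le_mul_right (hcell Sstar μ hS hμ hlow n _ hn1 (by positivity) ?_ x hx) _
        push_cast
        linarith
      · simp [hwS x _ _ hx, Set.indicator_of_notMem hx]
    refine (lintegral_mono hle).trans ?_
    simp
  obtain ⟨hL, hI, hh'⟩ := smootherMean_sub_memLp_and_integral hm hY hg hreg hCV hvar hw hint
    (by positivity) (by positivity) (by positivity) hV hW hB
  have hn0 : 0 ≤ (n : ℝ)⁻¹ := by positivity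
  have hm0 : 0 ≤ (m : ℝ)⁻¹ := by positivity
  have hK0 : (0 : ℝ) ≤ K := Nat.cast_nonneg K
  have hdL : 0 ≤ ((d : ℝ) ^ L) ^ 2 := by positivity
  refine ⟨hL, hI.trans ?_, _, ?_, ?_, ?_, hh'⟩
  · set T₁ := 2 * K * c₁ with hT₁
    set T₂ := f * c₂ with hT₂
    set T₃ := ((d : ℝ) ^ L) ^ 2 * K * c₁ with hT₃
    have hT₁0 : 0 ≤ T₁ := by positivity
    have hT₂0 : 0 ≤ T₂ := by positivity
    have hT₃0 : 0 ≤ T₃ := by positivity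
    set a₁ := (CV + CG ^ 2) * (m : ℝ)⁻¹ with ha₁
    set a₂ := CV * (n : ℝ)⁻¹ with ha₂
    set a₃ := CH ^ 2 * e with ha₃
    have ha₁0 : 0 ≤ a₁ := by positivity
    have ha₂0 : 0 ≤ a₂ := by positivity
    have ha₃0 : 0 ≤ a₃ := by positivity
    have heq : 3 * ((m : ℝ)⁻¹ * (2 * K * (CG ^ 2 + CV) * c₁) + CV * (f * c₂ * (n : ℝ)⁻¹) +
        κ * c₁ * e) = 3 * (T₁ * a₁ + T₂ * a₂ + T₃ * a₃) := by
      simp only [hT₁, hT₂, hT₃, ha₁, ha₂, ha₃, hκ]; ring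
    rw [heq]
    nlinarith [mul_nonneg hT₁0 ha₂0, mul_nonneg hT₁0 ha₃0, mul_nonneg hT₂0 ha₁0,
      mul_nonneg hT₂0 ha₃0, mul_nonneg hT₃0 ha₁0, mul_nonneg hT₃0 ha₂0]
  · exact (Finset.measurable_sum _ fun j _ => (measurable_avgWeight hw j).mul
      (hg.comp (measurable_pi_apply j))).sub measurable_const
  all_goals
    have hbm : Measurable fun z : Fin n → RSpace d => ∑ j, avgWeight ν w z j * g (z j) -
        ∫ x, Sstar.indicator g x ∂ν :=
      (Finset.measurable_sum _ fun j _ => (measurable_avgWeight hw j).mul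
        (hg.comp (measurable_pi_apply j))).sub measurable_const
    have hbL := memLp_two_of_lintegral_ofReal_sq_lt_top hbm.aestronglyMeasurable
      (hB.trans_lt ENNReal.ofReal_lt_top)
  · exact hbL
  · rw [hbL.lintegral_ofReal_sq, ENNReal.ofReal_le_ofReal_iff (by positivity)] at hB
    refine hB.trans ?_
    have h1 : κ * c₁ * e = (((d : ℝ) ^ L) ^ 2 * K * c₁) * (CH ^ 2 * e) := by rw [hκ]; ring
    rw [h1]
    refine mul_le_mul_of_nonneg_right ?_ (by positivity)
    have h2 : 0 ≤ 2 * K * c₁ := by positivity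
    have h3 : 0 ≤ f * c₂ := by positivity
    have h4 : 0 ≤ ((d : ℝ) ^ L) ^ 2 * K * c₁ := by positivity
    linarith

end NearestNeighborRisk

/-! ### The model reduced to product measures -/

namespace MatchingModel

variable {d n m l : ℕ} {ρ ρ' ρ'' ρbar lamS Cf β CH CG CV : ℝ}
  (M : MatchingModel.{u} d n m l ρ ρ' ρ'' ρbar lamS Cf β CH CG CV)

/-- The regression function, set to zero off the interior of the support. -/
noncomputable def innerG : RSpace d → ℝ := (interior M.S).indicator M.G

/-- The law of the covariate. -/
noncomputable def lawZ : Measure (RSpace d) := M.Q.map Prod.fst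

/-- The law of the additional sample. -/
noncomputable def lawX : Measure (RSpace d) :=
  volume.withDensity fun z => ENNReal.ofReal (M.f z)

instance : IsProbabilityMeasure M.Q := M.isProb_Q

instance : IsProbabilityMeasure M.P := M.isProb_P

instance : IsProbabilityMeasure M.lawX :=
  ⟨by rw [lawX, withDensity_apply _ MeasurableSet.univ, setLIntegral_univ, M.lintegral_f]⟩

instance : IsProbabilityMeasure M.lawZ :=
  Measure.isProbabilityMeasure_map measurable_fst.aemeasurable

theorem Sstar_subset_interior (hρ' : 0 < ρ') : M.Sstar ⊆ interior M.S := fun x hx =>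
  mem_interior.2 ⟨Metric.ball x ρ', M.ball_subset x hx, Metric.isOpen_ball,
    Metric.mem_ball_self hρ'⟩

theorem Sstar_subset (hρ' : 0 < ρ') : M.Sstar ⊆ M.S :=
  (M.Sstar_subset_interior hρ').trans interior_subset

theorem CG_nonneg (M : MatchingModel.{u} d n m l ρ ρ' ρ'' ρbar lamS Cf β CH CG CV)
    (hρ' : 0 < ρ') : 0 ≤ CG := by
  obtain ⟨x, hx⟩ := M.nonempty_Sstar
  exact (abs_nonneg _).trans (M.holder_G.bounded x (M.Sstar_subset_interior hρ' hx))

theorem ρbar_nonneg (M : MatchingModel.{u} d n m l ρ ρ' ρ'' ρbar lamS Cf β CH CG CV)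
    (hρ : 0 < ρ) (hρ' : 0 < ρ') : 0 ≤ ρbar := by
  obtain ⟨x, hx⟩ := M.nonempty_Sstar
  have hxS := M.Sstar_subset hρ' hx
  exact hρ.le.trans ((M.fZ_lower x hxS).trans (M.fZ_upper x hxS))

theorem measurable_innerG : Measurable M.innerG := by
  classical
  rw [innerG, ← Set.piecewise_eq_indicator]
  exact M.holder_G.contDiffOn.continuousOn.measurable_piecewise continuousOn_const
    isOpen_interior.measurableSet

theorem abs_innerG_le (hρ' : 0 < ρ') (z : RSpace d) : |M.innerG z| ≤ CG := by
  by_cases hz : z ∈ interior M.S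
  · rw [innerG, Set.indicator_of_mem hz]
    exact M.holder_G.bounded z hz
  · rw [innerG, Set.indicator_of_notMem hz, abs_zero]
    exact M.CG_nonneg hρ'

theorem isBoundedHolder_innerG : IsBoundedHolder (interior M.S) l β CH CG M.innerG := by
  have heq : ∀ z ∈ interior M.S, M.innerG z = M.G z := fun z hz => Set.indicator_of_mem hz _
  have hev : ∀ z ∈ interior M.S,
      iteratedFDeriv ℝ l M.innerG z = iteratedFDeriv ℝ l M.G z := fun z hz =>
    (Filter.EventuallyEq.iteratedFDeriv ℝ
      (Filter.eventuallyEq_of_mem (isOpen_interior.mem_nhds hz) heq) l).eq_of_nhds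
  refine ⟨M.holder_G.contDiffOn.congr heq, fun i z hz z' hz' => ?_, fun z hz => ?_⟩
  · rw [hev z hz, hev z' hz']
    exact M.holder_G.holder i z hz z' hz'
  · rw [heq z hz]
    exact M.holder_G.bounded z hz

theorem lawZ_le (hρ : 0 < ρ) (hρ' : 0 < ρ') : M.lawZ ≤ ENNReal.ofReal ρbar • volume := by
  rw [lawZ, M.law_Z, ← withDensity_const]
  refine withDensity_mono (Filter.Eventually.of_forall fun z => ENNReal.ofReal_le_ofReal ?_)
  by_cases hz : z ∈ M.S
  · exact M.fZ_upper z hz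
  · rw [M.fZ_off z hz]
    exact M.ρbar_nonneg hρ hρ'

theorem lawX_le : M.lawX ≤ ENNReal.ofReal Cf • volume := by
  rw [lawX, ← withDensity_const]
  exact withDensity_mono (Filter.Eventually.of_forall fun z => ENNReal.ofReal_le_ofReal (M.f_le z))

/-- The frontier of a convex set is a null set, and the law of the covariate has a density. Values
of `G` outside the interior are thus irrelevant. -/
theorem ae_mem_interior : ∀ᵐ t ∂M.lawZ, t ∈ interior M.S := by
  have hac : M.lawZ ≪ volume := by
    rw [lawZ, M.law_Z]
    exact withDensity_absolutelyContinuous _ _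
  have h1 : ∀ᵐ t ∂M.lawZ, t ∉ frontier M.S :=
    measure_eq_zero_iff_ae_notMem.1 (hac (M.convex_S.addHaar_frontier volume))
  have h2 : ∀ᵐ t ∂M.lawZ, t ∈ M.S := by
    have h0 : M.lawZ M.Sᶜ = 0 := by
      rw [lawZ, M.law_Z, withDensity_apply _ M.isCompact_S.measurableSet.compl,
        setLIntegral_eq_zero M.isCompact_S.measurableSet.compl]
      intro z hz
      simp [M.fZ_off z hz]
    filter_upwards [measure_eq_zero_iff_ae_notMem.1 h0] with t ht using Set.notMem_compl_iff.1 ht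
  filter_upwards [h1, h2] with t ht1 ht2
  by_contra ht
  exact ht1 (by rw [M.isCompact_S.isClosed.frontier_eq]; exact ⟨ht2, ht⟩)

/-- The distance of two points of the support is at most the diameter. Shrinking the ball by the
factor `ρ' / max ρ'' ρ'` brings its radius below `ρ'`, so the smaller ball lies in the support,
where the density is at least `ρ`. The maximum keeps the factor at most 1. -/
theorem mul_dist_pow_le_lawZ_closedBall (hd : 1 ≤ d) (hρ : 0 < ρ) (hρ' : 0 < ρ')
    {x : RSpace d} (hx : x ∈ M.Sstar) {t : RSpace d} (ht : t ∈ M.S) :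
    ρ * (volume : Measure (RSpace d)).real (Metric.ball 0 1) * (ρ' / max ρ'' ρ') ^ d *
      dist t x ^ d ≤ M.lawZ.real (Metric.closedBall x (dist t x)) := by
  have : Nonempty (Fin d) := ⟨⟨0, hd⟩⟩
  set r := dist t x with hr
  set s := ρ' / max ρ'' ρ' * r with hs
  have hmax : 0 < max ρ'' ρ' := lt_max_of_lt_right hρ'
  have hr0 : 0 ≤ r := dist_nonneg
  have hs0 : 0 ≤ s := by positivity
  have hrρ : r ≤ max ρ'' ρ' := by
    refine le_max_of_le_left ?_
    rw [← M.diam_S]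
    exact Metric.dist_le_diam_of_mem M.isCompact_S.isBounded ht (M.Sstar_subset hρ' hx)
  have hsr : s ≤ r := mul_le_of_le_one_left hr0 ((div_le_one hmax).2 (le_max_right _ _))
  have hsρ : s ≤ ρ' := by
    rw [hs, div_mul_eq_mul_div, div_le_iff₀ hmax]
    exact mul_le_mul_of_nonneg_left hrρ hρ'.le
  have hsub : Metric.ball x s ⊆ M.S := (Metric.ball_subset_ball hsρ).trans (M.ball_subset x hx)
  have hlow : ENNReal.ofReal ρ * volume (Metric.ball x s) ≤ M.lawZ (Metric.closedBall x r) := by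
    refine le_trans ?_ (measure_mono (Metric.ball_subset_closedBall.trans
      (Metric.closedBall_subset_closedBall hsr)))
    rw [lawZ, M.law_Z, withDensity_apply _ measurableSet_ball, ← setLIntegral_const]
    exact setLIntegral_mono' measurableSet_ball fun z hz =>
      ENNReal.ofReal_le_ofReal (M.fZ_lower z (hsub hz))
  have h2 := ENNReal.toReal_mono (measure_ne_top _ _) hlow
  rw [ENNReal.toReal_mul, ENNReal.toReal_ofReal hρ.le, Measure.addHaar_ball _ _ hs0,
    ENNReal.toReal_mul, ENNReal.toReal_ofReal (by positivity), finrank_euclideanSpace,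
    Fintype.card_fin] at h2
  refine le_of_eq_of_le ?_ h2
  rw [hs, mul_pow, Measure.real]
  ring

theorem Q_condExp_eq_innerG :
    M.Q[(fun p : RSpace d × ℝ => p.2) | MeasurableSpace.comap Prod.fst inferInstance]
      =ᵐ[M.Q] fun p => M.innerG p.1 := by
  have h := M.ae_mem_interior
  rw [lawZ] at h
  filter_upwards [M.regression, ae_of_ae_map measurable_fst.aemeasurable h] with p hp hpS
  rw [hp, innerG, Set.indicator_of_mem hpS]

/-- The weight `1_{S*} f / fZ` is a bounded function of the covariate, so the response may be
replaced by the regression function; then `fZ` cancels. -/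
theorem Phi_eq (hρ : 0 < ρ) (hρ' : 0 < ρ') :
    M.Phi = ∫ x, M.Sstar.indicator M.innerG x ∂M.lawX := by
  set h : RSpace d → ℝ := fun z => M.Sstar.indicator (fun _ => (1 : ℝ)) z * (M.f z / M.fZ z)
    with hh
  have hhm : Measurable h :=
    (measurable_const.indicator M.measurableSet_Sstar).mul (M.measurable_f.div M.measurable_fZ)
  have hfZ : ∀ z ∈ M.Sstar, 0 < M.fZ z := fun z hz =>
    hρ.trans_le (M.fZ_lower z (M.Sstar_subset hρ' hz))
  have hhb : ∀ z, ‖h z‖ ≤ Cf / ρ := by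
    intro z
    have hCf0 : 0 ≤ Cf := (M.f_nonneg z).trans (M.f_le z)
    by_cases hz : z ∈ M.Sstar
    · simp only [hh, Set.indicator_of_mem hz, one_mul]
      rw [Real.norm_of_nonneg (div_nonneg (M.f_nonneg z) (hfZ z hz).le)]
      exact div_le_div₀ hCf0 (M.f_le z) hρ (M.fZ_lower z (M.Sstar_subset hρ' hz))
    · simp only [hh, Set.indicator_of_notMem hz, zero_mul, norm_zero]
      positivity
  have hYi : Integrable (fun p : RSpace d × ℝ => p.2 * h p.1) M.Q := by
    simp_rw [mul_comm _ (h _)]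
    exact (M.memLp_Y.integrable (by norm_num)).bdd_mul
      (hhm.comp measurable_fst).aestronglyMeasurable (Filter.Eventually.of_forall fun p => hhb p.1)
  have hGi : Integrable (fun p : RSpace d × ℝ => M.innerG p.1 * h p.1) M.Q := by
    simp_rw [mul_comm _ (h _)]
    exact (integrable_condExp.congr M.Q_condExp_eq_innerG).bdd_mul
      (hhm.comp measurable_fst).aestronglyMeasurable (Filter.Eventually.of_forall fun p => hhb p.1)
  have h0 := integral_residual_mul_eq_zero M.memLp_Y M.Q_condExp_eq_innerG hhm
  simp_rw [sub_mul] at h0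
  rw [integral_sub hYi hGi, sub_eq_zero] at h0
  have h1 : M.Phi = ∫ p, p.2 * h p.1 ∂M.Q := by
    rw [Phi]
    simp only [hh, mul_assoc]
  have h2 : ∫ p, M.innerG p.1 * h p.1 ∂M.Q = ∫ z, M.innerG z * h z ∂(M.Q.map Prod.fst) :=
    (integral_map measurable_fst.aemeasurable
      (M.measurable_innerG.mul hhm).aestronglyMeasurable).symm
  rw [h1, h0, h2, M.law_Z, lawX, integral_withDensity_eq_integral_toReal_smul
      M.measurable_fZ.ennreal_ofReal (by simp),
    integral_withDensity_eq_integral_toReal_smul M.measurable_f.ennreal_ofReal (by simp)]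
  refine integral_congr_ae (Filter.Eventually.of_forall fun z => ?_)
  by_cases hz : z ∈ M.Sstar
  · simp only [hh, Set.indicator_of_mem hz, one_mul, smul_eq_mul]
    rw [ENNReal.toReal_ofReal (hfZ z hz).le, ENNReal.toReal_ofReal (M.f_nonneg z)]
    field_simp [(hfZ z hz).ne']
  · simp [hh, Set.indicator_of_notMem hz]

/-- The two samples. -/
def samples (ω : M.Ω) : (Fin n → RSpace d × ℝ) × (Fin m → RSpace d) :=
  (fun j => (M.Z j ω, M.Y j ω), fun k => M.X k ω)

theorem measurable_samples : Measurable M.samples :=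
  (measurable_pi_lambda _ fun j => (M.measurable_Z j).prodMk (M.measurable_Y j)).prodMk
    (measurable_pi_lambda _ fun k => M.measurable_X k)

theorem measurePreserving_samples : MeasurePreserving M.samples M.P
    ((Measure.pi fun _ : Fin n => M.Q).prod (Measure.pi fun _ : Fin m => M.lawX)) := by
  refine ⟨M.measurable_samples, ?_⟩
  have hZY : ∀ j, Measurable fun ω => (M.Z j ω, M.Y j ω) := fun j =>
    (M.measurable_Z j).prodMk (M.measurable_Y j)
  have h1 := (iIndepFun_iff_map_fun_eq_pi_map fun j => (hZY j).aemeasurable).1 M.indep_ZY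
  have h2 := (iIndepFun_iff_map_fun_eq_pi_map fun k => (M.measurable_X k).aemeasurable).1 M.indep_X
  have h3 := (indepFun_iff_map_prod_eq_prod_map_map
    (measurable_pi_lambda _ hZY).aemeasurable
    (measurable_pi_lambda _ M.measurable_X).aemeasurable).1 M.indep_samples
  simp only [M.law_ZY] at h1
  simp only [M.law_X] at h2
  rw [h1, h2] at h3
  exact h3

theorem PhiHat_eq (K : ℕ) (ω : M.Ω) :
    M.PhiHat K ω = smootherMean m (nnWeight (n := n) l K M.Sstar) (M.samples ω) := by
  rw [PhiHat, matchingEstimator_eq, smootherMean]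
  simp only [nnFit_eq_sum, samples]

end MatchingModel

/-! ### The risk bound and its consequences -/

theorem MatchingModel.exists_risk_le (d l K : ℕ) (hd : 1 ≤ d) (hK1 : 1 ≤ K)
    (hK : (2 * DConst d l + 1) * numMonomials d l ≤ K)
    (ρ ρ' ρ'' ρbar lamS Cf : ℝ) (hρ : 0 < ρ) (hρ' : 0 < ρ') :
    ∃ C : ℝ, 0 < C ∧ ∀ β CH CG CV : ℝ, 0 < β → β ≤ 1 → 0 < CH → 0 < CV →
      ∀ n m : ℕ, K ≤ n → 1 ≤ m →
        ∀ M : MatchingModel.{u} d n m l ρ ρ' ρ'' ρbar lamS Cf β CH CG CV,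
          (Integrable (fun ω => (M.PhiHat K ω - M.Phi) ^ 2) M.P ∧
          ∫ ω, (M.PhiHat K ω - M.Phi) ^ 2 ∂M.P ≤
            C * ((CV + CG ^ 2) * (m : ℝ)⁻¹ + CV * (n : ℝ)⁻¹ +
              CH ^ 2 * (n : ℝ) ^ (-(2 * ((l : ℝ) + β) / (d : ℝ))))) ∧
          Integrable (fun ω => ((M.P[M.PhiHat K | M.sigmaZ]) ω - M.Phi) ^ 2) M.P ∧
          ∫ ω, ((M.P[M.PhiHat K | M.sigmaZ]) ω - M.Phi) ^ 2 ∂M.P ≤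
            C * (CH ^ 2 * (n : ℝ) ^ (-(2 * ((l : ℝ) + β) / (d : ℝ)))) := by
  have : Nonempty (Fin d) := ⟨⟨0, hd⟩⟩
  have hc : 0 < ρ * (volume : Measure (RSpace d)).real (Metric.ball 0 1) *
      (ρ' / max ρ'' ρ') ^ d := by
    have h1 : 0 < (volume : Measure (RSpace d)).real (Metric.ball 0 1) :=
      ENNReal.toReal_pos (Metric.measure_ball_pos _ _ one_pos).ne' measure_ball_lt_top.ne
    have h2 : 0 < max ρ'' ρ' := lt_max_of_lt_right hρ'
    positivity
  obtain ⟨C, hC, hrisk⟩ := exists_nnFit_risk_le l K hd hK1 hK hc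
    (ENNReal.ofReal_ne_top (r := ρbar)) (ENNReal.ofReal_ne_top (r := Cf))
  refine ⟨C, hC, fun β CH CG CV hβ hβ1 hCH hCV n m hn hm M => ?_⟩
  obtain ⟨hL, hI, b, hbm, hbL, hbI, hbh⟩ := hrisk M.Sstar (interior M.S) M.Q M.lawX
    M.measurableSet_Sstar isOpen_interior M.convex_S.interior (M.Sstar_subset_interior hρ')
    (M.lawZ_le hρ hρ') M.ae_mem_interior
    (fun x hx => M.ae_mem_interior.mono fun t ht =>
      M.mul_dist_pow_le_lawZ_closedBall hd hρ hρ' hx (interior_subset ht))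
    M.lawX_le M.innerG β CH CG CV M.measurable_innerG (M.abs_innerG_le hρ') hβ hβ1 hCH.le hCV.le
    M.isBoundedHolder_innerG M.memLp_Y M.Q_condExp_eq_innerG M.condVar_le n m hn hm
  rw [← M.Phi_eq hρ hρ'] at hL hI hbh
  have hs := M.measurePreserving_samples
  set κ := (Measure.pi fun _ : Fin n => M.Q).prod (Measure.pi fun _ : Fin m => M.lawX) with hκ
  have hsm : Measurable (smootherMean m (nnWeight (n := n) l K M.Sstar)) :=
    measurable_smootherMean fun j => measurable_nnWeight M.measurableSet_Sstar j
  have hLP : MemLp (fun ω => M.PhiHat K ω - M.Phi) 2 M.P := by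
    simp_rw [M.PhiHat_eq]
    exact hL.comp_measurePreserving hs
  have hIP : ∫ ω, (M.PhiHat K ω - M.Phi) ^ 2 ∂M.P =
      ∫ p, (smootherMean m (nnWeight (n := n) l K M.Sstar) p - M.Phi) ^ 2 ∂κ := by
    simp_rw [M.PhiHat_eq]
    exact hs.integral_comp_of_measurable
      (F := fun p => (smootherMean m (nnWeight (n := n) l K M.Sstar) p - M.Phi) ^ 2)
      ((hsm.sub measurable_const).pow_const 2)
  have hZmp : MeasurePreserving (fun ω j => M.Z j ω) M.P
      (Measure.pi fun _ : Fin n => M.Q.map Prod.fst) :=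
    measurePreserving_pi_fst.comp (measurePreserving_fst.comp hs)
  have hPi : Integrable (fun ω => M.PhiHat K ω - M.Phi) M.P := hLP.integrable (by norm_num)
  have hPhi : Integrable (M.PhiHat K) M.P :=
    (hPi.add (integrable_const M.Phi)).congr (Filter.Eventually.of_forall fun ω => by simp)
  have hbZ : MemLp (fun ω => b fun j => M.Z j ω) 2 M.P := hbL.comp_measurePreserving hZmp
  have hbZi : Integrable (fun ω => b fun j => M.Z j ω) M.P := hbZ.integrable (by norm_num)
  have hle : M.sigmaZ ≤ M.mΩ := hZmp.measurable.comap_le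
  -- The weak identity for `b`, tested with indicators of sets `{Z ∈ B}`, characterizes the
  -- conditional expectation.
  have hcond : (fun ω => M.Phi + b fun j => M.Z j ω) =ᵐ[M.P] M.P[M.PhiHat K | M.sigmaZ] := by
    refine ae_eq_condExp_of_forall_setIntegral_eq hle hPhi
      (fun s _ _ => ((integrable_const _).add hbZi).integrableOn) ?_ ?_
    · rintro s ⟨B, hB, rfl⟩ -
      have h1 := hbh (B.indicator fun _ => 1) (measurable_const.indicator hB) 1 (fun z => by
        by_cases hz : z ∈ B
        · simp [Set.indicator_of_mem hz]
        · simp [Set.indicator_of_notMem hz])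
      have h2 : ∫ ω, B.indicator (fun _ => (1 : ℝ)) (fun j => M.Z j ω) *
          (M.PhiHat K ω - M.Phi) ∂M.P =
          ∫ ω, B.indicator (fun _ => (1 : ℝ)) (fun j => M.Z j ω) * b (fun j => M.Z j ω) ∂M.P := by
        have h3 := hs.integral_comp_of_measurable
          (F := fun p => B.indicator (fun _ => (1 : ℝ)) (fun i => (p.1 i).1) *
            (smootherMean m (nnWeight (n := n) l K M.Sstar) p - M.Phi))
          (((measurable_const.indicator hB).comp (measurable_fst_pi.comp measurable_fst)).mul
            (hsm.sub measurable_const))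
        have h4 := hZmp.integral_comp_of_measurable
          (F := fun z => B.indicator (fun _ => (1 : ℝ)) z * b z)
          ((measurable_const.indicator hB).mul hbm)
        rw [h4, ← h1, ← h3]
        simp_rw [M.PhiHat_eq]
        rfl
      have hpre : MeasurableSet ((fun ω j => M.Z j ω) ⁻¹' B) := hZmp.measurable hB
      have hind : ∀ F : M.Ω → ℝ, ∫ ω, B.indicator (fun _ => (1 : ℝ)) (fun j => M.Z j ω) * F ω ∂M.P =
          ∫ ω in (fun ω j => M.Z j ω) ⁻¹' B, F ω ∂M.P := by
        intro F
        rw [← integral_indicator hpre]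
        refine integral_congr_ae (Filter.Eventually.of_forall fun ω => ?_)
        by_cases hω : (fun j => M.Z j ω) ∈ B
        · have hω' : ω ∈ (fun ω j => M.Z j ω) ⁻¹' B := hω
          simp only [Set.indicator_of_mem hω, Set.indicator_of_mem hω', one_mul]
        · have hω' : ω ∉ (fun ω j => M.Z j ω) ⁻¹' B := hω
          simp only [Set.indicator_of_notMem hω, Set.indicator_of_notMem hω', zero_mul]
      rw [hind, hind, integral_sub hPhi.integrableOn (integrable_const _).integrableOn] at h2
      rw [integral_add (integrable_const _).integrableOn hbZi.integrableOn, ← h2]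
      ring
    · have hb' : Measurable[M.sigmaZ] fun ω => b fun j => M.Z j ω :=
        hbm.comp (comap_measurable _)
      exact (hb'.const_add M.Phi).stronglyMeasurable.aestronglyMeasurable
  have hcondsq : (fun ω => (b fun j => M.Z j ω) ^ 2) =ᵐ[M.P]
      fun ω => ((M.P[M.PhiHat K | M.sigmaZ]) ω - M.Phi) ^ 2 := by
    filter_upwards [hcond] with ω hω
    rw [← hω]
    ring
  refine ⟨⟨hLP.integrable_sq, hIP.trans_le hI⟩, hbZ.integrable_sq.congr hcondsq, ?_⟩
  rw [← integral_congr_ae hcondsq]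
  exact (hZmp.integral_comp_of_measurable (F := fun z => b z ^ 2) (hbm.pow_const 2)).trans_le hbI

theorem DConst_zero (d : ℕ) : DConst d 0 = 0 := by simp [DConst]

theorem numMonomials_zero (d : ℕ) : numMonomials d 0 = 1 := by simp [numMonomials]

/-- A power of exponent below `-1` is eventually smaller than any multiple of the inverse. -/
theorem exists_forall_mul_rpow_le_mul_inv {p : ℝ} (hp : 1 < p) {T ε : ℝ} (hε : 0 < ε) :
    ∃ N : ℕ, ∀ n : ℕ, N ≤ n → 1 ≤ n → T * (n : ℝ) ^ (-p) ≤ ε * (n : ℝ)⁻¹ := by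
  have hlim : Filter.Tendsto (fun n : ℕ => T * (n : ℝ) ^ (-(p - 1))) Filter.atTop (nhds 0) := by
    have h := (tendsto_rpow_neg_atTop (y := p - 1) (by linarith)).comp
      (tendsto_natCast_atTop_atTop (R := ℝ))
    simpa using h.const_mul T
  obtain ⟨N, hN⟩ := Filter.eventually_atTop.1 (hlim.eventually_le_const hε)
  refine ⟨N, fun n hn hn1 => ?_⟩
  have hn0 : (0 : ℝ) < n := by exact_mod_cast hn1
  have h1 : (n : ℝ) ^ (-p) = (n : ℝ) ^ (-(p - 1)) * (n : ℝ)⁻¹ := by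
    rw [← Real.rpow_neg_one, ← Real.rpow_add hn0]
    ring_nf
  rw [h1, ← mul_assoc]
  exact mul_le_mul_of_nonneg_right (hN n hn) (by positivity)

theorem theorem2 (d l K : ℕ) (hd : 2 ≤ d)
    (hK : (l = 0 ∧ 1 ≤ K) ∨ (1 ≤ l ∧ 2 + (2 * DConst d l + 1) * numMonomials d l ≤ K))
    (ρ ρ' ρ'' ρbar lamS Cf : ℝ) (hρ : 0 < ρ) (hρ' : 0 < ρ') :
    ∃ C : ℝ, 0 < C ∧ ∀ β CH CG CV : ℝ, 0 < β → β ≤ 1 → 0 < CH → 0 < CV →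
      -- the risk bound
      (∀ n m : ℕ, K ≤ n → 1 ≤ m →
        ∀ M : MatchingModel.{u} d n m l ρ ρ' ρ'' ρbar lamS Cf β CH CG CV,
          Integrable (fun ω => (M.PhiHat K ω - M.Phi) ^ 2) M.P ∧
          ∫ ω, (M.PhiHat K ω - M.Phi) ^ 2 ∂M.P ≤
            C * ((CV + CG ^ 2) * (m : ℝ)⁻¹ + CV * (n : ℝ)⁻¹ +
              CH ^ 2 * (n : ℝ) ^ (-(2 * ((l : ℝ) + β) / (d : ℝ))))) ∧
      -- the parametric rate
      ((d : ℝ) / 2 ≤ (l : ℝ) + β →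
        ∃ C' : ℝ, 0 < C' ∧ ∀ n m : ℕ, K ≤ n → 1 ≤ m →
          ∀ M : MatchingModel.{u} d n m l ρ ρ' ρ'' ρbar lamS Cf β CH CG CV,
            ∫ ω, (M.PhiHat K ω - M.Phi) ^ 2 ∂M.P ≤ C' * ((n : ℝ)⁻¹ + (m : ℝ)⁻¹)) ∧
      -- the mean squared conditional bias is of smaller order than `1 / n`
      ((d : ℝ) / 2 < (l : ℝ) + β →
        ∀ ε : ℝ, 0 < ε → ∃ N : ℕ, ∀ n m : ℕ, N ≤ n → K ≤ n → 1 ≤ m →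
          ∀ M : MatchingModel.{u} d n m l ρ ρ' ρ'' ρbar lamS Cf β CH CG CV,
            Integrable (fun ω => ((M.P[M.PhiHat K | M.sigmaZ]) ω - M.Phi) ^ 2) M.P ∧
            ∫ ω, ((M.P[M.PhiHat K | M.sigmaZ]) ω - M.Phi) ^ 2 ∂M.P ≤ ε * (n : ℝ)⁻¹) := by
  have hK1 : 1 ≤ K := by
    rcases hK with h | h
    · exact h.2
    · have := h.2
      omega
  have hK2 : (2 * DConst d l + 1) * numMonomials d l ≤ K := by
    -- For `l = 0` the constant `D` is 0 and there is one monomial, so the requirement is just `1 ≤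
    -- K`.
    rcases hK with ⟨rfl, h⟩ | h
    · simpa [DConst_zero, numMonomials_zero] using h
    · have := h.2
      omega
  have hd0 : (0 : ℝ) < d := by
    have : 0 < d := by omega
    exact_mod_cast this
  obtain ⟨C, hC, hrisk⟩ := MatchingModel.exists_risk_le.{u} d l K (by omega) hK1 hK2
    ρ ρ' ρ'' ρbar lamS Cf hρ hρ'
  refine ⟨C, hC, fun β CH CG CV hβ hβ1 hCH hCV =>
    ⟨fun n m hn hm M => (hrisk β CH CG CV hβ hβ1 hCH hCV n m hn hm M).1, fun hrate => ?_,
      fun hrate ε hε => ?_⟩⟩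
  · refine ⟨C * (CV + CG ^ 2 + CH ^ 2), by positivity, fun n m hn hm M => ?_⟩
    refine (hrisk β CH CG CV hβ hβ1 hCH hCV n m hn hm M).1.2.trans ?_
    rw [mul_assoc]
    refine mul_le_mul_of_nonneg_left ?_ hC.le
    have hn1 : (1 : ℝ) ≤ n := by exact_mod_cast hK1.trans hn
    -- The rate condition says that the bias exponent is at least 1.
    have hexp : (n : ℝ) ^ (-(2 * ((l : ℝ) + β) / (d : ℝ))) ≤ (n : ℝ)⁻¹ := by
      rw [← Real.rpow_neg_one]
      refine Real.rpow_le_rpow_of_exponent_le hn1 (neg_le_neg ?_)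
      rw [le_div_iff₀ hd0]
      linarith
    have hn0 : 0 ≤ (n : ℝ)⁻¹ := by positivity
    have hm0 : 0 ≤ (m : ℝ)⁻¹ := by positivity
    nlinarith [mul_le_mul_of_nonneg_left hexp (sq_nonneg CH), mul_nonneg (sq_nonneg CH) hm0,
      mul_nonneg (sq_nonneg CG) hn0, mul_nonneg hCV.le hm0, mul_nonneg hCV.le hn0]
  · have hp : 1 < 2 * ((l : ℝ) + β) / (d : ℝ) := by
      rw [lt_div_iff₀ hd0]
      linarith
    -- `N` is chosen before `m` and the model, which gives uniformity in both.
    obtain ⟨N, hN⟩ := exists_forall_mul_rpow_le_mul_inv hp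
      (T := C * CH ^ 2) hε
    refine ⟨N, fun n m hNn hn hm M => ?_⟩
    obtain ⟨-, hi, hb⟩ := hrisk β CH CG CV hβ hβ1 hCH hCV n m hn hm M
    refine ⟨hi, hb.trans ?_⟩
    rw [← mul_assoc]
    exact hN n hNn (hK1.trans hn)
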